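/- **Setting.** Let $(\Omega,\mathcal F,\mathbb P)$ be a complete probability space with a filtration $(\mathcal F_t)_{t\ge 0}$ satisfying the usual conditions, let $H,G$ be real separable Hilbert spaces, $U$ a topological space and $\mathcal R\subseteq\mathcal B(U)$ a ring generating $\mathcal B(U)$. Let $\mu$ be a $\sigma$-finite measure on $\mathcal B(U)$, finite on $\mathcal R$, such that $U$ is, up to a $\mu$-null set, a countable union of sets of $\mathcal R$; let $\lambda$ be a measure on $\mathcal B(\mathbb R_+)$ that is finite on bounded intervals. For a continuous Hilbertian seminorm $q$ on $H$ (with bilinear form $q(\cdot,\cdot)$) let $H_q$ be the Hilbert space completion of $(H/\ker q,q)$ and $i_q:H\to H_q$ the canonical map; for $p\le q$ let $i_{p,q}:H_q\to H_p$ be the continuous linear map with $i_p=i_{p,q}\circ i_q$. Let $\mathcal L_2$ denote Hilbert–Schmidt operators. A *cylindrical martingale-valued measure* on $\mathbb R_+\times\mathcal R$ is a family $M=(M(t,A):t\ge0,A\in\mathcal R)$ of linear maps $H\to L^0(\Omega,\mathcal F,\mathbb P)$, continuous for convergence in probability, such that, for each $h\in H$, almost surely: $M(0,A)(h)=0$,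 $M(t,\emptyset)(h)=0$, $M(t,A\cup B)(h)=M(t,A)(h)+M(t,B)(h)$ for disjoint $A,B\in\mathcal R$; each $(M(t,A)(h))_{t\ge0}$ is a mean-zero square integrable martingale; and $\mathbb E[M(t,A)(h_1)M(s,B)(h_2)]=0$ for disjoint $A,B\in\mathcal R$ and all $s,t\ge 0$, $h_1,h_2\in H$. Write $M((s,t],A)=M(t,A)-M(s,A)$. Consider moreover the properties: * (I) for all $0\le s<t$ the family $\{M((s,t],A)(h):A\in\mathcal R,h\in H\}$ is independent of $\mathcal F_s$; * (C) $\mathbb E|M((s,t],A)(h)|^2=\int_{(s,t]}\int_A q_{r,u}(h)^2\,\mu(du)\lambda(dr)$ for all $0\le s<t$, $A\in\mathcal R$, $h\in H$, where $q=\{q_{r,u}\}$ is a family of continuous Hilbertian seminorms on $H$ such that for all $h_1,h_2\in H$ the map $(r,u)\mapsto q_{r,u}(h_1,h_2)$ is $\mathcal B(\mathbb R_+)\otimes\mathcal B(U)$-measurable and bounded on $[0,T]\times U$ for all $T>0$. If $M$ satisfies (C) with $q$, then $\Lambda^2(M,T)=\Lambda^2(M,T;H,G)$ is the set of families $\Phi(r,\omega,u)\in\mathcal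 L_2(H_{q_{r,u}},G)$, $(r,\omega,u)\in[0,T]\times\Omega\times U$, such that $(r,\omega,u)\mapsto q_{r,u}(\Phi(r,\omega,u)^*g,i_{q_{r,u}}h)$ is $\mathcal P_T\otimes\mathcal B(U)$-measurable for all $h\in H,g\in G$ ($\mathcal P_T$ the predictable $\sigma$-algebra on $[0,T]\times\Omega$), and $\|\Phi\|^2_{\Lambda^2(M,T)}=\mathbb E\int_{(0,T]}\int_U\|\Phi(r,u)\|^2_{\mathcal L_2(H_{q_{r,u}},G)}\mu(du)\lambda(dr)<\infty$. For a simple integrand $\Phi=\sum_{i\le n}\sum_{j\le m}\mathbb 1_{(s_i,t_i]}(r)\mathbb 1_{F_i}(\omega)\mathbb 1_{A_j}(u)\,S_{i,j}\circ i_{q_{r,u}}^*$ with $0\le s_i<t_i\le T$, $F_i\in\mathcal F_{s_i}$, $A_j\in\mathcal R$, $S_{i,j}\in\mathcal L_2(H,G)$, put $I_t(\Phi)=\sum_{i,j}\mathbb 1_{F_i}Y_t(s_i,t_i,A_j,S_{i,j})$, where $Y(s,t,A,S)$ is the $G$-valued càdlàg square integrable martingale on $[0,T]$ with $\langle Y_r(s,t,A,S),g\rangle=M((s\wedge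 r,t\wedge r],A)(S^*g)$ a.s. for all $r\in[0,T]$, $g\in G$. A $G$-valued càdlàg square integrable martingale $X$ on $[0,T]$ is called the stochastic integral $\big(\int_0^t\int_U\Phi(r,u)\,M(dr,du)\big)_{t\in[0,T]}$ of $\Phi\in\Lambda^2(M,T)$ if there are simple integrands $\Phi_k$ with $\|\Phi_k-\Phi\|_{\Lambda^2(M,T)}\to0$ and $\mathbb E\sup_{t\le T}\|I_t(\Phi_k)-X_t\|^2\to0$. **Proposition.** Let $N_1,N_2$ be two cylindrical martingale-valued measures on $\mathbb R_+\times\mathcal R$, each satisfying (I), and satisfying (C) with the same $\mu,\lambda$ and with families of seminorms $p^1=\{p^1_{r,u}\}$ and $p^2=\{p^2_{r,u}\}$ respectively. Assume that for all $A,B\in\mathcal R$ the cylindrical processes $(N_1(t,A))_{t\ge0}$ and $(N_2(t,B))_{t\ge0}$ are independent. Put $M(t,A)=N_1(t,A)+N_2(t,A)$ for $t\ge 0$, $A\in\mathcal R$. Then $M$ is a cylindrical martingale-valued measure satisfying (C) for $\mu,\lambda$ and the family $q$ of continuous Hilbertian seminorms with $q_{r,u}(h)^2=p^1_{r,u}(h)^2+p^2_{r,u}(h)^2$.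 If, in addition, for all $0\le s<t$ the joint family $\{N_1((s,t],A)(h),N_2((s,t],A)(h):A\in\mathcal R,h\in H\}$ is independent of $\mathcal F_s$, then $M$ also satisfies (I). Moreover (without this additional assumption), for every $T>0$ and $\Phi\in\Lambda^2(M,T)$: 1. for $j=1,2$, the family $\Phi(r,\omega,u)\circ i^*_{p^j_{r,u},q_{r,u}}$ belongs to $\Lambda^2(N_j,T)$; 2. the stochastic integrals of $\Phi$ with respect to $M$ and of $\Phi\circ i^*_{p^j,q}$ with respect to $N_j$ ($j=1,2$) exist, are unique up to indistinguishability, and $\mathbb P$-a.s., for all $t\in[0,T]$, $$\int_0^t\!\!\int_U\Phi(r,u)\,M(dr,du)=\int_0^t\!\!\int_U\Phi(r,u)\circ i^*_{p^1_{r,u},q_{r,u}}\,N_1(dr,du)+\int_0^t\!\!\int_U\Phi(r,u)\circ i^*_{p^2_{r,u},q_{r,u}}\,N_2(dr,du).$$ -/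

import Mathlib

open MeasureTheory ProbabilityTheory Filter Topology Set
open scoped NNReal ENNReal

noncomputable section

/-! ### Hilbertian seminorms and the associated Hilbert spaces -/

/-- A continuous Hilbertian seminorm `q` on `H`, given by its (unique, by polarization) positive
symmetric bilinear form `q(·,·)`; the seminorm itself is `h ↦ √(q(h,h))`. -/
structure HilbertSeminorm (H : Type*) [NormedAddCommGroup H] [InnerProductSpace ℝ H] where
  form : LinearMap.BilinForm ℝ H
  form_symm : ∀ x y, form x y = form y x
  form_nonneg : ∀ x, 0 ≤ form x x
  continuous_sqrt : Continuous fun x => √(form x x)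

namespace HilbertSeminorm

variable {H : Type*} [NormedAddCommGroup H] [InnerProductSpace ℝ H]

instance : CoeFun (HilbertSeminorm H) (fun _ => H → ℝ) := ⟨fun q h => √(q.form h h)⟩

theorem sq_apply (q : HilbertSeminorm H) (h : H) : q h ^ 2 = q.form h h :=
  Real.sq_sqrt (q.form_nonneg h)

/-- The vector space `H` regarded as a pre-Hilbert space for `q`. -/
def Pre (_q : HilbertSeminorm H) : Type _ := H

instance (q : HilbertSeminorm H) : AddCommGroup q.Pre := inferInstanceAs (AddCommGroup H)
instance (q : HilbertSeminorm H) : Module ℝ q.Pre := inferInstanceAs (Module ℝ H)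

/-- The semi-inner product of `q`. -/
@[reducible]
def core (q : HilbertSeminorm H) : PreInnerProductSpace.Core ℝ q.Pre where
  inner x y := q.form x y
  conj_inner_symm x y := q.form_symm y x
  re_inner_nonneg x := q.form_nonneg x
  add_left x y z := LinearMap.BilinForm.add_left (B := q.form) x y z
  smul_left x y r := LinearMap.BilinForm.smul_left (B := q.form) r x y

instance (q : HilbertSeminorm H) : SeminormedAddCommGroup q.Pre :=
  @InnerProductSpace.Core.toSeminormedAddCommGroup ℝ q.Pre _ _ _ q.core

instance (q : HilbertSeminorm H) : InnerProductSpace ℝ q.Pre :=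
  InnerProductSpace.ofCore q.core

theorem norm_pre (q : HilbertSeminorm H) (h : H) : ‖(show q.Pre from h)‖ = q h := rfl

/-- The Hilbert space `H_q`: the Hausdorff completion of `(H, q)`, which is the completion of
`H / ker q`. -/
abbrev Space (q : HilbertSeminorm H) : Type _ := UniformSpace.Completion q.Pre

/-- The identity `H → (H, q)`. -/
def toPre (q : HilbertSeminorm H) : H →L[ℝ] q.Pre where
  toFun h := h
  map_add' _ _ := rfl
  map_smul' _ _ := rfl
  cont := by
    let f : H →+ q.Pre := { toFun := fun h => h, map_zero' := rfl, map_add' := fun _ _ => rfl }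
    refine continuous_of_continuousAt_zero f ?_
    have h0 : Tendsto (fun x : H => q x) (𝓝 0) (𝓝 0) := by
      simpa using q.continuous_sqrt.tendsto (0 : H)
    have : Tendsto f (𝓝 0) (𝓝 0) := tendsto_zero_iff_norm_tendsto_zero.2 h0
    simpa [ContinuousAt] using this

/-- The canonical map `i_q : H → H_q`. -/
def incl (q : HilbertSeminorm H) : H →L[ℝ] q.Space :=
  (UniformSpace.Completion.toComplL (𝕜 := ℝ) (E := q.Pre)).comp q.toPre

theorem norm_incl (q : HilbertSeminorm H) (h : H) : ‖q.incl h‖ = q h :=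
  UniformSpace.Completion.norm_coe (E := q.Pre) (q.toPre h)

theorem inner_incl (q : HilbertSeminorm H) (h k : H) :
    inner ℝ (q.incl h) (q.incl k) = q.form h k :=
  UniformSpace.Completion.inner_coe (𝕜 := ℝ) (E := q.Pre) (q.toPre h) (q.toPre k)

/-- For `p ≤ q`, the canonical map `i_{p,q} : H_q → H_p`. -/
def inclLE (p q : HilbertSeminorm H) (hpq : ∀ h, p h ≤ q h) : q.Space →L[ℝ] p.Space :=
  (LinearMap.mkContinuous (σ := RingHom.id ℝ) (E := q.Pre) (F := p.Pre)
    { toFun := fun h => h, map_add' := fun _ _ => rfl, map_smul' := fun _ _ => rfl } 1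
    (fun h => by rw [one_mul]; exact hpq h)).completion

theorem inclLE_incl (p q : HilbertSeminorm H) (hpq : ∀ h, p h ≤ q h) (h : H) :
    inclLE p q hpq (q.incl h) = p.incl h := by
  unfold inclLE incl
  exact ContinuousLinearMap.completion_apply_coe _ _

/-- The Hilbertian seminorm `q` with `q(h)² = p₁(h)² + p₂(h)²`. -/
def hilbertSum (p₁ p₂ : HilbertSeminorm H) : HilbertSeminorm H where
  form := p₁.form + p₂.form
  form_symm x y := by simp [p₁.form_symm x y, p₂.form_symm x y]
  form_nonneg x := add_nonneg (p₁.form_nonneg x) (p₂.form_nonneg x)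
  continuous_sqrt := by
    have h : (fun x => √((p₁.form + p₂.form) x x)) = fun x => √(p₁ x ^ 2 + p₂ x ^ 2) := by
      funext x
      simp [sq_apply]
    rw [h]
    exact ((p₁.continuous_sqrt.pow 2).add (p₂.continuous_sqrt.pow 2)).sqrt

theorem hilbertSum_sq (p₁ p₂ : HilbertSeminorm H) (h : H) :
    hilbertSum p₁ p₂ h ^ 2 = p₁ h ^ 2 + p₂ h ^ 2 := by
  simp only [sq_apply]
  rfl

theorem left_le_hilbertSum (p₁ p₂ : HilbertSeminorm H) (h : H) : p₁ h ≤ hilbertSum p₁ p₂ h :=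
  Real.sqrt_le_sqrt (le_add_of_nonneg_right (p₂.form_nonneg h))

theorem right_le_hilbertSum (p₁ p₂ : HilbertSeminorm H) (h : H) : p₂ h ≤ hilbertSum p₁ p₂ h :=
  Real.sqrt_le_sqrt (le_add_of_nonneg_left (p₁.form_nonneg h))

end HilbertSeminorm

/-! ### Hilbert-Schmidt operators -/

/-- The squared Hilbert-Schmidt norm `∑ ‖S eₙ‖²`, computed in some complete orthonormal system. -/
def hsNormSq {E G : Type*} [NormedAddCommGroup E] [InnerProductSpace ℝ E] [CompleteSpace E]
    [NormedAddCommGroup G] [InnerProductSpace ℝ G] (S : E →L[ℝ] G) : ℝ≥0∞ :=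
  ∑' e : (exists_hilbertBasis ℝ E).choose, ‖S (e : E)‖ₑ ^ 2

theorem enorm_sq_eq_tsum {ι E : Type*} [NormedAddCommGroup E] [InnerProductSpace ℝ E]
    (b : HilbertBasis ι ℝ E) (x : E) : ‖x‖ₑ ^ 2 = ∑' i, ‖inner ℝ x (b i)‖ₑ ^ 2 := by
  have h := b.hasSum_inner_mul_inner x x
  have h1 : ∀ y : ℝ, ‖y‖ₑ ^ 2 = ENNReal.ofReal (y ^ 2) := fun y => by
    rw [← ofReal_norm, ← ENNReal.ofReal_pow (norm_nonneg _), Real.norm_eq_abs, sq_abs]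
  have h2 : (fun i => inner ℝ x (b i) * inner ℝ (b i) x) = fun i => (inner ℝ x (b i)) ^ 2 := by
    funext i
    rw [real_inner_comm (b i) x, sq]
  rw [h2, real_inner_self_eq_norm_sq] at h
  simp_rw [h1]
  rw [← ENNReal.ofReal_tsum_of_nonneg (fun i => sq_nonneg _) h.summable, h.tsum_eq,
    ← ofReal_norm, ← ENNReal.ofReal_pow (norm_nonneg _)]

theorem tsum_enorm_sq_eq_adjoint {ι κ E G : Type*} [NormedAddCommGroup E] [InnerProductSpace ℝ E]
    [CompleteSpace E] [NormedAddCommGroup G] [InnerProductSpace ℝ G] [CompleteSpace G]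
    (S : E →L[ℝ] G) (b : HilbertBasis ι ℝ E) (d : HilbertBasis κ ℝ G) :
    ∑' i, ‖S (b i)‖ₑ ^ 2 = ∑' j, ‖S.adjoint (d j)‖ₑ ^ 2 := by
  rw [tsum_congr fun i => enorm_sq_eq_tsum d (S (b i)),
    tsum_congr fun j => enorm_sq_eq_tsum b (S.adjoint (d j)), ENNReal.tsum_comm]
  refine tsum_congr fun j => tsum_congr fun i => ?_
  rw [ContinuousLinearMap.adjoint_inner_left, real_inner_comm]

/-- The squared Hilbert-Schmidt norm can be computed in any complete orthonormal system. -/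
theorem hsNormSq_eq_tsum {ι E G : Type*} [NormedAddCommGroup E] [InnerProductSpace ℝ E]
    [CompleteSpace E] [NormedAddCommGroup G] [InnerProductSpace ℝ G] [CompleteSpace G]
    (S : E →L[ℝ] G) (b : HilbertBasis ι ℝ E) : hsNormSq S = ∑' i, ‖S (b i)‖ₑ ^ 2 := by
  obtain ⟨c, hc⟩ := (exists_hilbertBasis ℝ E).choose_spec
  obtain ⟨w, d, -⟩ := exists_hilbertBasis ℝ G
  rw [tsum_enorm_sq_eq_adjoint S b d, ← tsum_enorm_sq_eq_adjoint S c d, hc]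
  rfl

/-- `S` is a Hilbert-Schmidt operator. -/
def IsHilbertSchmidt {E G : Type*} [NormedAddCommGroup E] [InnerProductSpace ℝ E]
    [CompleteSpace E] [NormedAddCommGroup G] [InnerProductSpace ℝ G] (S : E →L[ℝ] G) : Prop :=
  hsNormSq S < ∞

/-! ### Filtrations, martingales -/

/-- The usual conditions: right continuity, and `ℱ 0` contains all subsets of `P`-null sets (so
in particular the probability space is complete). -/
structure UsualConditions {Ω : Type*} {mΩ : MeasurableSpace Ω} (P : Measure Ω)
    (ℱ : Filtration ℝ≥0 mΩ) : Prop where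
  rightContinuous : ∀ t, ⨅ s > t, ℱ s = ℱ t
  null_mem : ∀ s : Set Ω, P s = 0 → MeasurableSet[ℱ 0] s

/-- `x` is càdlàg on `[0,T]`. -/
def CadlagOn {G : Type*} [TopologicalSpace G] (T : ℝ≥0) (x : ℝ≥0 → G) : Prop :=
  ∀ t ≤ T, ContinuousWithinAt x (Icc t T) t ∧ ∃ l, Tendsto x (𝓝[<] t) (𝓝 l)

/-- `X`, restricted to `[0,T]`, is a `G`-valued càdlàg square integrable martingale. Processes are
indexed by `ℝ≥0`, but only their values on `[0,T]` matter. -/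
structure IsCadlagSqIntMartingale {Ω G : Type*} {mΩ : MeasurableSpace Ω} (P : Measure Ω)
    (ℱ : Filtration ℝ≥0 mΩ) [NormedAddCommGroup G] [InnerProductSpace ℝ G] [CompleteSpace G]
    (T : ℝ≥0) (X : ℝ≥0 → Ω → G) : Prop where
  adapted : ∀ t ≤ T, StronglyMeasurable[ℱ t] (X t)
  memLp : ∀ t ≤ T, MemLp (X t) 2 P
  condExp_eq : ∀ s t, s ≤ t → t ≤ T → P[X t | ℱ s] =ᵐ[P] X s
  cadlag : ∀ᵐ ω ∂P, CadlagOn T fun t => X t ω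

/-- `E sup_{0 ≤ t ≤ T} ‖X_t‖²`. -/
def supNormSq {Ω G : Type*} {mΩ : MeasurableSpace Ω} (P : Measure Ω) [NormedAddCommGroup G]
    (T : ℝ≥0) (X : ℝ≥0 → Ω → G) : ℝ≥0∞ :=
  ∫⁻ ω, ⨆ t ∈ Iic T, ‖X t ω‖ₑ ^ 2 ∂P

/-! ### Cylindrical martingale-valued measures -/

section CMVM

variable {Ω U H : Type*} {mΩ : MeasurableSpace Ω} [NormedAddCommGroup H] [InnerProductSpace ℝ H]

/-- The basic axioms of a cylindrical martingale-valued measure on `ℝ₊ × 𝓡`.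
Cylindrical random variables are linear maps into `L⁰(Ω, P)`; continuity into `L⁰` is for
convergence in probability, which is metrizable, as is `H`. The values `M t A` with `A ∉ 𝓡` are
irrelevant. -/
structure IsCylMartingaleValuedMeasure (P : Measure Ω) (ℱ : Filtration ℝ≥0 mΩ)
    (𝓡 : Set (Set U)) (M : ℝ≥0 → Set U → H →ₗ[ℝ] (Ω →ₘ[P] ℝ)) : Prop where
  zero_time : ∀ A ∈ 𝓡, ∀ h, M 0 A h = 0
  empty : ∀ t h, M t ∅ h = 0
  union : ∀ t, ∀ A ∈ 𝓡, ∀ B ∈ 𝓡, Disjoint A B → ∀ h, M t (A ∪ B) h = M t A h + M t B h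
  martingale : ∀ A ∈ 𝓡, ∀ h, Martingale (fun t => (M t A h : Ω → ℝ)) ℱ P
  memLp : ∀ t, ∀ A ∈ 𝓡, ∀ h, MemLp (M t A h) 2 P
  mean_zero : ∀ t, ∀ A ∈ 𝓡, ∀ h, ∫ ω, M t A h ω ∂P = 0
  continuous : ∀ t, ∀ A ∈ 𝓡, ∀ (x : ℕ → H) (h : H), Tendsto x atTop (𝓝 h) →
    TendstoInMeasure P (fun n => (M t A (x n) : Ω → ℝ)) atTop (M t A h)
  orthogonal : ∀ A ∈ 𝓡, ∀ B ∈ 𝓡, Disjoint A B → ∀ t s h₁ h₂,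
    ∫ ω, M t A h₁ ω * M s B h₂ ω ∂P = 0

/-- The σ-algebra generated by the increments `M((s,t], A)(h)`, `A ∈ 𝓡`, `h ∈ H`. -/
@[reducible]
def incrementSigma {P : Measure Ω} (𝓡 : Set (Set U)) (M : ℝ≥0 → Set U → H →ₗ[ℝ] (Ω →ₘ[P] ℝ))
    (s t : ℝ≥0) : MeasurableSpace Ω :=
  ⨆ A ∈ 𝓡, ⨆ h : H,
    MeasurableSpace.comap (M t A h - M s A h : Ω →ₘ[P] ℝ) (inferInstance : MeasurableSpace ℝ)

/-- For `s < t` the increments `M((s,t], A)(h)`, `A ∈ 𝓡`, `h ∈ H`, are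
independent of `ℱ s`. -/
def IncrementsIndepPast (P : Measure Ω) (ℱ : Filtration ℝ≥0 mΩ)
    (𝓡 : Set (Set U)) (M : ℝ≥0 → Set U → H →ₗ[ℝ] (Ω →ₘ[P] ℝ)) : Prop :=
  ∀ s t, s < t → Indep (incrementSigma 𝓡 M s t) (ℱ s) P

/-- The increments of `N₁` and `N₂` over `(s,t]` are jointly independent of `ℱ s`. -/
def JointIncrementsIndepPast (P : Measure Ω) (ℱ : Filtration ℝ≥0 mΩ)
    (𝓡 : Set (Set U)) (N₁ N₂ : ℝ≥0 → Set U → H →ₗ[ℝ] (Ω →ₘ[P] ℝ)) : Prop :=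
  ∀ s t, s < t → Indep (incrementSigma 𝓡 N₁ s t ⊔ incrementSigma 𝓡 N₂ s t) (ℱ s) P

/-- The covariance of `M` is determined by `λ`, `μ` and the family `q`, which is
weakly measurable, and weakly bounded on each `[0,T] × U`. -/
structure HasCovariance [MeasurableSpace U] (P : Measure Ω) (𝓡 : Set (Set U)) (μ : Measure U)
    (lam : Measure ℝ≥0) (q : ℝ≥0 → U → HilbertSeminorm H)
    (M : ℝ≥0 → Set U → H →ₗ[ℝ] (Ω →ₘ[P] ℝ)) : Prop where
  measurable_form : ∀ h₁ h₂, Measurable fun x : ℝ≥0 × U => (q x.1 x.2).form h₁ h₂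
  bounded_form : ∀ (T : ℝ≥0) h₁ h₂, ∃ C : ℝ, ∀ r ≤ T, ∀ u, |(q r u).form h₁ h₂| ≤ C
  covariance : ∀ A ∈ 𝓡, ∀ s t, s < t → ∀ h,
    ∫⁻ ω, ‖(M t A h - M s A h : Ω →ₘ[P] ℝ) ω‖ₑ ^ 2 ∂P
      = ∫⁻ r in Ioc s t, ∫⁻ u in A, ENNReal.ofReal (q r u h ^ 2) ∂μ ∂lam

/-- The σ-algebra generated by the cylindrical process `(M(t,A) : t ≥ 0)`. -/
@[reducible]
def cylProcessSigma {P : Measure Ω} (M : ℝ≥0 → Set U → H →ₗ[ℝ] (Ω →ₘ[P] ℝ)) (A : Set U) :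
    MeasurableSpace Ω :=
  ⨆ t : ℝ≥0, ⨆ h : H,
    MeasurableSpace.comap (M t A h : Ω → ℝ) (inferInstance : MeasurableSpace ℝ)

end CMVM

/-! ### Integrands and the stochastic integral -/

section Integral

variable {Ω U H G : Type*} {mΩ : MeasurableSpace Ω} [MeasurableSpace U]
  [NormedAddCommGroup H] [InnerProductSpace ℝ H] [CompleteSpace H]
  [NormedAddCommGroup G] [InnerProductSpace ℝ G] [CompleteSpace G]

/-- Families of operators `Φ(r,ω,u) : H_{q_{r,u}} → G`. Only `r ∈ [0,T]` will matter. -/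
abbrev OpFamily (Ω : Type*) {U H : Type*} (G : Type*) [NormedAddCommGroup H]
    [InnerProductSpace ℝ H] [NormedAddCommGroup G] [InnerProductSpace ℝ G]
    (q : ℝ≥0 → U → HilbertSeminorm H) : Type _ :=
  (r : ℝ≥0) → Ω → (u : U) → ((q r u).Space →L[ℝ] G)

/-- `‖Φ‖²_{Λ²(M,T)} = E ∫_{(0,T]} ∫_U ‖Φ(r,u)‖²_{HS} μ(du) λ(dr)`. -/
def lambdaNormSq (P : Measure Ω) (μ : Measure U) (lam : Measure ℝ≥0) (T : ℝ≥0)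
    (q : ℝ≥0 → U → HilbertSeminorm H) (Φ : OpFamily Ω G q) : ℝ≥0∞ :=
  ∫⁻ ω, ∫⁻ r in Ioc 0 T, ∫⁻ u, hsNormSq (Φ r ω u) ∂μ ∂lam ∂P

/-- The predictable σ-algebra on `[0,T] × Ω`. -/
@[reducible]
def predictableUpTo (ℱ : Filtration ℝ≥0 mΩ) (T : ℝ≥0) : MeasurableSpace (Iic T × Ω) :=
  MeasurableSpace.comap (fun x => ((x.1 : ℝ≥0), x.2)) ℱ.predictable

/-- `Φ ∈ Λ²(M,T;H,G)`. -/
structure MemLambda2 (P : Measure Ω) (ℱ : Filtration ℝ≥0 mΩ) (μ : Measure U) (lam : Measure ℝ≥0)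
    (T : ℝ≥0) (q : ℝ≥0 → U → HilbertSeminorm H) (Φ : OpFamily Ω G q) : Prop where
  isHilbertSchmidt : ∀ r ≤ T, ∀ ω u, IsHilbertSchmidt (Φ r ω u)
  predictable : ∀ (h : H) (g : G),
    Measurable[(predictableUpTo ℱ T).prod (inferInstance : MeasurableSpace U)]
      fun x : (Iic T × Ω) × U =>
        (inner ℝ ((Φ x.1.1 x.1.2 x.2).adjoint g) ((q x.1.1 x.2).incl h) : ℝ)
  norm_lt_top : lambdaNormSq P μ lam T q Φ < ∞

/-- The data of a simple integrand
`∑ᵢ ∑ⱼ 1_{(sᵢ,tᵢ]}(r) 1_{Fᵢ}(ω) 1_{Aⱼ}(u) S_{i,j} ∘ i_{q_{r,u}}*`. -/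
structure SimpleIntegrand (ℱ : Filtration ℝ≥0 mΩ) (𝓡 : Set (Set U)) (T : ℝ≥0)
    (H G : Type*) [NormedAddCommGroup H] [InnerProductSpace ℝ H] [CompleteSpace H]
    [NormedAddCommGroup G] [InnerProductSpace ℝ G] where
  n : ℕ
  m : ℕ
  s : Fin n → ℝ≥0
  t : Fin n → ℝ≥0
  F : Fin n → Set Ω
  A : Fin m → Set U
  S : Fin n → Fin m → (H →L[ℝ] G)
  s_lt_t : ∀ i, s i < t i
  t_le : ∀ i, t i ≤ T
  measurable_F : ∀ i, MeasurableSet[ℱ (s i)] (F i)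
  A_mem : ∀ j, A j ∈ 𝓡
  S_hs : ∀ i j, IsHilbertSchmidt (S i j)

/-- The operator-valued family given by the data of a simple integrand. -/
def SimpleIntegrand.toFamily {ℱ : Filtration ℝ≥0 mΩ} {𝓡 : Set (Set U)} {T : ℝ≥0}
    (Ψ : SimpleIntegrand ℱ 𝓡 T H G) (q : ℝ≥0 → U → HilbertSeminorm H) : OpFamily Ω G q :=
  fun r ω u => ∑ i, ∑ j,
    ((Ioc (Ψ.s i) (Ψ.t i)).indicator 1 r * (Ψ.F i).indicator 1 ω * (Ψ.A j).indicator 1 u : ℝ) •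
      (Ψ.S i j).comp (q r u).incl.adjoint

/-- `Y` is the process `(Y_r(s,t,A,S) : r ∈ [0,T])`: the `G`-valued càdlàg square integrable
martingale obtained by radonification of `h ↦ M((s ∧ r, t ∧ r], A)(h)` by `S`. -/
structure IsRadonification (P : Measure Ω) (ℱ : Filtration ℝ≥0 mΩ) (T : ℝ≥0)
    (M : ℝ≥0 → Set U → H →ₗ[ℝ] (Ω →ₘ[P] ℝ)) (s t : ℝ≥0) (A : Set U) (S : H →L[ℝ] G)
    (Y : ℝ≥0 → Ω → G) : Prop where
  martingale : IsCadlagSqIntMartingale P ℱ T Y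
  inner_eq : ∀ r ≤ T, ∀ g : G, (fun ω => (inner ℝ (Y r ω) g : ℝ)) =ᵐ[P]
    (M (min t r) A (S.adjoint g) - M (min s r) A (S.adjoint g) : Ω →ₘ[P] ℝ)

/-- `X` is the stochastic integral process `∑ᵢ ∑ⱼ 1_{Fᵢ} Y(sᵢ,tᵢ,Aⱼ,S_{i,j})` of a simple
integrand, on `[0,T]`. -/
def IsSimpleIntegral (P : Measure Ω) (ℱ : Filtration ℝ≥0 mΩ) (𝓡 : Set (Set U)) (T : ℝ≥0)
    (M : ℝ≥0 → Set U → H →ₗ[ℝ] (Ω →ₘ[P] ℝ)) (Ψ : SimpleIntegrand ℱ 𝓡 T H G)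
    (X : ℝ≥0 → Ω → G) : Prop :=
  ∃ Y : Fin Ψ.n → Fin Ψ.m → ℝ≥0 → Ω → G,
    (∀ i j, IsRadonification P ℱ T M (Ψ.s i) (Ψ.t i) (Ψ.A j) (Ψ.S i j) (Y i j)) ∧
    ∀ t ≤ T, ∀ ω, X t ω = ∑ i, ∑ j, (Ψ.F i).indicator (Y i j t) ω

/-- `X` is the stochastic integral `(∫₀ᵗ ∫_U Φ(r,u) M(dr,du) : t ∈ [0,T])`: the value at `Φ` of the
continuous extension to `Λ²(M,T)`, with values in the càdlàg square integrable martingales normed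
by `(E sup_{t ≤ T} ‖X_t‖²)^{1/2}`, of the integral of simple integrands. -/
def IsStochasticIntegral (P : Measure Ω) (ℱ : Filtration ℝ≥0 mΩ) (𝓡 : Set (Set U))
    (μ : Measure U) (lam : Measure ℝ≥0) (T : ℝ≥0) (q : ℝ≥0 → U → HilbertSeminorm H)
    (M : ℝ≥0 → Set U → H →ₗ[ℝ] (Ω →ₘ[P] ℝ)) (Φ : OpFamily Ω G q) (X : ℝ≥0 → Ω → G) : Prop :=
  IsCadlagSqIntMartingale P ℱ T X ∧
  ∃ (Ψ : ℕ → SimpleIntegrand ℱ 𝓡 T H G) (Z : ℕ → ℝ≥0 → Ω → G),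
    (∀ k, IsSimpleIntegral P ℱ 𝓡 T M (Ψ k) (Z k)) ∧
    Tendsto (fun k => lambdaNormSq P μ lam T q (fun r ω u => (Ψ k).toFamily q r ω u - Φ r ω u))
      atTop (𝓝 0) ∧
    Tendsto (fun k => supNormSq P T (fun t ω => Z k t ω - X t ω)) atTop (𝓝 0)

/-- For families of seminorms `p ≤ q`, the family `Φ(r,ω,u) ∘ i_{p_{r,u},q_{r,u}}*`. -/
def OpFamily.compInclAdjoint {q : ℝ≥0 → U → HilbertSeminorm H} (Φ : OpFamily Ω G q)
    (p : ℝ≥0 → U → HilbertSeminorm H) (hpq : ∀ r u h, p r u h ≤ q r u h) : OpFamily Ω G p :=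
  fun r ω u => (Φ r ω u).comp (HilbertSeminorm.inclLE (p r u) (q r u) (hpq r u)).adjoint

end Integral

end

/-! ### Square integrable random variables -/

section SquareIntegrable

variable {Ω E : Type*} {mΩ : MeasurableSpace Ω} {P : Measure Ω} [NormedAddCommGroup E]

/-! Independence and zero means kill every cross moment of `N₁` and `N₂`
(`integral_mul_eq_zero_of_indep`). Hence orthogonality over disjoint sets passes to `M`, and the
variances of increments add, which is the covariance formula with q² = p₁² + p₂². An increment of
`M` is, off a null set, the sum of the increments of `N₁` and `N₂`, so it is measurable for the
completed joint σ-algebra; completion preserves independence, which gives (I) under the joint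
hypothesis.

For the integrals the difficulty is that `M` need not satisfy (I), so no isometry is available for
it. The way round is that one set of simple data serves all three integrators. From i_p = i_{p,q} ∘
i_q follows (S ∘ i_q*) ∘ i_{p,q}* = S ∘ i_p* (`SimpleIntegrand.toFamily_comp_inclLE_adjoint`), and
composition with i_{p,q}* does not increase the Hilbert-Schmidt norm because ‖i_{p,q}‖ ≤ 1. So
simple data approximating Φ for q also approximate Φ ∘ i_{p_j,q}* for p_j, and the simple integral
against `M` is the sum of those against `N₁` and `N₂`. The isometry `IsSimpleIntegral.lintegral_sq`,
used only for `N₁` and `N₂`, makes both summands converge, and the sum of the limits is an integral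
against `M`. Conversely, whichever sequence defines a given integral X against `M`, its two parts
converge to the given X₁ and X₂ (`IsStochasticIntegral.tendsto_simpleIntegral`), so X = X₁ + X₂.
Since this holds for every choice of the three processes and all three exist, uniqueness up to
indistinguishability is included.

The rest constructs the integral. In the isometry, two increments multiplied by past events
correlate only over the overlap of their time intervals; (I) at the start of the overlap splits off
the probability of the events, and the covariance over A ∩ B remains. Density of simple integrands
(`exists_simpleIntegrand_tendsto`) reduces Hilbert-Schmidt families to rank-one families, these to
countably valued ones, and their supports to predictable rectangles. Càdlàg paths come from L² right
continuity (`IsL2Martingale.exists_cadlag_modification`), where a count of oscillations, valid for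
Hilbert space values, plays the role of upcrossings. Doob's inequality upgrades convergence at T to
uniform convergence in time. -/

theorem enorm_add_sq_le (x y : E) : ‖x + y‖ₑ ^ 2 ≤ 2 * ‖x‖ₑ ^ 2 + 2 * ‖y‖ₑ ^ 2 := by
  have h : ‖x + y‖₊ ^ 2 ≤ 2 * ‖x‖₊ ^ 2 + 2 * ‖y‖₊ ^ 2 := by
    rw [← mul_add]
    exact (pow_le_pow_left' (nnnorm_add_le x y) 2).trans add_sq_le
  simp only [enorm_eq_nnnorm]
  exact_mod_cast h

theorem enorm_sub_sq_le (x y : E) : ‖x - y‖ₑ ^ 2 ≤ 2 * ‖x‖ₑ ^ 2 + 2 * ‖y‖ₑ ^ 2 := by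
  simpa [sub_eq_add_neg] using enorm_add_sq_le x (-y)

theorem eLpNorm_two_sq (X : Ω → E) : eLpNorm X 2 P ^ 2 = ∫⁻ ω, ‖X ω‖ₑ ^ 2 ∂P := by
  rw [eLpNorm_eq_lintegral_rpow_enorm_toReal two_ne_zero ENNReal.ofNat_ne_top, ← ENNReal.rpow_two,
    ← ENNReal.rpow_mul]
  simp

theorem memLp_two_iff_lintegral {X : Ω → E} (hX : AEStronglyMeasurable X P) :
    MemLp X 2 P ↔ ∫⁻ ω, ‖X ω‖ₑ ^ 2 ∂P < ∞ := by
  rw [← eLpNorm_two_sq, MemLp]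
  simp [hX]

theorem MeasureTheory.MemLp.lintegral_sq_lt_top {X : Ω → E} (hX : MemLp X 2 P) :
    ∫⁻ ω, ‖X ω‖ₑ ^ 2 ∂P < ∞ := (memLp_two_iff_lintegral hX.1).1 hX

theorem MeasureTheory.MemLp.integrable_norm_sq {X : Ω → E} (hX : MemLp X 2 P) :
    Integrable (fun ω => ‖X ω‖ ^ 2) P := (memLp_two_iff_integrable_sq_norm hX.1).1 hX

theorem enorm_sq_eq_ofReal (x : E) : ‖x‖ₑ ^ 2 = ENNReal.ofReal (‖x‖ ^ 2) := by
  rw [ENNReal.ofReal_pow (norm_nonneg _), ofReal_norm]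

theorem lintegral_enorm_sq_eq_ofReal {X : Ω → E} (hX : MemLp X 2 P) :
    ∫⁻ ω, ‖X ω‖ₑ ^ 2 ∂P = ENNReal.ofReal (∫ ω, ‖X ω‖ ^ 2 ∂P) := by
  rw [ofReal_integral_eq_lintegral_ofReal hX.integrable_norm_sq
    (ae_of_all _ fun ω => sq_nonneg _)]
  simp_rw [enorm_sq_eq_ofReal]

theorem lintegral_enorm_add_sq_le {X Y : Ω → E} (hX : AEStronglyMeasurable X P) :
    ∫⁻ ω, ‖X ω + Y ω‖ₑ ^ 2 ∂P ≤ 2 * ∫⁻ ω, ‖X ω‖ₑ ^ 2 ∂P + 2 * ∫⁻ ω, ‖Y ω‖ₑ ^ 2 ∂P := by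
  rw [← lintegral_const_mul' _ _ ENNReal.ofNat_ne_top,
    ← lintegral_const_mul' _ _ ENNReal.ofNat_ne_top, ← lintegral_add_left']
  · exact lintegral_mono fun ω => enorm_add_sq_le _ _
  · exact (hX.enorm.pow_const 2).const_mul 2

theorem lintegral_enorm_sub_sq_triangle {X Y Z : Ω → E} (hX : AEStronglyMeasurable X P)
    (hY : AEStronglyMeasurable Y P) :
    ∫⁻ ω, ‖X ω - Z ω‖ₑ ^ 2 ∂P
      ≤ 2 * ∫⁻ ω, ‖X ω - Y ω‖ₑ ^ 2 ∂P + 2 * ∫⁻ ω, ‖Y ω - Z ω‖ₑ ^ 2 ∂P := by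
  simpa using lintegral_enorm_add_sq_le (X := fun ω => X ω - Y ω) (Y := fun ω => Y ω - Z ω)
    (hX.sub hY)

theorem lintegral_enorm_sub_sq_comm (X Y : Ω → E) :
    ∫⁻ ω, ‖X ω - Y ω‖ₑ ^ 2 ∂P = ∫⁻ ω, ‖Y ω - X ω‖ₑ ^ 2 ∂P := by
  simp_rw [fun ω => enorm_sub_rev (X ω) (Y ω)]

theorem ae_eq_of_lintegral_enorm_sub_sq {X Y : Ω → E} (hX : AEStronglyMeasurable X P)
    (hY : AEStronglyMeasurable Y P) (h : ∫⁻ ω, ‖X ω - Y ω‖ₑ ^ 2 ∂P = 0) : X =ᵐ[P] Y := by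
  have hm : AEMeasurable (fun ω => ‖X ω - Y ω‖ₑ ^ 2) P := (hX.sub hY).enorm.pow_const 2
  rw [lintegral_eq_zero_iff' hm] at h
  filter_upwards [h] with ω hω
  simpa [sub_eq_zero] using hω

theorem tendsto_eLpNorm_of_lintegral {ι : Type*} {l : Filter ι} {X : ι → Ω → E} {Y : Ω → E}
    (h : Tendsto (fun i => ∫⁻ ω, ‖X i ω - Y ω‖ₑ ^ 2 ∂P) l (𝓝 0)) :
    Tendsto (fun i => eLpNorm (X i - Y) 2 P) l (𝓝 0) := by
  have h1 : ∀ i, eLpNorm (X i - Y) 2 P = (∫⁻ ω, ‖X i ω - Y ω‖ₑ ^ 2 ∂P) ^ (1 / 2 : ℝ) := by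
    intro i
    have := eLpNorm_two_sq (P := P) (X i - Y)
    simp only [Pi.sub_apply] at this
    rw [← this, ← ENNReal.rpow_natCast, ← ENNReal.rpow_mul]
    simp
  simp_rw [h1]
  have := (ENNReal.continuous_rpow_const (y := (1 / 2 : ℝ))).tendsto 0
  rw [ENNReal.zero_rpow_of_pos (by norm_num)] at this
  exact this.comp h

/-- `L²` limits are almost surely unique. -/
theorem ae_eq_of_tendsto_lintegral {ι : Type*} {l : Filter ι} [l.NeBot] {X : ι → Ω → E}
    {Y Z : Ω → E} (hX : ∀ i, AEStronglyMeasurable (X i) P) (hY : AEStronglyMeasurable Y P)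
    (hZ : AEStronglyMeasurable Z P)
    (h : Tendsto (fun i => ∫⁻ ω, ‖X i ω - Y ω‖ₑ ^ 2 ∂P) l (𝓝 0))
    (h' : Tendsto (fun i => ∫⁻ ω, ‖X i ω - Z ω‖ₑ ^ 2 ∂P) l (𝓝 0)) : Y =ᵐ[P] Z := by
  refine ae_eq_of_lintegral_enorm_sub_sq hY hZ (le_antisymm ?_ zero_le)
  have h2 := (ENNReal.Tendsto.const_mul (a := 2) h (Or.inr ENNReal.ofNat_ne_top)).add
    (ENNReal.Tendsto.const_mul (a := 2) h' (Or.inr ENNReal.ofNat_ne_top))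
  simp only [mul_zero, add_zero] at h2
  refine ge_of_tendsto' h2 fun i => ?_
  rw [lintegral_enorm_sub_sq_comm (X i) Y]
  exact lintegral_enorm_sub_sq_triangle hY (hX i)

variable [InnerProductSpace ℝ E]

theorem integrable_inner_of_memLp {X Y : Ω → E} (hX : MemLp X 2 P) (hY : MemLp Y 2 P) :
    Integrable (fun ω => (inner ℝ (X ω) (Y ω) : ℝ)) P := by
  refine Integrable.mono' (hX.norm.integrable_mul hY.norm) (hX.1.inner hY.1)
    (ae_of_all _ fun ω => norm_inner_le_norm _ _)

end SquareIntegrable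

/-! ### Square integrable martingales -/

section Martingale

variable {Ω G : Type*} {mΩ : MeasurableSpace Ω} {P : Measure Ω} {ℱ : Filtration ℝ≥0 mΩ}
  [NormedAddCommGroup G]

theorem UsualConditions.measurableSet_of_null (hℱ : UsualConditions P ℱ) (t : ℝ≥0) {s : Set Ω}
    (hs : P s = 0) : MeasurableSet[ℱ t] s :=
  ℱ.mono (zero_le (a := t)) _ (hℱ.null_mem s hs)

/-- A modification of an `ℱ t`-measurable random variable is `ℱ t`-measurable. -/
theorem UsualConditions.stronglyMeasurable_congr [SecondCountableTopology G]
    (hℱ : UsualConditions P ℱ) {t : ℝ≥0}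
    {X Y : Ω → G} (hX : StronglyMeasurable[ℱ t] X) (h : X =ᵐ[P] Y) :
    StronglyMeasurable[ℱ t] Y := by
  borelize G
  refine (measurable_iff_comap_le.2 ?_ : Measurable[ℱ t] Y).stronglyMeasurable
  rintro _ ⟨B, hB, rfl⟩
  have hXB : MeasurableSet[ℱ t] (X ⁻¹' B) := hX.measurable hB
  have hN : P {ω | X ω ≠ Y ω} = 0 := h
  have e : Y ⁻¹' B = (X ⁻¹' B \ {ω | X ω ≠ Y ω}) ∪ (Y ⁻¹' B ∩ {ω | X ω ≠ Y ω}) := by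
    ext ω
    by_cases hω : X ω = Y ω <;> simp [hω]
  rw [e]
  exact (hXB.diff (hℱ.measurableSet_of_null t hN)).union
    (hℱ.measurableSet_of_null t (measure_mono_null inter_subset_right hN))

set_option linter.unusedSectionVars false

variable [InnerProductSpace ℝ G]

/-- A `G`-valued square integrable martingale on `[0,T]`, in terms of orthogonality of increments
to the past. No path regularity is required. -/
structure IsL2Martingale (P : Measure Ω) (ℱ : Filtration ℝ≥0 mΩ) (T : ℝ≥0) (X : ℝ≥0 → Ω → G) :
    Prop where
  adapted : ∀ t ≤ T, StronglyMeasurable[ℱ t] (X t)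
  memLp : ∀ t ≤ T, MemLp (X t) 2 P
  orthogonal : ∀ s t, s ≤ t → t ≤ T → ∀ V : Ω → G, StronglyMeasurable[ℱ s] V → MemLp V 2 P →
    ∫ ω, (inner ℝ (X t ω - X s ω) (V ω) : ℝ) ∂P = 0

variable [CompleteSpace G] [IsProbabilityMeasure P] {T : ℝ≥0} {X Y : ℝ≥0 → Ω → G}

/-- The test variable V is ℱ s-measurable, so it can be pulled out of the conditional expectation of
the inner product. -/
theorem isL2Martingale_of_condExp (adapted : ∀ t ≤ T, StronglyMeasurable[ℱ t] (X t))
    (memLp : ∀ t ≤ T, MemLp (X t) 2 P)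
    (condExp_eq : ∀ s t, s ≤ t → t ≤ T → P[X t | ℱ s] =ᵐ[P] X s) : IsL2Martingale P ℱ T X where
  adapted := adapted
  memLp := memLp
  orthogonal s t hst htT V hV hV2 := by
    have hs := hst.trans htT
    have hi := integrable_inner_of_memLp (memLp t htT) hV2
    have h := condExp_bilin_of_stronglyMeasurable_right (innerSL ℝ) hV hi
      ((memLp t htT).integrable one_le_two)
    have h1 : ∫ ω, (inner ℝ (X t ω) (V ω) : ℝ) ∂P = ∫ ω, (inner ℝ (X s ω) (V ω) : ℝ) ∂P := by
      rw [← integral_condExp (ℱ.le s)]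
      refine integral_congr_ae (h.trans ?_)
      filter_upwards [condExp_eq s t hst htT] with ω hω
      rw [hω]
      rfl
    simp_rw [inner_sub_left]
    rw [integral_sub hi (integrable_inner_of_memLp (memLp s hs) hV2), h1, sub_self]

theorem IsCadlagSqIntMartingale.isL2Martingale (hX : IsCadlagSqIntMartingale P ℱ T X) :
    IsL2Martingale P ℱ T X := isL2Martingale_of_condExp hX.adapted hX.memLp hX.condExp_eq

namespace IsL2Martingale

theorem memLp_sub (hX : IsL2Martingale P ℱ T X) {s t : ℝ≥0} (hs : s ≤ T) (ht : t ≤ T) :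
    MemLp (fun ω => X s ω - X t ω) 2 P := (hX.memLp s hs).sub (hX.memLp t ht)

/-- Testing orthogonality against 1_A g, with A ∈ ℱ s and g arbitrary, determines the integral of
the increment over A as a vector. -/
theorem condExp_eq (hX : IsL2Martingale P ℱ T X) {s t : ℝ≥0} (hst : s ≤ t) (ht : t ≤ T) :
    P[X t | ℱ s] =ᵐ[P] X s := by
  have hit := (hX.memLp t ht).integrable one_le_two
  have his := (hX.memLp s (hst.trans ht)).integrable one_le_two
  refine (ae_eq_condExp_of_forall_setIntegral_eq (ℱ.le s) hit (fun _ _ _ => his.integrableOn) ?_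
    (hX.adapted s (hst.trans ht)).aestronglyMeasurable).symm
  intro A hA _
  have hA' := ℱ.le s _ hA
  rw [eq_comm, ← sub_eq_zero, ← integral_sub hit.integrableOn his.integrableOn]
  refine ext_inner_left ℝ fun g => ?_
  have hi : Integrable (fun ω => X t ω - X s ω) (P.restrict A) := (hit.sub his).integrableOn
  rw [← integral_inner (𝕜 := ℝ) hi, inner_zero_right, ← integral_indicator hA']
  have := hX.orthogonal s t hst ht (A.indicator fun _ => g)
    ((stronglyMeasurable_const (b := g)).indicator hA) ((memLp_const g).indicator hA')
  rw [← this]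
  congr 1
  ext ω
  by_cases hω : ω ∈ A <;> simp [hω, real_inner_comm]

theorem isCadlagSqIntMartingale (hX : IsL2Martingale P ℱ T X)
    (h : ∀ᵐ ω ∂P, CadlagOn T fun t => X t ω) : IsCadlagSqIntMartingale P ℱ T X :=
  ⟨hX.adapted, hX.memLp, fun _ _ hst ht => hX.condExp_eq hst ht, h⟩

theorem congr [SecondCountableTopology G] (hX : IsL2Martingale P ℱ T X) (hℱ : UsualConditions P ℱ)
    (h : ∀ t ≤ T, X t =ᵐ[P] Y t) : IsL2Martingale P ℱ T Y where
  adapted t ht := hℱ.stronglyMeasurable_congr (hX.adapted t ht) (h t ht)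
  memLp t ht := (memLp_congr_ae (h t ht)).1 (hX.memLp t ht)
  orthogonal s t hst ht V hV hV2 := by
    rw [← hX.orthogonal s t hst ht V hV hV2]
    refine integral_congr_ae ?_
    filter_upwards [h t ht, h s (hst.trans ht)] with ω h1 h2
    rw [h1, h2]

theorem zero : IsL2Martingale P ℱ T (fun _ _ => (0 : G)) where
  adapted _ _ := stronglyMeasurable_const
  memLp _ _ := MemLp.zero'
  orthogonal s t hst ht V hV hV2 := by simp

theorem add (hX : IsL2Martingale P ℱ T X) (hY : IsL2Martingale P ℱ T Y) :
    IsL2Martingale P ℱ T (fun t ω => X t ω + Y t ω) where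
  adapted t ht := (hX.adapted t ht).add (hY.adapted t ht)
  memLp t ht := (hX.memLp t ht).add (hY.memLp t ht)
  orthogonal s t hst ht V hV hV2 := by
    have hs := hst.trans ht
    have e : ∀ ω, (inner ℝ (X t ω + Y t ω - (X s ω + Y s ω)) (V ω) : ℝ)
        = inner ℝ (X t ω - X s ω) (V ω) + inner ℝ (Y t ω - Y s ω) (V ω) := fun ω => by
      rw [← inner_add_left]; congr 1; abel
    simp_rw [e]
    rw [integral_add (integrable_inner_of_memLp (hX.memLp_sub ht hs) hV2)
      (integrable_inner_of_memLp (hY.memLp_sub ht hs) hV2),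
      hX.orthogonal s t hst ht V hV hV2, hY.orthogonal s t hst ht V hV hV2, add_zero]

theorem neg (hX : IsL2Martingale P ℱ T X) : IsL2Martingale P ℱ T (fun t ω => - X t ω) where
  adapted t ht := (hX.adapted t ht).neg
  memLp t ht := (hX.memLp t ht).neg
  orthogonal s t hst ht V hV hV2 := by
    have e : ∀ ω, (inner ℝ (- X t ω - - X s ω) (V ω) : ℝ) = - inner ℝ (X t ω - X s ω) (V ω) :=
      fun ω => by rw [← inner_neg_left]; congr 1; abel
    simp_rw [e]
    rw [integral_neg, hX.orthogonal s t hst ht V hV hV2, neg_zero]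

theorem sub (hX : IsL2Martingale P ℱ T X) (hY : IsL2Martingale P ℱ T Y) :
    IsL2Martingale P ℱ T (fun t ω => X t ω - Y t ω) := by
  simpa only [sub_eq_add_neg] using hX.add hY.neg

theorem sum {ι : Type*} {X : ι → ℝ≥0 → Ω → G} (s : Finset ι)
    (h : ∀ i ∈ s, IsL2Martingale P ℱ T (X i)) :
    IsL2Martingale P ℱ T (fun t ω => ∑ i ∈ s, X i t ω) := by
  classical
  induction s using Finset.induction_on with
  | empty => simpa using zero
  | insert a s ha ih =>
    simp only [Finset.sum_insert ha]
    exact (h a (Finset.mem_insert_self _ _)).add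
      (ih fun i hi => h i (Finset.mem_insert_of_mem hi))

/-- Pythagoras: an increment is orthogonal to everything known before it. -/
theorem integral_norm_sq_sub_add (hX : IsL2Martingale P ℱ T X) {s t : ℝ≥0} (hst : s ≤ t)
    (ht : t ≤ T) {V : Ω → G} (hV : StronglyMeasurable[ℱ s] V) (hV2 : MemLp V 2 P) :
    ∫ ω, ‖X t ω - X s ω + V ω‖ ^ 2 ∂P = ∫ ω, ‖X t ω - X s ω‖ ^ 2 ∂P + ∫ ω, ‖V ω‖ ^ 2 ∂P := by
  have hD := hX.memLp_sub ht (hst.trans ht)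
  have e : ∀ ω, ‖X t ω - X s ω + V ω‖ ^ 2
      = ‖X t ω - X s ω‖ ^ 2 + 2 * inner ℝ (X t ω - X s ω) (V ω) + ‖V ω‖ ^ 2 :=
    fun ω => norm_add_sq_real _ _
  have hi : Integrable (fun ω => 2 * (inner ℝ (X t ω - X s ω) (V ω) : ℝ)) P :=
    (integrable_inner_of_memLp hD hV2).const_mul 2
  have hi' : Integrable
      (fun ω => ‖X t ω - X s ω‖ ^ 2 + 2 * (inner ℝ (X t ω - X s ω) (V ω) : ℝ)) P :=
    hD.integrable_norm_sq.add hi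
  simp_rw [e]
  rw [integral_add hi' hV2.integrable_norm_sq,
    integral_add hD.integrable_norm_sq hi, integral_const_mul, hX.orthogonal s t hst ht V hV hV2]
  ring

theorem integral_norm_sq_eq (hX : IsL2Martingale P ℱ T X) {s t : ℝ≥0} (hst : s ≤ t)
    (ht : t ≤ T) :
    ∫ ω, ‖X t ω‖ ^ 2 ∂P = ∫ ω, ‖X t ω - X s ω‖ ^ 2 ∂P + ∫ ω, ‖X s ω‖ ^ 2 ∂P := by
  simpa using hX.integral_norm_sq_sub_add hst ht (hX.adapted s (hst.trans ht))
    (hX.memLp s (hst.trans ht))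

/-- Applied to differences of martingales, this lets the terminal time control all earlier times. -/
theorem lintegral_mono (hX : IsL2Martingale P ℱ T X) {s t : ℝ≥0} (hst : s ≤ t) (ht : t ≤ T) :
    ∫⁻ ω, ‖X s ω‖ₑ ^ 2 ∂P ≤ ∫⁻ ω, ‖X t ω‖ₑ ^ 2 ∂P := by
  rw [lintegral_enorm_sq_eq_ofReal (hX.memLp t ht),
    lintegral_enorm_sq_eq_ofReal (hX.memLp s (hst.trans ht)), hX.integral_norm_sq_eq hst ht]
  exact ENNReal.ofReal_le_ofReal (le_add_of_nonneg_left (integral_nonneg fun ω => sq_nonneg _))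

end IsL2Martingale

end Martingale

/-! ### Dyadic times -/

section Dyadic

/-- The dyadic number `k / 2 ^ n`, cut off at `T`. -/
noncomputable def dyadicTime (T : ℝ≥0) (n k : ℕ) : ℝ≥0 := min T (k / 2 ^ n)

variable {T : ℝ≥0}

theorem dyadicTime_le (n k : ℕ) : dyadicTime T n k ≤ T := min_le_left _ _

theorem dyadicTime_mono (n : ℕ) : Monotone (dyadicTime T n) := fun i j hij =>
  min_le_min_left _ (by gcongr)

theorem dyadicTime_add (n j k : ℕ) : dyadicTime T (n + j) (k * 2 ^ j) = dyadicTime T n k := by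
  unfold dyadicTime
  congr 1
  rw [pow_add]
  push_cast
  exact mul_div_mul_right _ _ (by positivity)

theorem dyadicTime_ceil (n : ℕ) {k : ℕ} (hk : ⌈T * 2 ^ n⌉₊ ≤ k) : dyadicTime T n k = T := by
  refine min_eq_left ?_
  rw [le_div_iff₀ (by positivity)]
  exact Nat.ceil_le.1 hk

theorem dyadicTime_floor_le (n : ℕ) {t : ℝ≥0} (ht : t ≤ T) :
    ∃ k ≤ ⌈T * 2 ^ n⌉₊ + 1, dyadicTime T n k ≤ t + 1 / 2 ^ n ∧ (t < T → t < dyadicTime T n k) := by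
  -- The successor of the floor gives a grid point strictly to the right of t at distance at most
  -- 2⁻ⁿ; only the cut-off at T can spoil strictness, and only for t = T. The successor costs one
  -- index beyond the ceiling.
  refine ⟨⌊t * 2 ^ n⌋₊ + 1, ?_, ?_, fun h => lt_min h ?_⟩
  · gcongr
    exact (Nat.floor_mono (by gcongr)).trans (Nat.floor_le_ceil _)
  · refine (min_le_right _ _).trans ?_
    rw [div_le_iff₀ (by positivity), add_mul, one_div, inv_mul_cancel₀ (by positivity)]
    push_cast
    gcongr
    exact Nat.floor_le zero_le
  · rw [lt_div_iff₀ (by positivity)]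
    push_cast
    exact Nat.lt_floor_add_one _

end Dyadic

/-! ### Doob's maximal inequality -/

section Doob

set_option linter.unusedSectionVars false

variable {Ω G : Type*} {mΩ : MeasurableSpace Ω} {P : Measure Ω} {ℱ : Filtration ℝ≥0 mΩ}
  [NormedAddCommGroup G] [InnerProductSpace ℝ G] [CompleteSpace G] [IsProbabilityMeasure P]
  {T : ℝ≥0} {X : ℝ≥0 → Ω → G}

/-- The running maximum of a sequence. -/
noncomputable def runningMax (x : ℕ → ℝ) : ℕ → ℝ
  | 0 => x 0
  | k + 1 => max (runningMax x k) (x (k + 1))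

theorem runningMax_nonneg {x : ℕ → ℝ} (hx : ∀ k, 0 ≤ x k) (k : ℕ) : 0 ≤ runningMax x k := by
  cases k with
  | zero => exact hx 0
  | succ k => exact (hx _).trans (le_max_right _ _)

theorem le_runningMax (x : ℕ → ℝ) {j k : ℕ} (h : j ≤ k) : x j ≤ runningMax x k := by
  induction k with
  | zero => rw [Nat.le_zero.1 h]; exact le_rfl
  | succ k ih =>
    rcases h.lt_or_eq with h | rfl
    · exact (ih (Nat.lt_succ_iff.1 h)).trans (le_max_left _ _)
    · exact le_max_right _ _

/-- A pathwise form of Doob's inequality: with m the old maximum, x the old value and y the new one,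
2m² − 4m‖x‖ grows by at most a martingale transform term. The right side is at least 2m² − 4m‖y‖,
and what is left when ‖y‖ exceeds m is the square 2(m − ‖y‖)². For x = 0 the inverse is 0, so the
transform vanishes. -/
theorem doob_step {m : ℝ} (hm : 0 ≤ m) (x y : G) :
    2 * max m ‖y‖ ^ 2 - 4 * (max m ‖y‖ * ‖y‖)
      ≤ 2 * m ^ 2 - 4 * (m * ‖x‖) - 4 * inner ℝ (y - x) ((m * ‖x‖⁻¹) • x) := by
  have hxx : inner ℝ x ((m * ‖x‖⁻¹) • x) = m * ‖x‖ := by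
    rw [inner_smul_right, real_inner_self_eq_norm_sq]
    rcases eq_or_ne ‖x‖ 0 with h | h
    · simp [h]
    · field_simp
  have hyx : inner ℝ y ((m * ‖x‖⁻¹) • x) ≤ m * ‖y‖ := by
    rw [inner_smul_right, mul_assoc]
    refine mul_le_mul_of_nonneg_left ?_ hm
    rcases eq_or_ne ‖x‖ 0 with h | h
    · simp [h]
    · rw [inv_mul_le_iff₀ (lt_of_le_of_ne (norm_nonneg _) (Ne.symm h)), mul_comm]
      exact real_inner_le_norm y x
  rw [inner_sub_left, hxx]
  rcases le_total m ‖y‖ with h | h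
  · rw [max_eq_right h]
    nlinarith [sq_nonneg (m - ‖y‖)]
  · rw [max_eq_left h]
    linarith

namespace IsL2Martingale

variable {τ : ℕ → ℝ≥0}

theorem runningMax_props (hX : IsL2Martingale P ℱ T X) (hτ : Monotone τ) (hτT : ∀ k, τ k ≤ T)
    (k : ℕ) :
    StronglyMeasurable[ℱ (τ k)] (fun ω => runningMax (fun j => ‖X (τ j) ω‖) k) ∧
    MemLp (fun ω => runningMax (fun j => ‖X (τ j) ω‖) k) 2 P := by
  induction k with
  | zero => exact ⟨(hX.adapted _ (hτT 0)).norm, (hX.memLp _ (hτT 0)).norm⟩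
  | succ k ih =>
    have h1 := (hX.adapted _ (hτT (k + 1))).norm
    have h2 := (hX.memLp _ (hτT (k + 1))).norm
    refine ⟨(continuous_fst.max continuous_snd).comp_stronglyMeasurable
      ((ih.1.mono (ℱ.mono (hτ k.le_succ))).prodMk h1), ?_⟩
    refine (ih.2.add h2).mono (ih.2.1.sup h2.1) (ae_of_all _ fun ω => ?_)
    have h3 := runningMax_nonneg (x := fun j => ‖X (τ j) ω‖) (fun j => norm_nonneg _) k
    have h4 := norm_nonneg (X (τ (k + 1)) ω)
    simp only [Pi.add_apply, runningMax]
    rw [Real.norm_of_nonneg (h3.trans le_sup_left), Real.norm_of_nonneg (add_nonneg h3 h4)]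
    exact sup_le (le_add_of_nonneg_right h4) (le_add_of_nonneg_left h3)

/-- Doob's `L²` maximal inequality for finitely many times. -/
theorem integral_runningMax_sq_le (hX : IsL2Martingale P ℱ T X) (hτ : Monotone τ)
    (hτT : ∀ k, τ k ≤ T) (N : ℕ) :
    ∫ ω, runningMax (fun j => ‖X (τ j) ω‖) N ^ 2 ∂P ≤ 4 * ∫ ω, ‖X (τ N) ω‖ ^ 2 ∂P := by
  set m : ℕ → Ω → ℝ := fun k ω => runningMax (fun j => ‖X (τ j) ω‖) k with hm
  have hmeas := fun k => (hX.runningMax_props hτ hτT k).1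
  have hLp := fun k => (hX.runningMax_props hτ hτT k).2
  have hm0 : ∀ k ω, 0 ≤ m k ω := fun k ω => runningMax_nonneg (fun j => norm_nonneg _) k
  have hint : ∀ k, Integrable (fun ω => 2 * m k ω ^ 2 - 4 * (m k ω * ‖X (τ k) ω‖)) P := fun k =>
    ((hLp k).integrable_sq.const_mul 2).sub
      (((hLp k).integrable_mul (hX.memLp _ (hτT k)).norm).const_mul 4)
  -- Taking expectations in `doob_step` removes the transform term, so the bound propagates from
  -- time 0, where it reads −2‖X‖² ≤ 0.
  have key : ∀ k, ∫ ω, (2 * m k ω ^ 2 - 4 * (m k ω * ‖X (τ k) ω‖)) ∂P ≤ 0 := by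
    intro k
    induction k with
    | zero =>
      refine integral_nonpos fun ω => ?_
      simp only [hm, runningMax, Pi.zero_apply]
      nlinarith [sq_nonneg ‖X (τ 0) ω‖]
    | succ k ih =>
      -- The integrand of the transform; its norm is at most the running maximum, hence it is square
      -- integrable.
      set V : Ω → G := fun ω => (m k ω * ‖X (τ k) ω‖⁻¹) • X (τ k) ω with hV
      have hVm : StronglyMeasurable[ℱ (τ k)] V := by
        have hXk := hX.adapted _ (hτT k)
        have hinv : StronglyMeasurable[ℱ (τ k)] fun ω => ‖X (τ k) ω‖⁻¹ :=
          (hXk.norm.measurable.inv).stronglyMeasurable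
        exact ((hmeas k).mul hinv).smul hXk
      have hV2 : MemLp V 2 P := by
        refine (hLp k).mono (hVm.mono (ℱ.le _)).aestronglyMeasurable (ae_of_all _ fun ω => ?_)
        simp only [hV, norm_smul, norm_mul, norm_inv, norm_norm, mul_assoc]
        exact mul_le_of_le_one_right (norm_nonneg _) (inv_mul_le_one)
      have hi := integrable_inner_of_memLp
        (hX.memLp_sub (hτT (k + 1)) (hτT k)) hV2
      have hle : ∫ ω, (2 * m (k + 1) ω ^ 2 - 4 * (m (k + 1) ω * ‖X (τ (k + 1)) ω‖)) ∂P
          ≤ ∫ ω, (2 * m k ω ^ 2 - 4 * (m k ω * ‖X (τ k) ω‖)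
            - 4 * inner ℝ (X (τ (k + 1)) ω - X (τ k) ω) (V ω)) ∂P :=
        integral_mono (hint _) ((hint k).sub (hi.const_mul 4)) fun ω => doob_step (hm0 k ω) _ _
      rw [integral_sub (hint k) (hi.const_mul 4), integral_const_mul,
        hX.orthogonal _ _ (hτ k.le_succ) (hτT _) V hVm hV2] at hle
      linarith
  have hX2 := (hX.memLp _ (hτT N)).integrable_norm_sq
  -- The difference of the two integrands is the square (m − 2‖X‖)².
  calc ∫ ω, m N ω ^ 2 ∂P
      ≤ ∫ ω, (4 * ‖X (τ N) ω‖ ^ 2 + (2 * m N ω ^ 2 - 4 * (m N ω * ‖X (τ N) ω‖))) ∂P := by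
        refine integral_mono (hLp N).integrable_sq ((hX2.const_mul 4).add (hint N)) fun ω => ?_
        simp only
        nlinarith [sq_nonneg (m N ω - 2 * ‖X (τ N) ω‖)]
    _ = 4 * ∫ ω, ‖X (τ N) ω‖ ^ 2 ∂P + _ := by
        rw [integral_add (hX2.const_mul 4) (hint N), integral_const_mul]
    _ ≤ _ := by linarith [key N]

theorem lintegral_runningMax_sq_le (hX : IsL2Martingale P ℱ T X) (hτ : Monotone τ)
    (hτT : ∀ k, τ k ≤ T) (N : ℕ) :
    ∫⁻ ω, ENNReal.ofReal (runningMax (fun j => ‖X (τ j) ω‖) N ^ 2) ∂P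
      ≤ 4 * ∫⁻ ω, ‖X (τ N) ω‖ₑ ^ 2 ∂P := by
  rw [← ofReal_integral_eq_lintegral_ofReal (hX.runningMax_props hτ hτT N).2.integrable_sq
    (ae_of_all _ fun ω => sq_nonneg _), lintegral_enorm_sq_eq_ofReal (hX.memLp _ (hτT N)),
    show (4 : ℝ≥0∞) = ENNReal.ofReal 4 by simp, ← ENNReal.ofReal_mul (by norm_num)]
  exact ENNReal.ofReal_le_ofReal (hX.integral_runningMax_sq_le hτ hτT N)

/-- Doob's `L²` maximal inequality. -/
theorem supNormSq_le (hX : IsL2Martingale P ℱ T X) (hc : ∀ᵐ ω ∂P, CadlagOn T fun t => X t ω) :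
    supNormSq P T X ≤ 4 * ∫⁻ ω, ‖X T ω‖ₑ ^ 2 ∂P := by
  -- Large enough to include the index from `dyadicTime_floor_le`, and past the ceiling so that the
  -- last grid time is T.
  set N : ℕ → ℕ := fun n => ⌈T * 2 ^ n⌉₊ + 1
  set m : ℕ → Ω → ℝ≥0∞ := fun n ω =>
    ENNReal.ofReal (runningMax (fun j => ‖X (dyadicTime T n j) ω‖) (N n) ^ 2)
  have hbound : ∀ n, ∫⁻ ω, m n ω ∂P ≤ 4 * ∫⁻ ω, ‖X T ω‖ₑ ^ 2 ∂P := fun n => by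
    have := hX.lintegral_runningMax_sq_le (dyadicTime_mono n) (dyadicTime_le n) (N n)
    rwa [dyadicTime_ceil n (Nat.le_succ _)] at this
  have hmeas : ∀ n, AEMeasurable (m n) P := fun n =>
    ((hX.runningMax_props (dyadicTime_mono n) (dyadicTime_le n) (N n)).2.1.aemeasurable.pow_const
      2).ennreal_ofReal
  -- Right continuity bounds each ‖X_t‖² by the lower limit of the grid maxima; Fatou's lemma then
  -- carries the uniform bound over, without monotonicity in the level.
  calc supNormSq P T X ≤ ∫⁻ ω, liminf (fun n => m n ω) atTop ∂P := by
        refine lintegral_mono_ae ?_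
        filter_upwards [hc] with ω hω
        refine iSup₂_le fun t ht => ?_
        choose k hk hle hlt using fun n => dyadicTime_floor_le n ht
        -- Grid points approaching t from the right; at t = T no room is left, and T itself is used.
        set s : ℕ → ℝ≥0 := fun n => if t < T then dyadicTime T n (k n) else T
        have hts : ∀ n, t ≤ s n := fun n => by
          by_cases h : t < T
          · simpa [s, h] using (hlt n h).le
          · simpa [s, h] using ht
        have hst : ∀ n, s n ≤ t + 1 / 2 ^ n := fun n => by
          by_cases h : t < T
          · simpa [s, h] using hle n
          · simpa [s, h] using (not_lt.1 h).trans le_self_add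
        have hsT : ∀ n, s n ≤ T := fun n => by
          by_cases h : t < T
          · simpa [s, h] using dyadicTime_le n (k n)
          · simp [s, h]
        have hs : Tendsto s atTop (𝓝 t) := by
          refine tendsto_of_tendsto_of_tendsto_of_le_of_le tendsto_const_nhds ?_ hts hst
          have : Tendsto (fun n : ℕ => t + (1 / 2 : ℝ≥0) ^ n) atTop (𝓝 (t + 0)) :=
            tendsto_const_nhds.add (NNReal.tendsto_pow_atTop_nhds_zero_of_lt_one one_half_lt_one)
          simpa using this
        have hXs : Tendsto (fun n => X (s n) ω) atTop (𝓝 (X t ω)) :=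
          (hω t ht).1.tendsto.comp (tendsto_nhdsWithin_iff.2
            ⟨hs, Eventually.of_forall fun n => ⟨hts n, hsT n⟩⟩)
        have hXs' : Tendsto (fun n => ‖X (s n) ω‖ₑ ^ 2) atTop (𝓝 (‖X t ω‖ₑ ^ 2)) :=
          (ENNReal.continuous_pow 2).tendsto _ |>.comp (continuous_enorm.tendsto _ |>.comp hXs)
        rw [← hXs'.liminf_eq]
        refine liminf_le_liminf (Eventually.of_forall fun n => ?_)
        rw [enorm_sq_eq_ofReal]
        refine ENNReal.ofReal_le_ofReal (pow_le_pow_left₀ (norm_nonneg _) ?_ 2)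
        by_cases h : t < T
        · simpa [s, h] using le_runningMax (fun j => ‖X (dyadicTime T n j) ω‖) (hk n)
        · have := le_runningMax (fun j => ‖X (dyadicTime T n j) ω‖) (le_refl (N n))
          rw [dyadicTime_ceil n (Nat.le_succ _)] at this
          simpa [s, h] using this
    _ ≤ liminf (fun n => ∫⁻ ω, m n ω ∂P) atTop := lintegral_liminf_le' hmeas
    _ ≤ liminf (fun _ : ℕ => 4 * ∫⁻ ω, ‖X T ω‖ₑ ^ 2 ∂P) atTop :=
        liminf_le_liminf (Eventually.of_forall hbound)
    _ = _ := liminf_const _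

/-- A càdlàg square integrable martingale is right continuous in `L²`. -/
theorem tendsto_lintegral_sub (hX : IsL2Martingale P ℱ T X)
    (hc : ∀ᵐ ω ∂P, CadlagOn T fun t => X t ω) {t : ℝ≥0} (ht : t ≤ T) :
    Tendsto (fun s => ∫⁻ ω, ‖X s ω - X t ω‖ₑ ^ 2 ∂P) (𝓝[Icc t T] t) (𝓝 0) := by
  -- The pathwise supremum is the dominating function, with finite integral by Doob's inequality;
  -- its measurability is not needed.
  set W : Ω → ℝ≥0∞ := fun ω => ⨆ t ∈ Iic T, ‖X t ω‖ₑ ^ 2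
  have hW : ∫⁻ ω, W ω ∂P < ∞ := (hX.supNormSq_le hc).trans_lt
    (ENNReal.mul_lt_top ENNReal.ofNat_lt_top (hX.memLp T le_rfl).lintegral_sq_lt_top)
  have hle : ∀ s ≤ T, ∀ ω, ‖X s ω‖ₑ ^ 2 ≤ W ω := fun s hs ω =>
    le_iSup₂ (f := fun t (_ : t ∈ Iic T) => ‖X t ω‖ₑ ^ 2) s hs
  have h0 : (0 : ℝ≥0∞) = ∫⁻ _ : Ω, 0 ∂P := by simp
  rw [h0]
  refine tendsto_lintegral_filter_of_dominated_convergence' (fun ω => 4 * W ω) ?_ ?_ ?_ ?_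
  · filter_upwards [self_mem_nhdsWithin] with s hs
    exact (hX.memLp_sub hs.2 ht).1.enorm.pow_const 2
  · filter_upwards [self_mem_nhdsWithin] with s hs
    refine ae_of_all _ fun ω => (enorm_sub_sq_le _ _).trans ?_
    calc 2 * ‖X s ω‖ₑ ^ 2 + 2 * ‖X t ω‖ₑ ^ 2 ≤ 2 * W ω + 2 * W ω := by
          gcongr
          exacts [hle s hs.2 ω, hle t ht ω]
      _ = 4 * W ω := by rw [← add_mul]; norm_num
  · rw [lintegral_const_mul' _ _ ENNReal.ofNat_ne_top]
    exact (ENNReal.mul_lt_top ENNReal.ofNat_lt_top hW).ne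
  · filter_upwards [hc] with ω hω
    have h1 : Tendsto (fun s => X s ω - X t ω) (𝓝[Icc t T] t) (𝓝 0) := by
      simpa using (hω t ht).1.tendsto.sub_const (X t ω)
    have h2 := ((ENNReal.continuous_pow 2).comp continuous_enorm).tendsto (0 : G)
    simp only [Function.comp_apply, enorm_zero, ne_eq, OfNat.ofNat_ne_zero, not_false_eq_true,
      zero_pow] at h2
    exact h2.comp h1

end IsL2Martingale

end Doob

/-! ### Regularization of paths -/

section Oscillation

variable {G : Type*} [NormedAddCommGroup G]

/-- The last value of the sequence at which it moved by at least `ε` since the previous such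
value. -/
noncomputable def anchor (ε : ℝ) (x : ℕ → G) : ℕ → G
  | 0 => x 0
  | k + 1 => if ε ≤ ‖x (k + 1) - anchor ε x k‖ then x (k + 1) else anchor ε x k

/-- The number of times that the anchor has been moved. -/
noncomputable def resets (ε : ℝ) (x : ℕ → G) : ℕ → ℕ
  | 0 => 0
  | k + 1 => if ε ≤ ‖x (k + 1) - anchor ε x k‖ then resets ε x k + 1 else resets ε x k

variable {ε : ℝ} {x : ℕ → G}

theorem norm_sub_anchor_lt (hε : 0 < ε) (k : ℕ) : ‖x k - anchor ε x k‖ < ε := by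
  cases k with
  | zero => simpa [anchor] using hε
  | succ k =>
    simp only [anchor]
    split_ifs with h
    · simpa using hε
    · exact not_le.1 h

theorem resets_mono : Monotone (resets ε x) := monotone_nat_of_le_succ fun k => by
  simp only [resets]
  split_ifs <;> omega

theorem resets_le (k : ℕ) : resets ε x k ≤ k := by
  induction k with
  | zero => exact le_rfl
  | succ k ih =>
    simp only [resets]
    split_ifs <;> omega

theorem anchor_eq_of_resets_eq {i j : ℕ} (hij : i ≤ j) (h : resets ε x i = resets ε x j) :
    anchor ε x i = anchor ε x j := by
  induction j, hij using Nat.le_induction with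
  | base => rfl
  | succ j hij ih =>
    have h1 := resets_mono (ε := ε) (x := x) hij
    simp only [resets] at h
    simp only [anchor]
    split_ifs at h ⊢ with hc
    · omega
    · exact ih h

/-- Were the counter unchanged, both values would lie within ε of one common anchor, hence within 2ε
of each other. -/
theorem resets_succ_le (hε : 0 < ε) {i j : ℕ} (hij : i ≤ j) (h : 2 * ε ≤ ‖x i - x j‖) :
    resets ε x i + 1 ≤ resets ε x j := by
  by_contra hc
  have h1 := resets_mono (ε := ε) (x := x) hij
  have h2 := anchor_eq_of_resets_eq (ε := ε) (x := x) hij (by omega)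
  have h3 := norm_sub_anchor_lt (x := x) hε i
  have h4 := norm_sub_anchor_lt (x := x) hε j
  rw [← h2, norm_sub_rev] at h4
  have h5 := norm_sub_le_norm_sub_add_norm_sub (x i) (anchor ε x i) (x j)
  linarith

/-- A function with finitely many oscillations of each size has one-sided limits. -/
theorem exists_tendsto_of_oscillations [CompleteSpace G] {f : ℝ≥0 → G} {D : Set ℝ≥0}
    {L : Filter ℝ≥0} (hD : D ∈ L)
    (hL : (∀ x ∈ D, ∀ᶠ z in L, z < x) ∨ (∀ x ∈ D, ∀ᶠ z in L, x < z))
    (hf : ∀ ε > 0, ∃ c : ℕ → ℝ≥0 → ℕ, (∀ n, Monotone (c n)) ∧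
      (∃ K, ∃ᶠ n in atTop, ∀ t, c n t ≤ K) ∧
      ∀ x ∈ D, ∀ y ∈ D, x < y → ε ≤ ‖f x - f y‖ → ∀ᶠ n in atTop, c n x + 1 ≤ c n y) :
    ∃ l, Tendsto f L (𝓝 l) := by
  rcases eq_or_neBot L with rfl | hne
  · exact ⟨0, tendsto_bot⟩
  refine cauchy_map_iff_exists_tendsto.1 (Metric.cauchy_iff.2 ⟨inferInstance, ?_⟩)
  by_contra hc
  push Not at hc
  obtain ⟨ε, hε, h⟩ := hc
  -- If the image filter is not Cauchy, every member of the filter contains two times between which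
  -- f moves by at least ε.
  have hpair : ∀ W ∈ L, ∃ x ∈ W, ∃ y ∈ W, x < y ∧ ε ≤ ‖f x - f y‖ := by
    intro W hW
    obtain ⟨_, ⟨x, hx, rfl⟩, _, ⟨y, hy, rfl⟩, hxy⟩ := h (f '' W) (image_mem_map hW)
    rcases lt_trichotomy x y with hlt | rfl | hlt
    · exact ⟨x, hx, y, hy, hlt, by rwa [← dist_eq_norm]⟩
    · rw [dist_self] at hxy; linarith
    · exact ⟨y, hy, x, hx, hlt, by rwa [← dist_eq_norm, dist_comm]⟩
  obtain ⟨c, hmono, ⟨K, hK⟩, hcount⟩ := hf ε hε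
  -- Pairs are stacked: the next pair is sought on the side of the previous one towards which the
  -- filter tends, so the counts of disjoint oscillations add up.
  have key : ∀ K : ℕ, ∀ W ∈ L, ∃ a ∈ W, ∃ b ∈ W, ∀ᶠ n in atTop, c n a + K ≤ c n b := by
    intro K
    induction K with
    | zero =>
      intro W hW
      obtain ⟨a, ha⟩ := hne.nonempty_of_mem hW
      exact ⟨a, ha, a, ha, Eventually.of_forall fun n => le_rfl⟩
    | succ K ih =>
      intro W hW
      obtain ⟨x, hx, y, hy, hxy, hε'⟩ := hpair _ (inter_mem hW hD)
      have hxyc := hcount x hx.2 y hy.2 hxy hε'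
      rcases hL with hL | hL
      · obtain ⟨a, ha, b, hb, hab⟩ := ih _ (inter_mem hW (hL x hx.2))
        refine ⟨a, ha.1, y, hy.1, ?_⟩
        filter_upwards [hxyc, hab] with n h1 h2
        have := hmono n (le_of_lt hb.2)
        omega
      · obtain ⟨a, ha, b, hb, hab⟩ := ih _ (inter_mem hW (hL y hy.2))
        refine ⟨x, hx.1, b, hb.1, ?_⟩
        filter_upwards [hxyc, hab] with n h1 h2
        have := hmono n (le_of_lt ha.2)
        omega
  -- The count exceeds K on all fine levels, but stays below K on infinitely many; one common level
  -- gives the contradiction.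
  obtain ⟨a, -, b, -, hab⟩ := key (K + 1) _ univ_mem
  obtain ⟨n, h1, h2⟩ := (hK.and_eventually hab).exists
  have := h1 b
  omega

end Oscillation

/-! ### Dyadic times and one-sided limits along them -/

section DyadicIndex

variable {T : ℝ≥0}

/-- The dyadic times in `[0,T]`. -/
def dyadicTimes (T : ℝ≥0) : Set ℝ≥0 := {t | ∃ n k, t = dyadicTime T n k}

theorem dyadicTimes_countable : (dyadicTimes T).Countable := by
  refine (countable_range fun p : ℕ × ℕ => dyadicTime T p.1 p.2).mono ?_
  rintro _ ⟨n, k, rfl⟩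
  exact ⟨(n, k), rfl⟩

theorem le_of_mem_dyadicTimes {t : ℝ≥0} (ht : t ∈ dyadicTimes T) : t ≤ T := by
  obtain ⟨n, k, rfl⟩ := ht
  exact dyadicTime_le n k

/-- The index of a dyadic time on a fine enough level. -/
noncomputable def dyadicIndex (T : ℝ≥0) (n : ℕ) (t : ℝ≥0) : ℕ :=
  if t < T then ⌊t * 2 ^ n⌋₊ else ⌈T * 2 ^ n⌉₊

theorem dyadicIndex_le (n : ℕ) (t : ℝ≥0) : dyadicIndex T n t ≤ ⌈T * 2 ^ n⌉₊ := by
  unfold dyadicIndex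
  split_ifs with h
  · exact (Nat.floor_mono (by gcongr)).trans (Nat.floor_le_ceil _)
  · exact le_rfl

theorem dyadicIndex_mono (n : ℕ) : Monotone (dyadicIndex T n) := fun s t hst => by
  by_cases ht : t < T
  · simp only [dyadicIndex, ht, hst.trans_lt ht, if_true]
    exact Nat.floor_mono (by gcongr)
  · refine (dyadicIndex_le n s).trans ?_
    simp [dyadicIndex, ht]

/-- Dyadic grids are nested, so below T the floor is exact once the level is reached; T itself need
not be dyadic and is recovered through the cut-off. -/
theorem dyadicTime_dyadicIndex {t : ℝ≥0} (ht : t ∈ dyadicTimes T) :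
    ∀ᶠ n in atTop, dyadicTime T n (dyadicIndex T n t) = t := by
  obtain ⟨m, k, rfl⟩ := ht
  filter_upwards [eventually_ge_atTop m] with n hn
  obtain ⟨j, rfl⟩ := Nat.exists_eq_add_of_le hn
  by_cases h : dyadicTime T m k < T
  · have h1 : dyadicTime T m k = k / 2 ^ m := by
      rcases min_lt_iff.1 h with h' | h'
      · exact absurd h' (lt_irrefl _)
      · exact min_eq_right h'.le
    have h2 : dyadicIndex T (m + j) (dyadicTime T m k) = k * 2 ^ j := by
      simp only [dyadicIndex, h, if_true]
      rw [h1, pow_add, ← mul_assoc, div_mul_cancel₀ _ (by positivity)]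
      have : (k : ℝ≥0) * 2 ^ j = ((k * 2 ^ j : ℕ) : ℝ≥0) := by push_cast; rfl
      rw [this, Nat.floor_natCast]
    rw [h2, dyadicTime_add]
  · have h1 : dyadicTime T m k = T := le_antisymm (dyadicTime_le _ _) (not_lt.1 h)
    rw [h1]
    simp only [dyadicIndex, lt_irrefl, if_false]
    exact dyadicTime_ceil _ le_rfl

theorem mem_closure_dyadicTimes {t : ℝ≥0} (ht : t < T) :
    (𝓝[dyadicTimes T ∩ Ioi t] t).NeBot := by
  rw [← mem_closure_iff_nhdsWithin_neBot]
  choose k hk hle hlt using fun n => dyadicTime_floor_le n ht.le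
  refine mem_closure_of_tendsto (f := fun n => dyadicTime T n (k n)) (b := atTop) ?_
    (Eventually.of_forall fun n => ⟨⟨n, k n, rfl⟩, hlt n ht⟩)
  refine tendsto_of_tendsto_of_tendsto_of_le_of_le tendsto_const_nhds ?_
    (fun n => (hlt n ht).le) hle
  have : Tendsto (fun n : ℕ => t + (1 / 2 : ℝ≥0) ^ n) atTop (𝓝 (t + 0)) :=
    tendsto_const_nhds.add (NNReal.tendsto_pow_atTop_nhds_zero_of_lt_one one_half_lt_one)
  simpa using this

/-- The right limits along the dyadic times of a function that has one-sided limits along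
the dyadic times form a càdlàg function. -/
theorem cadlagOn_of_tendsto_dyadic {G : Type*} [NormedAddCommGroup G] {f y : ℝ≥0 → G}
    (hr : ∀ t < T, Tendsto f (𝓝[dyadicTimes T ∩ Ioi t] t) (𝓝 (y t)))
    (hl : ∀ t ≤ T, ∃ l, Tendsto f (𝓝[dyadicTimes T ∩ Iio t] t) (𝓝 l)) : CadlagOn T y := by
  -- The value y s is a limit of values of f at dyadic times just after s, so closed bounds on those
  -- values pass to y s.
  have key : ∀ s < T, ∀ (W : Set ℝ≥0) (l : G) (ε : ℝ), IsOpen W → s ∈ W →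
      (∀ d ∈ W, d ∈ dyadicTimes T → s < d → dist (f d) l ≤ ε) → dist (y s) l ≤ ε := by
    intro s hs W l ε hW hsW h
    have := mem_closure_dyadicTimes hs
    refine le_of_tendsto ((hr s hs).dist tendsto_const_nhds) ?_
    filter_upwards [mem_nhdsWithin_of_mem_nhds (hW.mem_nhds hsW), self_mem_nhdsWithin] with d h1 h2
    exact h d h1 h2.1 h2.2
  intro t ht
  constructor
  · rcases ht.lt_or_eq with ht | rfl
    · rw [ContinuousWithinAt, Metric.tendsto_nhds]
      intro ε hε
      have h1 := Metric.tendsto_nhds.1 (hr t ht) (ε / 2) (half_pos hε)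
      obtain ⟨W, hW, htW, hWs⟩ := mem_nhdsWithin.1 h1
      filter_upwards [mem_nhdsWithin_of_mem_nhds (hW.mem_nhds htW),
        mem_nhdsWithin_of_mem_nhds (Iio_mem_nhds ht), self_mem_nhdsWithin] with s h2 h3 h4
      refine (key s h3 W (y t) (ε / 2) hW h2 fun d hd hdD hsd => ?_).trans_lt (half_lt_self hε)
      exact (hWs ⟨hd, hdD, h4.1.trans_lt hsd⟩).le
    · simp only [Icc_self]
      exact continuousWithinAt_singleton
  · obtain ⟨l, hl⟩ := hl t ht
    refine ⟨l, Metric.tendsto_nhds.2 fun ε hε => ?_⟩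
    have h1 := Metric.tendsto_nhds.1 hl (ε / 2) (half_pos hε)
    obtain ⟨W, hW, htW, hWs⟩ := mem_nhdsWithin.1 h1
    filter_upwards [mem_nhdsWithin_of_mem_nhds (hW.mem_nhds htW), self_mem_nhdsWithin] with s h2 h3
    refine (key s (lt_of_lt_of_le h3 ht) (W ∩ Iio t) l (ε / 2) (hW.inter isOpen_Iio) ⟨h2, h3⟩
      fun d hd hdD _ => ?_).trans_lt (half_lt_self hε)
    exact (hWs ⟨hd.1, hdD, hd.2⟩).le

end DyadicIndex

/-! ### Càdlàg modifications of square integrable martingales -/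

section Regularization

set_option linter.unusedSectionVars false

variable {Ω G : Type*} {mΩ : MeasurableSpace Ω} {P : Measure Ω} {ℱ : Filtration ℝ≥0 mΩ}
  [NormedAddCommGroup G] [InnerProductSpace ℝ G] [CompleteSpace G] [IsProbabilityMeasure P]
  {T : ℝ≥0} {X : ℝ≥0 → Ω → G}

namespace IsL2Martingale

theorem anchor_props (hX : IsL2Martingale P ℱ T X) {τ : ℕ → ℝ≥0} (hτ : Monotone τ)
    (hτT : ∀ k, τ k ≤ T) (ε : ℝ) (k : ℕ) :
    StronglyMeasurable[ℱ (τ k)] (fun ω => anchor ε (fun j => X (τ j) ω) k) ∧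
    MemLp (fun ω => anchor ε (fun j => X (τ j) ω) k) 2 P ∧
    StronglyMeasurable[ℱ (τ k)] (fun ω => (resets ε (fun j => X (τ j) ω) k : ℝ)) := by
  induction k with
  | zero => exact ⟨hX.adapted _ (hτT 0), hX.memLp _ (hτT 0), by
    simp only [resets]; exact stronglyMeasurable_const⟩
  | succ k ih =>
    have hle := ℱ.mono (hτ k.le_succ)
    have h1 := hX.adapted _ (hτT (k + 1))
    have h2 := hX.memLp _ (hτT (k + 1))
    have h3 := ih.1.mono hle
    have hB : MeasurableSet[ℱ (τ (k + 1))]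
        {ω | ε ≤ ‖X (τ (k + 1)) ω - anchor ε (fun j => X (τ j) ω) k‖} :=
      (@measurable_const _ _ _ (ℱ (τ (k + 1))) ε |>.stronglyMeasurable).measurableSet_le
        (h1.sub h3).norm
    refine ⟨StronglyMeasurable.ite hB h1 h3, ?_, ?_⟩
    · refine ((h2.indicator (ℱ.le _ _ hB)).add (ih.2.1.indicator (ℱ.le _ _ hB).compl)).ae_eq
        (ae_of_all _ fun ω => ?_)
      by_cases hω : ε ≤ ‖X (τ (k + 1)) ω - anchor ε (fun j => X (τ j) ω) k‖ <;>
        simp [anchor, hω]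
    · have e : (fun ω => (resets ε (fun j => X (τ j) ω) (k + 1) : ℝ)) = fun ω =>
          if ε ≤ ‖X (τ (k + 1)) ω - anchor ε (fun j => X (τ j) ω) k‖ then
            (resets ε (fun j => X (τ j) ω) k : ℝ) + 1 else resets ε (fun j => X (τ j) ω) k := by
        ext ω
        simp only [resets]
        split_ifs <;> simp
      rw [e]
      exact StronglyMeasurable.ite hB ((ih.2.2.mono hle).add stronglyMeasurable_const)
        (ih.2.2.mono hle)

/-- The mean squared distance from the anchor acts as a potential. A time step increases it exactly
by the variance of the increment, since the anchor is known beforehand, and each reset lowers it by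
at least ε². The increments' variances sum to at most E‖X‖², so ε² times the expected number of
resets is bounded independently of the grid. -/
theorem integral_resets_le (hX : IsL2Martingale P ℱ T X) {τ : ℕ → ℝ≥0} (hτ : Monotone τ)
    (hτT : ∀ k, τ k ≤ T) {ε : ℝ} (hε : 0 < ε) (k : ℕ) :
    Integrable (fun ω => (resets ε (fun j => X (τ j) ω) k : ℝ)) P ∧
    ∫ ω, ‖X (τ k) ω - anchor ε (fun j => X (τ j) ω) k‖ ^ 2 ∂P
      + ε ^ 2 * ∫ ω, (resets ε (fun j => X (τ j) ω) k : ℝ) ∂P ≤ ∫ ω, ‖X (τ k) ω‖ ^ 2 ∂P := by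
  have hint : ∀ k, Integrable (fun ω => (resets ε (fun j => X (τ j) ω) k : ℝ)) P := fun k => by
    refine Integrable.mono' (integrable_const (k : ℝ))
      ((hX.anchor_props hτ hτT ε k).2.2.mono (ℱ.le _)).aestronglyMeasurable
      (ae_of_all _ fun ω => ?_)
    rw [Real.norm_of_nonneg (Nat.cast_nonneg _)]
    exact_mod_cast resets_le k
  refine ⟨hint k, ?_⟩
  induction k with
  | zero =>
    simp only [anchor, sub_self, norm_zero, resets, Nat.cast_zero, integral_zero, mul_zero,
      ne_eq, OfNat.ofNat_ne_zero, not_false_eq_true, zero_pow, add_zero]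
    exact integral_nonneg fun ω => sq_nonneg _
  | succ k ih =>
    set Z : ℕ → Ω → G := fun k ω => anchor ε (fun j => X (τ j) ω) k with hZ
    have hZm := fun k => (hX.anchor_props hτ hτT ε k).1
    have hZ2 : ∀ k, MemLp (Z k) 2 P := fun k => (hX.anchor_props hτ hτT ε k).2.1
    have hstep := hτ k.le_succ
    have hk := hτT k
    have hk1 := hτT (k + 1)
    -- Pythagoras with the vector from the old anchor to the old value, which is known at time τ k.
    have e1 := hX.integral_norm_sq_sub_add hstep hk1 ((hX.adapted _ hk).sub (hZm k))
      ((hX.memLp _ hk).sub (hZ2 k))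
    have e2 := hX.integral_norm_sq_eq hstep hk1
    simp only [Pi.sub_apply, sub_add_sub_cancel] at e1
    have i1 : ∀ k, MemLp (fun ω => X (τ k) ω - Z k ω) 2 P :=
      fun k => (hX.memLp _ (hτT k)).sub (hZ2 k)
    have i2 : MemLp (fun ω => X (τ (k + 1)) ω - Z k ω) 2 P := (hX.memLp _ hk1).sub (hZ2 k)
    have hle : ∫ ω, (‖X (τ (k + 1)) ω - Z (k + 1) ω‖ ^ 2
          + ε ^ 2 * (resets ε (fun j => X (τ j) ω) (k + 1) : ℝ)) ∂P
        ≤ ∫ ω, (‖X (τ (k + 1)) ω - Z k ω‖ ^ 2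
          + ε ^ 2 * (resets ε (fun j => X (τ j) ω) k : ℝ)) ∂P := by
      refine integral_mono ((i1 _).integrable_norm_sq.add ((hint _).const_mul _))
        (i2.integrable_norm_sq.add ((hint _).const_mul _)) fun ω => ?_
      simp only [hZ, anchor, resets]
      split_ifs with h
      · have : ε ^ 2 ≤ ‖X (τ (k + 1)) ω - anchor ε (fun j => X (τ j) ω) k‖ ^ 2 :=
          pow_le_pow_left₀ hε.le h 2
        push_cast
        simp only [sub_self, norm_zero]
        nlinarith
      · exact le_rfl
    rw [integral_add (i1 _).integrable_norm_sq ((hint _).const_mul _),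
      integral_add i2.integrable_norm_sq ((hint _).const_mul _), integral_const_mul,
      integral_const_mul, e1] at hle
    linarith

/-- The expected counts are bounded by E‖X_T‖²/ε² uniformly in the level. By Fatou their lower limit
is almost surely finite, which bounds the counts along infinitely many levels. -/
theorem ae_frequently_resets_le (hX : IsL2Martingale P ℱ T X) {ε : ℝ} (hε : 0 < ε) :
    ∀ᵐ ω ∂P, ∃ K : ℕ, ∃ᶠ n in atTop,
      resets ε (fun j => X (dyadicTime T n j) ω) ⌈T * 2 ^ n⌉₊ ≤ K := by
  set C : ℕ → Ω → ℝ := fun n ω => (resets ε (fun j => X (dyadicTime T n j) ω) ⌈T * 2 ^ n⌉₊ : ℝ)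
  have hC := fun n => hX.integral_resets_le (dyadicTime_mono n) (dyadicTime_le n) hε ⌈T * 2 ^ n⌉₊
  set B : ℝ := (∫ ω, ‖X T ω‖ ^ 2 ∂P) / ε ^ 2
  have hB : ∀ n, ∫⁻ ω, ENNReal.ofReal (C n ω) ∂P ≤ ENNReal.ofReal B := fun n => by
    rw [← ofReal_integral_eq_lintegral_ofReal (hC n).1 (ae_of_all _ fun ω => Nat.cast_nonneg _)]
    refine ENNReal.ofReal_le_ofReal ?_
    rw [le_div_iff₀ (by positivity), mul_comm]
    have h1 := (hC n).2
    rw [dyadicTime_ceil n le_rfl] at h1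
    refine le_trans ?_ h1
    exact le_add_of_nonneg_left (integral_nonneg fun ω => sq_nonneg _)
  have hlim : ∫⁻ ω, liminf (fun n => ENNReal.ofReal (C n ω)) atTop ∂P < ∞ := by
    refine (lintegral_liminf_le' fun n => (hC n).1.1.aemeasurable.ennreal_ofReal).trans_lt ?_
    refine (liminf_le_liminf (Eventually.of_forall hB)).trans_lt ?_
    rw [liminf_const]
    exact ENNReal.ofReal_lt_top
  have hae := ae_lt_top (Measurable.liminf fun n => ((hX.anchor_props (dyadicTime_mono n)
    (dyadicTime_le n) ε ⌈T * 2 ^ n⌉₊).2.2.mono (ℱ.le _)).measurable.ennreal_ofReal) hlim.ne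
  filter_upwards [hae] with ω hω
  obtain ⟨K, hK⟩ := ENNReal.exists_nat_gt hω.ne
  refine ⟨K, (frequently_lt_of_liminf_lt (by isBoundedDefault) hK).mono fun n hn => ?_⟩
  have : ENNReal.ofReal (C n ω) = (resets ε (fun j => X (dyadicTime T n j) ω) ⌈T * 2 ^ n⌉₊ : ℕ) :=
    ENNReal.ofReal_natCast _
  rw [this] at hn
  exact_mod_cast hn.le

/-- The counters of `exists_tendsto_of_oscillations` are the resets on the dyadic grids. Countably
many thresholds suffice, so one null set serves all sizes of oscillation and all times t. -/
theorem ae_exists_tendsto (hX : IsL2Martingale P ℱ T X) :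
    ∀ᵐ ω ∂P, (∀ t < T, ∃ l, Tendsto (fun s => X s ω) (𝓝[dyadicTimes T ∩ Ioi t] t) (𝓝 l)) ∧
      ∀ t ≤ T, ∃ l, Tendsto (fun s => X s ω) (𝓝[dyadicTimes T ∩ Iio t] t) (𝓝 l) := by
  have h := ae_all_iff.2 fun j : ℕ =>
    hX.ae_frequently_resets_le (ε := 1 / ((j : ℝ) + 1)) (by positivity)
  filter_upwards [h] with ω hω
  have hosc : ∀ ε > 0, ∃ c : ℕ → ℝ≥0 → ℕ, (∀ n, Monotone (c n)) ∧
      (∃ K, ∃ᶠ n in atTop, ∀ t, c n t ≤ K) ∧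
      ∀ x ∈ dyadicTimes T, ∀ y ∈ dyadicTimes T, x < y → ε ≤ ‖X x ω - X y ω‖ →
        ∀ᶠ n in atTop, c n x + 1 ≤ c n y := by
    intro ε hε
    -- The threshold is taken below ε/2 because `resets_succ_le` detects only moves of twice the
    -- threshold.
    obtain ⟨j, hj⟩ := exists_nat_one_div_lt (half_pos hε)
    obtain ⟨K, hK⟩ := hω j
    refine ⟨fun n t => resets (1 / ((j : ℝ) + 1)) (fun i => X (dyadicTime T n i) ω)
      (dyadicIndex T n t), fun n => resets_mono.comp (dyadicIndex_mono n),
      ⟨K, hK.mono fun n hn t => (resets_mono (dyadicIndex_le n t)).trans hn⟩, ?_⟩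
    intro x hx y hy hxy hfxy
    filter_upwards [dyadicTime_dyadicIndex hx, dyadicTime_dyadicIndex hy] with n h1 h2
    refine resets_succ_le (by positivity) (dyadicIndex_mono n hxy.le) ?_
    simp only [h1, h2]
    linarith
  constructor
  · intro t ht
    refine exists_tendsto_of_oscillations (D := dyadicTimes T ∩ Ioi t) self_mem_nhdsWithin
      (Or.inl fun x hx => mem_nhdsWithin_of_mem_nhds (Iio_mem_nhds hx.2)) fun ε hε => ?_
    obtain ⟨c, h1, h2, h3⟩ := hosc ε hε
    exact ⟨c, h1, h2, fun x hx y hy => h3 x hx.1 y hy.1⟩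
  · intro t ht
    refine exists_tendsto_of_oscillations (D := dyadicTimes T ∩ Iio t) self_mem_nhdsWithin
      (Or.inr fun x hx => mem_nhdsWithin_of_mem_nhds (Ioi_mem_nhds hx.2)) fun ε hε => ?_
    obtain ⟨c, h1, h2, h3⟩ := hosc ε hε
    exact ⟨c, h1, h2, fun x hx y hy => h3 x hx.1 y hy.1⟩

/-- A square integrable martingale which is right continuous in `L²` has a càdlàg modification. -/
theorem exists_cadlag_modification [SecondCountableTopology G] (hℱ : UsualConditions P ℱ)
    (hX : IsL2Martingale P ℱ T X)
    (hr : ∀ t < T, Tendsto (fun s => ∫⁻ ω, ‖X s ω - X t ω‖ₑ ^ 2 ∂P) (𝓝[Icc t T] t) (𝓝 0)) :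
    ∃ Y : ℝ≥0 → Ω → G, IsCadlagSqIntMartingale P ℱ T Y ∧ ∀ t ≤ T, X t =ᵐ[P] Y t := by
  -- Off the null set of paths without limits `limUnder` is the right limit; on that set its value
  -- is arbitrary. At T the process itself is kept.
  set Y : ℝ≥0 → Ω → G := fun t ω =>
    if t < T then limUnder (𝓝[dyadicTimes T ∩ Ioi t] t) (fun s => X s ω) else X t ω
  have hlim : ∀ᵐ ω ∂P, ∀ t < T,
      Tendsto (fun s => X s ω) (𝓝[dyadicTimes T ∩ Ioi t] t) (𝓝 (Y t ω)) := by
    filter_upwards [hX.ae_exists_tendsto] with ω hω t ht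
    simp only [Y, ht, if_true]
    exact tendsto_nhds_limUnder (hω.1 t ht)
  have hXY : ∀ t ≤ T, X t =ᵐ[P] Y t := by
    intro t ht
    rcases ht.lt_or_eq with ht | rfl
    · have := mem_closure_dyadicTimes ht
      obtain ⟨s, hs⟩ := exists_seq_tendsto (𝓝[dyadicTimes T ∩ Ioi t] t)
      obtain ⟨N, hN⟩ := eventually_atTop.1 (hs.eventually self_mem_nhdsWithin)
      set s' : ℕ → ℝ≥0 := fun n => s (n + N)
      have hs' : Tendsto s' atTop (𝓝[dyadicTimes T ∩ Ioi t] t) := hs.comp (tendsto_add_atTop_nat N)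
      have hmem : ∀ n, s' n ∈ dyadicTimes T ∩ Ioi t := fun n => hN _ (by simp)
      have hsT : ∀ n, s' n ≤ T := fun n => le_of_mem_dyadicTimes (hmem n).1
      have hs'' : Tendsto s' atTop (𝓝[Icc t T] t) := tendsto_nhdsWithin_iff.2
        ⟨(tendsto_nhdsWithin_iff.1 hs').1, Eventually.of_forall fun n => ⟨(hmem n).2.le, hsT n⟩⟩
      have hm : ∀ n, AEStronglyMeasurable (X (s' n)) P := fun n => (hX.memLp _ (hsT n)).1
      -- Along one sequence of dyadic times decreasing to t, the process tends to X t in L² and to Y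
      -- t almost surely; limits in measure are unique.
      have h1 : TendstoInMeasure P (fun n => X (s' n)) atTop (X t) :=
        tendstoInMeasure_of_tendsto_eLpNorm two_ne_zero hm (hX.memLp t ht.le).1
          (tendsto_eLpNorm_of_lintegral ((hr t ht).comp hs''))
      refine tendstoInMeasure_ae_unique h1 (tendstoInMeasure_of_tendsto_ae hm ?_)
      filter_upwards [hlim] with ω hω
      exact (hω t ht).comp hs'
    · exact ae_of_all _ fun ω => by simp [Y]
  refine ⟨Y, (hX.congr hℱ hXY).isCadlagSqIntMartingale ?_, hXY⟩
  filter_upwards [hlim, hX.ae_exists_tendsto] with ω h1 h2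
  exact cadlagOn_of_tendsto_dyadic h1 h2.2

end IsL2Martingale

end Regularization

/-! ### Limits of martingales -/

section Limits

set_option linter.unusedSectionVars false

variable {Ω G : Type*} {mΩ : MeasurableSpace Ω} {P : Measure Ω} {ℱ : Filtration ℝ≥0 mΩ}
  [NormedAddCommGroup G] [InnerProductSpace ℝ G] [CompleteSpace G] [IsProbabilityMeasure P]
  {T : ℝ≥0}

theorem edist_toLp_sq {X Y : Ω → G} (hX : MemLp X 2 P) (hY : MemLp Y 2 P) :
    edist (hX.toLp X) (hY.toLp Y) ^ 2 = ∫⁻ ω, ‖X ω - Y ω‖ₑ ^ 2 ∂P := by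
  rw [Lp.edist_toLp_toLp, eLpNorm_two_sq]
  rfl

theorem tendsto_pow_two_zero_iff {ι : Type*} {l : Filter ι} {f : ι → ℝ≥0∞} :
    Tendsto (fun i => f i ^ 2) l (𝓝 0) ↔ Tendsto f l (𝓝 0) := by
  constructor
  · intro h
    have := (ENNReal.continuous_rpow_const (y := (1 / 2 : ℝ))).tendsto 0
    rw [ENNReal.zero_rpow_of_pos (by norm_num)] at this
    refine (this.comp h).congr fun i => ?_
    simp only [Function.comp_apply]
    rw [← ENNReal.rpow_natCast, ← ENNReal.rpow_mul]
    simp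
  · intro h
    have := ((ENNReal.continuous_pow 2).tendsto 0).comp h
    rwa [zero_pow two_ne_zero] at this

/-- `L²` completeness, with measurability with respect to a sub-σ-algebra. -/
theorem exists_limit_of_cauchy {m : MeasurableSpace Ω} (hm : m ≤ mΩ) {Z : ℕ → Ω → G}
    (hZm : ∀ k, StronglyMeasurable[m] (Z k)) (hZ : ∀ k, MemLp (Z k) 2 P)
    (hC : Tendsto (fun p : ℕ × ℕ => ∫⁻ ω, ‖Z p.1 ω - Z p.2 ω‖ₑ ^ 2 ∂P) atTop (𝓝 0)) :
    ∃ X : Ω → G, StronglyMeasurable[m] X ∧ MemLp X 2 P ∧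
      Tendsto (fun k => ∫⁻ ω, ‖Z k ω - X ω‖ₑ ^ 2 ∂P) atTop (𝓝 0) := by
  have hcau : CauchySeq fun k => (hZ k).toLp (Z k) := by
    rw [EMetric.cauchySeq_iff]
    intro ε hε
    have h1 : Tendsto (fun p : ℕ × ℕ => edist ((hZ p.1).toLp (Z p.1)) ((hZ p.2).toLp (Z p.2)))
        atTop (𝓝 0) := by
      rw [← tendsto_pow_two_zero_iff]
      simpa only [edist_toLp_sq] using hC
    obtain ⟨⟨a, b⟩, hab⟩ := eventually_atTop.1 (h1.eventually (gt_mem_nhds hε))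
    exact ⟨max a b, fun i hi j hj =>
      hab (i, j) ⟨(le_max_left _ _).trans hi, (le_max_right _ _).trans hj⟩⟩
  obtain ⟨x, hx⟩ := cauchySeq_tendsto_of_complete hcau
  have hxm : AEStronglyMeasurable[m] x P := by
    -- Being almost everywhere equal to an m-measurable function is a closed condition in L², which
    -- keeps the limit adapted.
    refine (isClosed_aestronglyMeasurable hm).mem_of_tendsto hx (Eventually.of_forall fun k => ?_)
    exact ⟨Z k, hZm k, MemLp.coeFn_toLp _⟩
  obtain ⟨X, hXm, hXx⟩ := hxm
  have hX : MemLp X 2 P := (memLp_congr_ae hXx).1 (Lp.memLp x)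
  refine ⟨X, hXm, hX, ?_⟩
  have hxe : x = hX.toLp X := Lp.ext (hXx.trans hX.coeFn_toLp.symm)
  have h2 := tendsto_pow_two_zero_iff.2 (tendsto_iff_edist_tendsto_0.1 hx)
  simpa only [hxe, edist_toLp_sq] using h2

theorem tendsto_integral_inner {Z : ℕ → Ω → G} {X V : Ω → G} (hZ : ∀ k, MemLp (Z k) 2 P)
    (hX : MemLp X 2 P) (hV : MemLp V 2 P)
    (h : Tendsto (fun k => ∫⁻ ω, ‖Z k ω - X ω‖ₑ ^ 2 ∂P) atTop (𝓝 0)) :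
    Tendsto (fun k => ∫ ω, (inner ℝ (Z k ω) (V ω) : ℝ) ∂P) atTop
      (𝓝 (∫ ω, (inner ℝ (X ω) (V ω) : ℝ) ∂P)) := by
  have h1 : Tendsto (fun k => (hZ k).toLp (Z k)) atTop (𝓝 (hX.toLp X)) := by
    rw [tendsto_iff_edist_tendsto_0, ← tendsto_pow_two_zero_iff]
    simpa only [edist_toLp_sq] using h
  have h2 : ∀ {Y : Ω → G} (hY : MemLp Y 2 P),
      (inner ℝ (hY.toLp Y) (hV.toLp V) : ℝ) = ∫ ω, (inner ℝ (Y ω) (V ω) : ℝ) ∂P := by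
    intro Y hY
    rw [L2.inner_def]
    refine integral_congr_ae ?_
    filter_upwards [hY.coeFn_toLp, hV.coeFn_toLp] with ω e1 e2
    rw [e1, e2]
  have h3 := (h1.inner (tendsto_const_nhds (x := hV.toLp V)) : Tendsto
    (fun k => (inner ℝ ((hZ k).toLp (Z k)) (hV.toLp V) : ℝ)) atTop _)
  simpa only [h2] using h3

/-- A sequence of square integrable martingales, right continuous in `L²`, that is Cauchy at the
terminal time, converges to a càdlàg square integrable martingale. -/
theorem exists_limit_martingale [SecondCountableTopology G] (hℱ : UsualConditions P ℱ)
    {Z : ℕ → ℝ≥0 → Ω → G} (hZ : ∀ k, IsL2Martingale P ℱ T (Z k))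
    (hr : ∀ k, ∀ t < T,
      Tendsto (fun s => ∫⁻ ω, ‖Z k s ω - Z k t ω‖ₑ ^ 2 ∂P) (𝓝[Icc t T] t) (𝓝 0))
    (hC : Tendsto (fun p : ℕ × ℕ => ∫⁻ ω, ‖Z p.1 T ω - Z p.2 T ω‖ₑ ^ 2 ∂P) atTop (𝓝 0)) :
    ∃ X : ℝ≥0 → Ω → G, IsCadlagSqIntMartingale P ℱ T X ∧
      ∀ t ≤ T, Tendsto (fun k => ∫⁻ ω, ‖Z k t ω - X t ω‖ₑ ^ 2 ∂P) atTop (𝓝 0) := by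
  -- Differences of martingales have nondecreasing L² norm, so the Cauchy property at T passes to
  -- every earlier time.
  have hCt : ∀ t ≤ T,
      Tendsto (fun p : ℕ × ℕ => ∫⁻ ω, ‖Z p.1 t ω - Z p.2 t ω‖ₑ ^ 2 ∂P) atTop (𝓝 0) :=
    fun t ht => tendsto_of_tendsto_of_tendsto_of_le_of_le tendsto_const_nhds hC
      (fun _ => zero_le) fun p => ((hZ p.1).sub (hZ p.2)).lintegral_mono ht le_rfl
  have hex : ∀ t, ∃ X : Ω → G, t ≤ T → StronglyMeasurable[ℱ t] X ∧ MemLp X 2 P ∧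
      Tendsto (fun k => ∫⁻ ω, ‖Z k t ω - X ω‖ₑ ^ 2 ∂P) atTop (𝓝 0) := by
    intro t
    by_cases ht : t ≤ T
    · obtain ⟨X, hX⟩ := exists_limit_of_cauchy (ℱ.le t) (fun k => (hZ k).adapted t ht)
        (fun k => (hZ k).memLp t ht) (hCt t ht)
      exact ⟨X, fun _ => hX⟩
    · exact ⟨0, fun h => absurd h ht⟩
  choose X hX using hex
  have hXL : IsL2Martingale P ℱ T X := by
    refine ⟨fun t ht => (hX t ht).1, fun t ht => (hX t ht).2.1, fun s t hst ht V hV hV2 => ?_⟩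
    have hs := hst.trans ht
    have h1 := tendsto_integral_inner (fun k => (hZ k).memLp t ht) (hX t ht).2.1 hV2 (hX t ht).2.2
    have h2 := tendsto_integral_inner (fun k => (hZ k).memLp s hs) (hX s hs).2.1 hV2 (hX s hs).2.2
    have h3 := h1.sub h2
    simp_rw [inner_sub_left]
    rw [integral_sub (integrable_inner_of_memLp (hX t ht).2.1 hV2)
      (integrable_inner_of_memLp (hX s hs).2.1 hV2)]
    refine tendsto_nhds_unique h3 (tendsto_const_nhds.congr fun k => ?_)
    rw [← integral_sub (integrable_inner_of_memLp ((hZ k).memLp t ht) hV2)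
      (integrable_inner_of_memLp ((hZ k).memLp s hs) hV2)]
    simp_rw [← inner_sub_left]
    exact ((hZ k).orthogonal s t hst ht V hV hV2).symm
  have hXT : ∀ t ≤ T, ∀ k, ∫⁻ ω, ‖Z k t ω - X t ω‖ₑ ^ 2 ∂P ≤ ∫⁻ ω, ‖Z k T ω - X T ω‖ₑ ^ 2 ∂P :=
    fun t ht k => ((hZ k).sub hXL).lintegral_mono ht le_rfl
  -- The convergence is uniform in t, being controlled at T, so L² right continuity survives. The
  -- two squared triangle inequalities give weights 2, 4 and 4; with ε/12 for each term, their sum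
  -- stays below ε.
  have hXr : ∀ t < T,
      Tendsto (fun s => ∫⁻ ω, ‖X s ω - X t ω‖ₑ ^ 2 ∂P) (𝓝[Icc t T] t) (𝓝 0) := by
    intro t ht
    rw [ENNReal.tendsto_nhds_zero]
    intro ε hε
    obtain ⟨k, hk⟩ := ((ENNReal.tendsto_nhds_zero.1 (hX T le_rfl).2.2) (ε / 12)
      (ENNReal.div_pos hε.ne' (by norm_num))).exists
    filter_upwards [(ENNReal.tendsto_nhds_zero.1 (hr k t ht)) (ε / 12)
      (ENNReal.div_pos hε.ne' (by norm_num)), self_mem_nhdsWithin] with s hs hsT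
    have hXs := (hX s hsT.2).2.1.1
    have hZs := ((hZ k).memLp s hsT.2).1
    have hZt := ((hZ k).memLp t ht.le).1
    calc ∫⁻ ω, ‖X s ω - X t ω‖ₑ ^ 2 ∂P
        ≤ 2 * ∫⁻ ω, ‖X s ω - Z k s ω‖ₑ ^ 2 ∂P + 2 * ∫⁻ ω, ‖Z k s ω - X t ω‖ₑ ^ 2 ∂P :=
          lintegral_enorm_sub_sq_triangle hXs hZs
      _ ≤ 2 * ∫⁻ ω, ‖X s ω - Z k s ω‖ₑ ^ 2 ∂P + 2 * (2 * ∫⁻ ω, ‖Z k s ω - Z k t ω‖ₑ ^ 2 ∂P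
            + 2 * ∫⁻ ω, ‖Z k t ω - X t ω‖ₑ ^ 2 ∂P) := by
          gcongr
          exact lintegral_enorm_sub_sq_triangle hZs hZt
      _ ≤ 2 * (ε / 12) + 2 * (2 * (ε / 12) + 2 * (ε / 12)) := by
          rw [lintegral_enorm_sub_sq_comm (X s)]
          gcongr
          · exact (hXT s hsT.2 k).trans hk
          · exact (hXT t ht.le k).trans hk
      _ = (ε / 12) * 10 := by ring
      _ ≤ (ε / 12) * 12 := by gcongr; norm_num
      _ = ε := ENNReal.div_mul_cancel (by norm_num) (by norm_num)
  obtain ⟨Y, hY, hXY⟩ := hXL.exists_cadlag_modification hℱ hXr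
  refine ⟨Y, hY, fun t ht => ((hX t ht).2.2).congr fun k => lintegral_congr_ae ?_⟩
  filter_upwards [hXY t ht] with ω hω
  rw [hω]

/-- Two càdlàg processes which are modifications of each other are indistinguishable. -/
theorem ae_forall_eq_of_cadlag {X Y : ℝ≥0 → Ω → G}
    (hX : ∀ᵐ ω ∂P, CadlagOn T fun t => X t ω) (hY : ∀ᵐ ω ∂P, CadlagOn T fun t => Y t ω)
    (h : ∀ t ≤ T, X t =ᵐ[P] Y t) : ∀ᵐ ω ∂P, ∀ t ≤ T, X t ω = Y t ω := by
  have hD : ∀ᵐ ω ∂P, ∀ t ∈ dyadicTimes T, X t ω = Y t ω :=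
    (ae_ball_iff dyadicTimes_countable).2 fun t ht => h t (le_of_mem_dyadicTimes ht)
  filter_upwards [hX, hY, hD, h T le_rfl] with ω h1 h2 h3 h4 t ht
  rcases ht.lt_or_eq with ht' | rfl
  · have hne := mem_closure_dyadicTimes ht'
    have hle : 𝓝[dyadicTimes T ∩ Ioi t] t ≤ 𝓝[Icc t T] t :=
      nhdsWithin_mono _ fun s hs => ⟨(mem_Ioi.1 hs.2).le, le_of_mem_dyadicTimes hs.1⟩
    refine tendsto_nhds_unique ((h1 t ht).1.tendsto.mono_left hle)
      (((h2 t ht).1.tendsto.mono_left hle).congr' ?_)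
    filter_upwards [self_mem_nhdsWithin] with s hs
    exact (h3 s hs.1).symm
  · exact h4

/-- A càdlàg square integrable martingale is determined by its terminal value. -/
theorem IsCadlagSqIntMartingale.indistinguishable {X Y : ℝ≥0 → Ω → G}
    (hX : IsCadlagSqIntMartingale P ℱ T X) (hY : IsCadlagSqIntMartingale P ℱ T Y)
    (h : X T =ᵐ[P] Y T) : ∀ᵐ ω ∂P, ∀ t ≤ T, X t ω = Y t ω :=
  ae_forall_eq_of_cadlag hX.cadlag hY.cadlag fun t ht =>
    (hX.condExp_eq t T ht le_rfl).symm.trans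
      ((condExp_congr_ae h).trans (hY.condExp_eq t T ht le_rfl))

theorem CadlagOn.add {x y : ℝ≥0 → G} (hx : CadlagOn T x) (hy : CadlagOn T y) :
    CadlagOn T fun t => x t + y t := fun t ht => by
  obtain ⟨l, hl⟩ := (hx t ht).2
  obtain ⟨l', hl'⟩ := (hy t ht).2
  exact ⟨(hx t ht).1.add (hy t ht).1, l + l', hl.add hl'⟩

theorem CadlagOn.neg {x : ℝ≥0 → G} (hx : CadlagOn T x) : CadlagOn T fun t => - x t :=
  fun t ht => by
    obtain ⟨l, hl⟩ := (hx t ht).2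
    exact ⟨(hx t ht).1.neg, - l, hl.neg⟩

theorem CadlagOn.zero : CadlagOn T fun _ => (0 : G) :=
  fun _ _ => ⟨continuousWithinAt_const, 0, tendsto_const_nhds⟩

theorem IsCadlagSqIntMartingale.add {X Y : ℝ≥0 → Ω → G}
    (hX : IsCadlagSqIntMartingale P ℱ T X) (hY : IsCadlagSqIntMartingale P ℱ T Y) :
    IsCadlagSqIntMartingale P ℱ T fun t ω => X t ω + Y t ω :=
  (hX.isL2Martingale.add hY.isL2Martingale).isCadlagSqIntMartingale (by
    filter_upwards [hX.cadlag, hY.cadlag] with ω h1 h2 using h1.add h2)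

theorem IsCadlagSqIntMartingale.neg {X : ℝ≥0 → Ω → G} (hX : IsCadlagSqIntMartingale P ℱ T X) :
    IsCadlagSqIntMartingale P ℱ T fun t ω => - X t ω :=
  hX.isL2Martingale.neg.isCadlagSqIntMartingale (by
    filter_upwards [hX.cadlag] with ω h1 using h1.neg)

theorem IsCadlagSqIntMartingale.sub {X Y : ℝ≥0 → Ω → G}
    (hX : IsCadlagSqIntMartingale P ℱ T X) (hY : IsCadlagSqIntMartingale P ℱ T Y) :
    IsCadlagSqIntMartingale P ℱ T fun t ω => X t ω - Y t ω := by
  simpa only [sub_eq_add_neg] using hX.add hY.neg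

theorem IsCadlagSqIntMartingale.zero :
    IsCadlagSqIntMartingale P ℱ T fun _ _ => (0 : G) :=
  IsL2Martingale.zero.isCadlagSqIntMartingale (ae_of_all _ fun _ => CadlagOn.zero)

end Limits

/-! ### Hilbert-Schmidt operators and Hilbertian seminorms -/

/-- Distinct basis vectors are at distance √2, so the balls of radius 1/2 around them are disjoint
open sets in a second countable space. -/
theorem HilbertBasis.countable {ι E : Type*} [NormedAddCommGroup E] [InnerProductSpace ℝ E]
    [SecondCountableTopology E] (b : HilbertBasis ι ℝ E) : Countable ι := by
  have hd : (univ : Set ι).PairwiseDisjoint fun i => Metric.ball (b i) (1 / 2) := by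
    intro i _ j _ hij
    refine Metric.ball_disjoint_ball ?_
    have h1 : dist (b i) (b j) ^ 2 = 2 := by
      rw [dist_eq_norm, norm_sub_sq_real, b.orthonormal.1 i, b.orthonormal.1 j,
        b.orthonormal.2 hij]
      norm_num
    nlinarith [dist_nonneg (x := b i) (y := b j)]
  exact countable_univ_iff.1 (hd.countable_of_isOpen (fun _ _ => Metric.isOpen_ball)
    fun i _ => Metric.nonempty_ball.2 (by norm_num))

section HilbertSchmidt

set_option linter.unusedSectionVars false

variable {E F G : Type*} [NormedAddCommGroup E] [InnerProductSpace ℝ E] [CompleteSpace E]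
  [NormedAddCommGroup F] [InnerProductSpace ℝ F] [CompleteSpace F]
  [NormedAddCommGroup G] [InnerProductSpace ℝ G] [CompleteSpace G]

theorem hsNormSq_eq_tsum_adjoint {ι : Type*} (S : E →L[ℝ] G) (d : HilbertBasis ι ℝ G) :
    hsNormSq S = ∑' j, ‖S.adjoint (d j)‖ₑ ^ 2 := by
  obtain ⟨w, b, -⟩ := exists_hilbertBasis ℝ E
  rw [hsNormSq_eq_tsum S b, tsum_enorm_sq_eq_adjoint S b d]

theorem hsNormSq_zero : hsNormSq (0 : E →L[ℝ] G) = 0 := by simp [hsNormSq]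

theorem hsNormSq_neg (S : E →L[ℝ] G) : hsNormSq (-S) = hsNormSq S := by simp [hsNormSq]

theorem hsNormSq_smul (c : ℝ) (S : E →L[ℝ] G) : hsNormSq (c • S) = ‖c‖ₑ ^ 2 * hsNormSq S := by
  simp [hsNormSq, enorm_smul, mul_pow, ENNReal.tsum_mul_left]

theorem hsNormSq_add_le (S R : E →L[ℝ] G) :
    hsNormSq (S + R) ≤ 2 * hsNormSq S + 2 * hsNormSq R := by
  unfold hsNormSq
  rw [← ENNReal.tsum_mul_left, ← ENNReal.tsum_mul_left, ← ENNReal.tsum_add]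
  exact ENNReal.tsum_le_tsum fun e => enorm_add_sq_le _ _

theorem hsNormSq_sub_le (S R : E →L[ℝ] G) :
    hsNormSq (S - R) ≤ 2 * hsNormSq S + 2 * hsNormSq R := by
  simpa [sub_eq_add_neg, hsNormSq_neg] using hsNormSq_add_le S (-R)

theorem hsNormSq_sub_comm (S R : E →L[ℝ] G) : hsNormSq (S - R) = hsNormSq (R - S) := by
  rw [← hsNormSq_neg, neg_sub]

/-- In a basis of the target, the adjoint of S ∘ B first applies S* and then B*, so B contributes
its operator norm in every term. -/
theorem hsNormSq_comp_le (S : E →L[ℝ] G) (B : F →L[ℝ] E) :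
    hsNormSq (S.comp B) ≤ ‖B‖ₑ ^ 2 * hsNormSq S := by
  obtain ⟨w, d, -⟩ := exists_hilbertBasis ℝ G
  rw [hsNormSq_eq_tsum_adjoint _ d, hsNormSq_eq_tsum_adjoint _ d, ← ENNReal.tsum_mul_left]
  refine ENNReal.tsum_le_tsum fun j => ?_
  rw [ContinuousLinearMap.adjoint_comp, ContinuousLinearMap.comp_apply, ← mul_pow]
  gcongr
  have : ‖B‖ₑ = ‖B.adjoint‖ₑ := by
    rw [← ofReal_norm, ← ofReal_norm, LinearIsometryEquiv.norm_map]
  rw [this]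
  exact ContinuousLinearMap.le_opENorm _ _

theorem IsHilbertSchmidt.neg {S : E →L[ℝ] G} (h : IsHilbertSchmidt S) :
    IsHilbertSchmidt (-S) := by
  rwa [IsHilbertSchmidt, hsNormSq_neg]

theorem IsHilbertSchmidt.zero : IsHilbertSchmidt (0 : E →L[ℝ] G) := by
  simp [IsHilbertSchmidt, hsNormSq_zero]

end HilbertSchmidt

namespace HilbertSeminorm

variable {H : Type*} [NormedAddCommGroup H] [InnerProductSpace ℝ H]

theorem denseRange_incl (q : HilbertSeminorm H) : DenseRange q.incl := by
  have h := UniformSpace.Completion.denseRange_coe (α := q.Pre)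
  have e : Set.range q.incl = Set.range ((↑) : q.Pre → q.Space) := by
    ext x
    constructor
    · rintro ⟨h, rfl⟩; exact ⟨q.toPre h, rfl⟩
    · rintro ⟨h, rfl⟩; exact ⟨h, rfl⟩
  rwa [DenseRange, e]

theorem norm_inclLE_le (p q : HilbertSeminorm H) (hpq : ∀ h, p h ≤ q h) :
    ‖inclLE p q hpq‖ ≤ 1 := by
  refine ContinuousLinearMap.opNorm_le_bound _ zero_le_one fun z => ?_
  have hc : IsClosed {z : q.Space | ‖inclLE p q hpq z‖ ≤ 1 * ‖z‖} :=
    isClosed_le (by fun_prop) (by fun_prop)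
  refine q.denseRange_incl.induction_on z hc fun h => ?_
  rw [inclLE_incl, norm_incl, norm_incl, one_mul]
  exact hpq h

theorem inclLE_comp_incl (p q : HilbertSeminorm H) (hpq : ∀ h, p h ≤ q h) :
    (inclLE p q hpq).comp q.incl = p.incl := by
  ext h
  exact inclLE_incl p q hpq h

/-- The norm of `H_q` is a supremum over a dense sequence of `H`. -/
theorem enorm_eq_iSup [SecondCountableTopology H] (q : HilbertSeminorm H) (v : q.Space) :
    ‖v‖ₑ = ⨆ n, ENNReal.ofReal
      (|inner ℝ v (q.incl (TopologicalSpace.denseSeq H n))|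
        / q (TopologicalSpace.denseSeq H n)) := by
  set e := TopologicalSpace.denseSeq H
  rw [← ofReal_norm]
  refine le_antisymm ?_ (iSup_le fun n => ENNReal.ofReal_le_ofReal ?_)
  · rcases eq_or_ne v 0 with rfl | hv
    · simp
    refine le_of_forall_lt fun c hc => ?_
    have hv' : ‖v‖ ≠ 0 := norm_ne_zero_iff.2 hv
    -- The quotient |⟨v,w⟩|/‖w‖ is continuous at w = v, where it equals ‖v‖; vectors of the dense
    -- sequence near v therefore come close to the supremum.
    have hcont : ContinuousAt (fun w : q.Space => ENNReal.ofReal (|inner ℝ v w| / ‖w‖)) v :=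
      ENNReal.continuous_ofReal.continuousAt.comp
        (ContinuousAt.div (by fun_prop) (by fun_prop) hv')
    have hval : c < ENNReal.ofReal (|inner ℝ v v| / ‖v‖) := by
      rw [real_inner_self_eq_norm_sq, abs_of_nonneg (sq_nonneg _), sq, mul_self_div_self]
      exact hc
    have hd : DenseRange (q.incl ∘ e) :=
      q.denseRange_incl.comp (TopologicalSpace.denseRange_denseSeq H) q.incl.continuous
    obtain ⟨_, hw, ⟨n, rfl⟩⟩ := mem_closure_iff_nhds.1 (hd v) _
      (hcont.eventually (lt_mem_nhds hval))
    simp only [Function.comp_apply, mem_ofPred_eq, norm_incl] at hw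
    exact hw.trans_le (le_iSup (fun n => ENNReal.ofReal
      (|inner ℝ v (q.incl (e n))| / q (e n))) n)
  · refine div_le_of_le_mul₀ (Real.sqrt_nonneg _) (norm_nonneg _) ?_
    rw [← q.norm_incl]
    exact abs_real_inner_le_norm _ _

end HilbertSeminorm

/-! ### Weakly measurable sections -/

section WeaklyMeasurable

set_option linter.unusedSectionVars false

variable {X H G : Type*} [MeasurableSpace X] [NormedAddCommGroup H] [InnerProductSpace ℝ H]
  [SecondCountableTopology H] {Q : X → HilbertSeminorm H}

open HilbertSeminorm

/-- The fibres H_{q_x} vary with x, so measurability of a section is expressed only through its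
pairings with the countably many images of a dense sequence of H. -/
theorem measurable_enorm_section (hQ : ∀ h k, Measurable fun x => (Q x).form h k)
    {v : (x : X) → (Q x).Space} (hv : ∀ h, Measurable fun x => (inner ℝ (v x) ((Q x).incl h) : ℝ)) :
    Measurable fun x => ‖v x‖ₑ := by
  simp_rw [fun x => enorm_eq_iSup (Q x) (v x)]
  refine Measurable.iSup fun n => ENNReal.measurable_ofReal.comp ?_
  have h1 : Measurable fun x =>
      |(inner ℝ (v x) ((Q x).incl (TopologicalSpace.denseSeq H n)) : ℝ)| :=
    continuous_abs.measurable.comp (hv _)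
  exact h1.div (hQ _ _).sqrt

/-- Polarization reduces pairings of two sections to norms. -/
theorem measurable_inner_section (hQ : ∀ h k, Measurable fun x => (Q x).form h k)
    {v w : (x : X) → (Q x).Space}
    (hv : ∀ h, Measurable fun x => (inner ℝ (v x) ((Q x).incl h) : ℝ))
    (hw : ∀ h, Measurable fun x => (inner ℝ (w x) ((Q x).incl h) : ℝ)) :
    Measurable fun x => (inner ℝ (v x) (w x) : ℝ) := by
  have h1 : Measurable fun x => ‖v x + w x‖ₑ := measurable_enorm_section hQ fun h => by
    simp_rw [inner_add_left]
    exact (hv h).add (hw h)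
  have h2 : Measurable fun x => ‖v x - w x‖ₑ := measurable_enorm_section hQ fun h => by
    simp_rw [inner_sub_left]
    exact (hv h).sub (hw h)
  have h3 : Measurable fun x => (‖v x + w x‖ₑ.toReal * ‖v x + w x‖ₑ.toReal
      - ‖v x - w x‖ₑ.toReal * ‖v x - w x‖ₑ.toReal) / 4 :=
    ((h1.ennreal_toReal.mul h1.ennreal_toReal).sub
      (h2.ennreal_toReal.mul h2.ennreal_toReal)).div_const 4
  convert h3 using 2 with x
  simp_rw [toReal_enorm]
  rw [norm_add_mul_self_real, norm_sub_mul_self_real]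
  ring

variable [NormedAddCommGroup G] [InnerProductSpace ℝ G] [CompleteSpace G]

/-- A family of operators `Φ(x) : H_{q_x} → G` is weakly measurable if all
`x ↦ q_x(Φ(x)* g, i_{q_x} h)` are measurable. -/
def IsWeaklyMeasurable (Q : X → HilbertSeminorm H) (Φ : (x : X) → ((Q x).Space →L[ℝ] G)) : Prop :=
  ∀ (h : H) (g : G), Measurable fun x => (inner ℝ ((Φ x).adjoint g) ((Q x).incl h) : ℝ)

theorem IsWeaklyMeasurable.hsNormSq [SecondCountableTopology G]
    (hQ : ∀ h k, Measurable fun x => (Q x).form h k)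
    {Φ : (x : X) → ((Q x).Space →L[ℝ] G)} (hΦ : IsWeaklyMeasurable Q Φ) :
    Measurable fun x => hsNormSq (Φ x) := by
  obtain ⟨w, d, -⟩ := exists_hilbertBasis ℝ G
  have := d.countable
  simp_rw [fun x => hsNormSq_eq_tsum_adjoint (Φ x) d]
  exact Measurable.tsum fun j =>
    (measurable_enorm_section hQ fun h => hΦ h (d j)).pow_const 2

theorem IsWeaklyMeasurable.sub {Φ Ψ : (x : X) → ((Q x).Space →L[ℝ] G)}
    (hΦ : IsWeaklyMeasurable Q Φ) (hΨ : IsWeaklyMeasurable Q Ψ) :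
    IsWeaklyMeasurable Q fun x => Φ x - Ψ x := fun h g => by
  simp only [map_sub, _root_.sub_apply, inner_sub_left]
  exact (hΦ h g).sub (hΨ h g)

theorem IsWeaklyMeasurable.zero : IsWeaklyMeasurable Q fun x => (0 : (Q x).Space →L[ℝ] G) :=
  fun h g => by simp

theorem IsWeaklyMeasurable.sum {ι : Type*} (s : Finset ι)
    {Φ : ι → (x : X) → ((Q x).Space →L[ℝ] G)} (hΦ : ∀ i ∈ s, IsWeaklyMeasurable Q (Φ i)) :
    IsWeaklyMeasurable Q fun x => ∑ i ∈ s, Φ i x := fun h g => by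
  simp only [map_sum, _root_.sum_apply, sum_inner]
  exact Finset.measurable_fun_sum s fun i hi => hΦ i hi h g

theorem IsWeaklyMeasurable.smul {Φ : (x : X) → ((Q x).Space →L[ℝ] G)}
    (hΦ : IsWeaklyMeasurable Q Φ) {c : X → ℝ} (hc : Measurable c) :
    IsWeaklyMeasurable Q fun x => c x • Φ x := fun h g => by
  simp only [map_smulₛₗ, _root_.smul_apply, inner_smul_left, conj_trivial]
  exact hc.mul (hΦ h g)

theorem isWeaklyMeasurable_comp_incl_adjoint [CompleteSpace H]
    (hQ : ∀ h k, Measurable fun x => (Q x).form h k) (S : H →L[ℝ] G) :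
    IsWeaklyMeasurable Q fun x => S.comp (Q x).incl.adjoint := fun h g => by
  simp only [ContinuousLinearMap.adjoint_comp, ContinuousLinearMap.adjoint_adjoint,
    ContinuousLinearMap.comp_apply, inner_incl]
  exact hQ _ _

/-- The required pairing equals that of Φ* g with i_{R,Q}* i_R h. The latter is itself a measurable
section, as its pairing with i_Q k is the form of R at (h,k). -/
theorem IsWeaklyMeasurable.comp_inclLE_adjoint
    (hQ : ∀ h k, Measurable fun x => (Q x).form h k) {R : X → HilbertSeminorm H}
    (hR : ∀ h k, Measurable fun x => (R x).form h k) (hRQ : ∀ x h, R x h ≤ Q x h)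
    {Φ : (x : X) → ((Q x).Space →L[ℝ] G)} (hΦ : IsWeaklyMeasurable Q Φ) :
    IsWeaklyMeasurable R fun x => (Φ x).comp (inclLE (R x) (Q x) (hRQ x)).adjoint := fun h g => by
  simp only [ContinuousLinearMap.adjoint_comp, ContinuousLinearMap.adjoint_adjoint,
    ContinuousLinearMap.comp_apply]
  have h1 : Measurable fun x => (inner ℝ ((Φ x).adjoint g)
      ((inclLE (R x) (Q x) (hRQ x)).adjoint ((R x).incl h)) : ℝ) := by
    refine measurable_inner_section hQ (fun k => hΦ k g) fun k => ?_
    simp_rw [ContinuousLinearMap.adjoint_inner_left, inclLE_incl, inner_incl]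
    exact hR _ _
  simpa only [ContinuousLinearMap.adjoint_inner_right] using h1

end WeaklyMeasurable

/-! ### Increments of cylindrical martingale-valued measures -/

section Increments

set_option linter.unusedSectionVars false

variable {Ω U H : Type*} {mΩ : MeasurableSpace Ω} [NormedAddCommGroup H] [InnerProductSpace ℝ H]
  {P : Measure Ω} [IsProbabilityMeasure P] {ℱ : Filtration ℝ≥0 mΩ} {𝓡 : Set (Set U)}
  {N : ℝ≥0 → Set U → H →ₗ[ℝ] (Ω →ₘ[P] ℝ)}

theorem integrable_mul_of_memLp {X Y : Ω → ℝ} (hX : MemLp X 2 P) (hY : MemLp Y 2 P) :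
    Integrable (fun ω => X ω * Y ω) P := hX.integrable_mul hY

/-- The increment `N((s,t], A)(h)`. -/
abbrev cylIncr (N : ℝ≥0 → Set U → H →ₗ[ℝ] (Ω →ₘ[P] ℝ)) (s t : ℝ≥0) (A : Set U) (h : H) :
    Ω →ₘ[P] ℝ := N t A h - N s A h

theorem coeFn_cylIncr (s t : ℝ≥0) (A : Set U) (h : H) :
    cylIncr N s t A h =ᵐ[P] fun ω => N t A h ω - N s A h ω := AEEqFun.coeFn_sub _ _

theorem cylIncr_add_cylIncr (r s t : ℝ≥0) (A : Set U) (h : H) :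
    (fun ω => cylIncr N r s A h ω + cylIncr N s t A h ω) =ᵐ[P] cylIncr N r t A h := by
  filter_upwards [AEEqFun.coeFn_add (cylIncr N r s A h) (cylIncr N s t A h)] with ω hω
  rw [show cylIncr N r t A h = cylIncr N r s A h + cylIncr N s t A h by simp [cylIncr], hω]
  rfl

theorem cylIncr_add (s t : ℝ≥0) (A : Set U) (h k : H) :
    (fun ω => cylIncr N s t A h ω + cylIncr N s t A k ω) =ᵐ[P] cylIncr N s t A (h + k) := by
  filter_upwards [AEEqFun.coeFn_add (cylIncr N s t A h) (cylIncr N s t A k)] with ω hω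
  rw [show cylIncr N s t A (h + k) = cylIncr N s t A h + cylIncr N s t A k by
    simp only [cylIncr, map_add]; abel, hω]
  rfl

theorem cylIncr_sub (s t : ℝ≥0) (A : Set U) (h k : H) :
    (fun ω => cylIncr N s t A h ω - cylIncr N s t A k ω) =ᵐ[P] cylIncr N s t A (h - k) := by
  filter_upwards [AEEqFun.coeFn_sub (cylIncr N s t A h) (cylIncr N s t A k)] with ω hω
  rw [show cylIncr N s t A (h - k) = cylIncr N s t A h - cylIncr N s t A k by
    simp only [cylIncr, map_sub]; abel, hω]
  rfl

namespace IsCylMartingaleValuedMeasure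

variable (hN : IsCylMartingaleValuedMeasure P ℱ 𝓡 N)
include hN

theorem isL2Martingale {A : Set U} (hA : A ∈ 𝓡) (h : H) (T : ℝ≥0) :
    IsL2Martingale P ℱ T fun t => (N t A h : Ω → ℝ) :=
  isL2Martingale_of_condExp (fun t _ => (hN.martingale A hA h).1 t)
    (fun t _ => hN.memLp t A hA h) fun s t hst _ => (hN.martingale A hA h).2 s t hst

theorem memLp_cylIncr {A : Set U} (hA : A ∈ 𝓡) (s t : ℝ≥0) (h : H) :
    MemLp (cylIncr N s t A h) 2 P :=
  (memLp_congr_ae (coeFn_cylIncr s t A h)).2 ((hN.memLp t A hA h).sub (hN.memLp s A hA h))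

theorem stronglyMeasurable_cylIncr (hℱ : UsualConditions P ℱ) {A : Set U} (hA : A ∈ 𝓡)
    {s t : ℝ≥0} (hst : s ≤ t) (h : H) : StronglyMeasurable[ℱ t] (cylIncr N s t A h) := by
  have hm := (hN.martingale A hA h).1
  exact hℱ.stronglyMeasurable_congr ((hm t).sub ((hm s).mono (ℱ.mono hst)))
    (coeFn_cylIncr s t A h).symm

theorem integral_cylIncr_mul_eq_zero {A : Set U} (hA : A ∈ 𝓡) {s t : ℝ≥0} (hst : s ≤ t) (h : H)
    {V : Ω → ℝ} (hV : StronglyMeasurable[ℱ s] V) (hV2 : MemLp V 2 P) :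
    ∫ ω, cylIncr N s t A h ω * V ω ∂P = 0 := by
  rw [← (hN.isL2Martingale hA h t).orthogonal s t hst le_rfl V hV hV2]
  refine integral_congr_ae ?_
  filter_upwards [coeFn_cylIncr (N := N) s t A h] with ω hω
  rw [hω]
  simp [mul_comm]

theorem integral_cylIncr_mul_of_disjoint {A B : Set U} (hA : A ∈ 𝓡) (hB : B ∈ 𝓡)
    (hAB : Disjoint A B) (s t : ℝ≥0) (h k : H) :
    ∫ ω, cylIncr N s t A h ω * cylIncr N s t B k ω ∂P = 0 := by
  have hi : ∀ s t, Integrable (fun ω => N s A h ω * N t B k ω) P := fun s t =>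
    (hN.memLp s A hA h).integrable_mul (hN.memLp t B hB k)
  have e : ∫ ω, cylIncr N s t A h ω * cylIncr N s t B k ω ∂P
      = ∫ ω, ((N t A h ω * N t B k ω - N t A h ω * N s B k ω)
        - (N s A h ω * N t B k ω - N s A h ω * N s B k ω)) ∂P := by
    refine integral_congr_ae ?_
    filter_upwards [coeFn_cylIncr (N := N) s t A h, coeFn_cylIncr (N := N) s t B k] with ω h1 h2
    rw [h1, h2]
    ring
  have hi' : ∀ r, Integrable
      (fun ω => N r A h ω * N t B k ω - N r A h ω * N s B k ω) P := fun r =>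
    (hi r t).sub (hi r s)
  rw [e, integral_sub (hi' t) (hi' s),
    integral_sub (hi _ _) (hi _ _), integral_sub (hi _ _) (hi _ _)]
  simp only [hN.orthogonal A hA B hB hAB, sub_zero]

theorem cylIncr_union (s t : ℝ≥0) {A B : Set U} (hA : A ∈ 𝓡) (hB : B ∈ 𝓡)
    (hAB : Disjoint A B) (h : H) :
    (fun ω => cylIncr N s t A h ω + cylIncr N s t B h ω) =ᵐ[P] cylIncr N s t (A ∪ B) h := by
  filter_upwards [AEEqFun.coeFn_add (cylIncr N s t A h) (cylIncr N s t B h)] with ω hω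
  rw [show cylIncr N s t (A ∪ B) h = cylIncr N s t A h + cylIncr N s t B h by
    simp only [cylIncr, hN.union _ A hA B hB hAB]; abel, hω]
  rfl

/-- Extending one of the two increments into the future does not change the covariance. -/
theorem setIntegral_cylIncr_mul_extend (hℱ : UsualConditions P ℱ) {A B : Set U} (hA : A ∈ 𝓡)
    (hB : B ∈ 𝓡) {s s' v t : ℝ≥0} (hsv : s ≤ v) (hvt : v ≤ t) {F : Set Ω}
    (hF : MeasurableSet[ℱ v] F) (h k : H) :
    ∫ ω in F, cylIncr N s v A h ω * cylIncr N s' t B k ω ∂P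
      = ∫ ω in F, cylIncr N s v A h ω * cylIncr N s' v B k ω ∂P := by
  have h1 := hN.memLp_cylIncr hA s v h
  have h2 := hN.memLp_cylIncr hB
  -- The past increment restricted to F is ℱ v-measurable, hence orthogonal to the increment over
  -- (v,t].
  have h3 : ∫ ω in F, cylIncr N s v A h ω * cylIncr N v t B k ω ∂P = 0 := by
    rw [← integral_indicator (ℱ.le v _ hF),
      ← hN.integral_cylIncr_mul_eq_zero hB hvt k
        ((hN.stronglyMeasurable_cylIncr hℱ hA hsv h).indicator hF) (h1.indicator (ℱ.le v _ hF))]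
    congr 1
    ext ω
    by_cases hω : ω ∈ F <;> simp [hω, mul_comm]
  rw [← add_zero (∫ ω in F, cylIncr N s v A h ω * cylIncr N s' v B k ω ∂P), ← h3,
    ← integral_add (integrable_mul_of_memLp h1 (h2 s' v k)).integrableOn
      (integrable_mul_of_memLp h1 (h2 v t k)).integrableOn]
  refine setIntegral_congr_ae (ℱ.le v _ hF) ?_
  filter_upwards [cylIncr_add_cylIncr (N := N) s' v t B k] with ω hω _
  rw [← hω, mul_add]

end IsCylMartingaleValuedMeasure

/-! ### Covariances -/

variable [MeasurableSpace U] {μ : Measure U} {lam : Measure ℝ≥0}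
  {p : ℝ≥0 → U → HilbertSeminorm H} {T : ℝ≥0}

/-- The measure `λ ⊗ μ` on `(0,T] × U`. -/
noncomputable abbrev stripMeasure (lam : Measure ℝ≥0) (μ : Measure U) (T : ℝ≥0) :
    Measure (ℝ≥0 × U) := (lam.restrict (Ioc 0 T)).prod μ

theorem stripMeasure_restrict [SFinite lam] [SFinite μ] {s t : ℝ≥0} (ht : t ≤ T) (A : Set U) :
    (stripMeasure lam μ T).restrict (Ioc s t ×ˢ A)
      = (lam.restrict (Ioc s t)).prod (μ.restrict A) := by
  rw [← Measure.prod_restrict, Measure.restrict_restrict measurableSet_Ioc,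
    inter_eq_left.2 (Ioc_subset_Ioc zero_le ht)]

theorem stripMeasure_prod_lt_top [SFinite μ] (hlam : ∀ t, lam (Iic t) < ∞) (R : Set ℝ≥0)
    {A : Set U} (hμ : μ A < ∞) : stripMeasure lam μ T (R ×ˢ A) < ∞ := by
  rw [Measure.prod_prod]
  refine ENNReal.mul_lt_top ((measure_mono (subset_univ R)).trans_lt ?_) hμ
  rw [Measure.restrict_apply_univ]
  exact (measure_mono Ioc_subset_Iic_self).trans_lt (hlam T)

variable [SFinite lam] [SFinite μ]

theorem HasCovariance.integrableOn_form (hC : HasCovariance P 𝓡 μ lam p N)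
    (hlam : ∀ t, lam (Iic t) < ∞) {s t : ℝ≥0} (ht : t ≤ T) {A : Set U} (hA : MeasurableSet A)
    (hμA : μ A < ∞) (h k : H) :
    IntegrableOn (fun x : ℝ≥0 × U => (p x.1 x.2).form h k) (Ioc s t ×ˢ A)
      (stripMeasure lam μ T) := by
  obtain ⟨C, hCb⟩ := hC.bounded_form T h k
  refine Measure.integrableOn_of_bounded (M := C) (stripMeasure_prod_lt_top hlam _ hμA).ne
    (hC.measurable_form h k).aestronglyMeasurable ?_
  refine (ae_restrict_iff' (measurableSet_Ioc.prod hA)).2 (ae_of_all _ fun x hx => ?_)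
  exact hCb _ (hx.1.2.trans ht) _

theorem HasCovariance.integral_cylIncr_sq (hC : HasCovariance P 𝓡 μ lam p N)
    (hN : IsCylMartingaleValuedMeasure P ℱ 𝓡 N)
    (hlam : ∀ t, lam (Iic t) < ∞) {s t : ℝ≥0} (hst : s < t) (ht : t ≤ T) {A : Set U} (hA : A ∈ 𝓡)
    (hAm : MeasurableSet A) (hμA : μ A < ∞) (h : H) :
    ∫ ω, cylIncr N s t A h ω ^ 2 ∂P
      = ∫ x in Ioc s t ×ˢ A, (p x.1 x.2).form h h ∂(stripMeasure lam μ T) := by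
  have hm : Measurable fun x : ℝ≥0 × U => ENNReal.ofReal ((p x.1 x.2).form h h) :=
    (hC.measurable_form h h).ennreal_ofReal
  have h1 := hC.covariance A hA s t hst h
  have h2 := lintegral_enorm_sq_eq_ofReal (hN.memLp_cylIncr hA s t h)
  simp only [Real.norm_eq_abs, sq_abs] at h2
  have h3 : ∫⁻ r in Ioc s t, ∫⁻ u in A, ENNReal.ofReal (p r u h ^ 2) ∂μ ∂lam
      = ∫⁻ x in Ioc s t ×ˢ A, ENNReal.ofReal ((p x.1 x.2).form h h) ∂(stripMeasure lam μ T) := by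
    rw [stripMeasure_restrict ht, lintegral_prod _ hm.aemeasurable]
    simp_rw [HilbertSeminorm.sq_apply]
  rw [h2, h3, ← ofReal_integral_eq_lintegral_ofReal
    (hC.integrableOn_form hlam ht hAm hμA h h)
    (ae_of_all _ fun x : ℝ≥0 × U => (p x.1 x.2).form_nonneg h)] at h1
  exact (ENNReal.ofReal_eq_ofReal_iff (integral_nonneg fun ω => sq_nonneg _)
    (integral_nonneg fun x : ℝ≥0 × U => (p x.1 x.2).form_nonneg h)).1 h1

/-- Polarization of the variance formula, on both sides. -/
theorem HasCovariance.integral_cylIncr_mul_self (hC : HasCovariance P 𝓡 μ lam p N)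
    (hN : IsCylMartingaleValuedMeasure P ℱ 𝓡 N)
    (hlam : ∀ t, lam (Iic t) < ∞) {s t : ℝ≥0} (hst : s < t) (ht : t ≤ T) {A : Set U} (hA : A ∈ 𝓡)
    (hAm : MeasurableSet A) (hμA : μ A < ∞) (h k : H) :
    ∫ ω, cylIncr N s t A h ω * cylIncr N s t A k ω ∂P
      = ∫ x in Ioc s t ×ˢ A, (p x.1 x.2).form h k ∂(stripMeasure lam μ T) := by
  have hi := fun h => (hN.memLp_cylIncr hA s t h).integrable_sq
  have hf := hC.integrableOn_form (s := s) hlam ht hAm hμA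
  have e1 : ∫ ω, cylIncr N s t A h ω * cylIncr N s t A k ω ∂P
      = ∫ ω, (cylIncr N s t A (h + k) ω ^ 2 - cylIncr N s t A (h - k) ω ^ 2) / 4 ∂P := by
    refine integral_congr_ae ?_
    filter_upwards [cylIncr_add (N := N) s t A h k, cylIncr_sub (N := N) s t A h k] with ω h1 h2
    rw [← h1, ← h2]
    ring
  have e2 : ∀ x : ℝ≥0 × U, (p x.1 x.2).form h k
      = ((p x.1 x.2).form (h + k) (h + k) - (p x.1 x.2).form (h - k) (h - k)) / 4 := fun x => by
    simp only [map_add, map_sub, LinearMap.add_apply, LinearMap.sub_apply,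
      (p x.1 x.2).form_symm k h]
    ring
  rw [e1, integral_div, integral_sub (hi _) (hi _),
    hC.integral_cylIncr_sq hN hlam hst ht hA hAm hμA,
    hC.integral_cylIncr_sq hN hlam hst ht hA hAm hμA]
  simp_rw [e2 _]
  rw [integral_div, integral_sub (hf _ _) (hf _ _)]

/-- Cut A and B along A ∩ B; pieces over disjoint sets are uncorrelated, so only the common piece
counts. -/
theorem HasCovariance.integral_cylIncr_mul (hC : HasCovariance P 𝓡 μ lam p N)
    (hN : IsCylMartingaleValuedMeasure P ℱ 𝓡 N) (h𝓡 : IsSetRing 𝓡)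
    (h𝓡_meas : ∀ A ∈ 𝓡, MeasurableSet A) (hμ : ∀ A ∈ 𝓡, μ A < ∞)
    (hlam : ∀ t, lam (Iic t) < ∞) {s t : ℝ≥0} (hst : s < t) (ht : t ≤ T) {A B : Set U}
    (hA : A ∈ 𝓡) (hB : B ∈ 𝓡) (h k : H) :
    ∫ ω, cylIncr N s t A h ω * cylIncr N s t B k ω ∂P
      = ∫ x in Ioc s t ×ˢ (A ∩ B), (p x.1 x.2).form h k ∂(stripMeasure lam μ T) := by
  have hAB := h𝓡.inter_mem hA hB
  have hA' := h𝓡.sdiff_mem hA hB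
  have hB' := h𝓡.sdiff_mem hB hA
  have m := fun {A : Set U} (hA : A ∈ 𝓡) (h : H) => hN.memLp_cylIncr hA s t h
  rw [← hC.integral_cylIncr_mul_self hN hlam hst ht hAB (h𝓡_meas _ hAB) (hμ _ hAB)]
  have e : (fun ω => cylIncr N s t A h ω * cylIncr N s t B k ω) =ᵐ[P] fun ω =>
      cylIncr N s t (A ∩ B) h ω * cylIncr N s t (A ∩ B) k ω
      + cylIncr N s t (A ∩ B) h ω * cylIncr N s t (B \ A) k ω
      + cylIncr N s t (A \ B) h ω * cylIncr N s t B k ω := by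
    have d1 : Disjoint (A ∩ B) (A \ B) := disjoint_sdiff_inter.symm
    have d2 : Disjoint (A ∩ B) (B \ A) := by rw [inter_comm]; exact disjoint_sdiff_inter.symm
    filter_upwards [hN.cylIncr_union s t hAB hA' d1 h, hN.cylIncr_union s t hAB hB' d2 k]
      with ω h1 h2
    rw [inter_union_sdiff] at h1
    rw [inter_comm A B, inter_union_sdiff, inter_comm B A] at h2
    rw [← h1, ← h2]
    ring
  have i1 := integrable_mul_of_memLp (m hAB h) (m hAB k)
  have i2 := integrable_mul_of_memLp (m hAB h) (m hB' k)
  have i12 : Integrable (fun ω => cylIncr N s t (A ∩ B) h ω * cylIncr N s t (A ∩ B) k ω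
      + cylIncr N s t (A ∩ B) h ω * cylIncr N s t (B \ A) k ω) P := i1.add i2
  rw [integral_congr_ae e, integral_add i12 (integrable_mul_of_memLp (m hA' h) (m hB k)),
    integral_add i1 i2,
    hN.integral_cylIncr_mul_of_disjoint hAB hB'
      (disjoint_sdiff_right.mono_left inter_subset_left),
    hN.integral_cylIncr_mul_of_disjoint hA' hB disjoint_sdiff_left, add_zero, add_zero]

theorem incrementSigma_le (s t : ℝ≥0) : incrementSigma 𝓡 N s t ≤ mΩ :=
  iSup₂_le fun A _ => iSup_le fun h => (AEEqFun.measurable (N t A h - N s A h)).comap_le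

theorem stronglyMeasurable_incrementSigma {A : Set U} (hA : A ∈ 𝓡) (s t : ℝ≥0) (h : H) :
    StronglyMeasurable[incrementSigma 𝓡 N s t] (cylIncr N s t A h) := by
  refine Measurable.stronglyMeasurable ?_
  refine (comap_measurable _).mono ?_ le_rfl
  exact le_iSup₂_of_le A hA (le_iSup_of_le h le_rfl)

/-- The product involves two sets and two vectors at once: this is where independence of the whole
family of increments from ℱ s is needed, not just of each increment. -/
theorem IncrementsIndepPast.setIntegral_mul (hI : IncrementsIndepPast P ℱ 𝓡 N) {s t : ℝ≥0} {h k : H}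
    (hst : s < t) {A B : Set U} (hA : A ∈ 𝓡) (hB : B ∈ 𝓡)
    (hi : Integrable (fun ω => cylIncr N s t A h ω * cylIncr N s t B k ω) P) {F : Set Ω}
    (hF : MeasurableSet[ℱ s] F) :
    ∫ ω in F, cylIncr N s t A h ω * cylIncr N s t B k ω ∂P
      = P.real F * ∫ ω, cylIncr N s t A h ω * cylIncr N s t B k ω ∂P := by
  have h1 := condExp_indep_eq (incrementSigma_le s t) (ℱ.le s)
    ((stronglyMeasurable_incrementSigma hA s t h).mul
      (stronglyMeasurable_incrementSigma hB s t k)) (hI s t hst)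
  rw [← setIntegral_condExp (ℱ.le s) hi hF]
  refine (setIntegral_congr_ae (ℱ.le s _ hF) (h1.mono fun ω hω _ => hω)).trans ?_
  rw [setIntegral_const, smul_eq_mul]
  rfl

end Increments

/-! ### The isometry for simple integrands -/

theorem HilbertSeminorm.sq_sum_smul {H ι : Type*} [NormedAddCommGroup H] [InnerProductSpace ℝ H]
    [Fintype ι] (q : HilbertSeminorm H) (c : ι → ℝ) (h : ι → H) :
    q (∑ i, c i • h i) ^ 2 = ∑ i, ∑ j, c i * c j * q.form (h i) (h j) := by
  rw [HilbertSeminorm.sq_apply]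
  simp only [map_sum, LinearMap.sum_apply, map_smul, LinearMap.smul_apply, smul_eq_mul,
    Finset.mul_sum]
  rw [Finset.sum_comm]
  refine Finset.sum_congr rfl fun i _ => Finset.sum_congr rfl fun j _ => ?_
  ring

theorem integral_sum_sum {X ι : Type*} [MeasurableSpace X] {ν : Measure X} [Fintype ι]
    {f : ι → ι → X → ℝ} (hf : ∀ i j, Integrable (f i j) ν) :
    ∫ x, ∑ i, ∑ j, f i j x ∂ν = ∑ i, ∑ j, ∫ x, f i j x ∂ν := by
  rw [integral_finsetSum _ fun i _ => integrable_finsetSum _ fun j _ => hf i j]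
  exact Finset.sum_congr rfl fun i _ => integral_finsetSum _ fun j _ => hf i j

/-- The indicator function of a box in `Ω × ℝ₊ × U`. -/
noncomputable def boxWeight {Ω U : Type*} (I : Set ℝ≥0) (F : Set Ω) (A : Set U)
    (z : Ω × ℝ≥0 × U) : ℝ :=
  I.indicator 1 z.2.1 * F.indicator 1 z.1 * A.indicator 1 z.2.2

theorem boxWeight_eq_indicator {Ω U : Type*} (I : Set ℝ≥0) (F : Set Ω) (A : Set U) :
    boxWeight I F A = (F ×ˢ (I ×ˢ A)).indicator 1 := by
  ext z
  by_cases h1 : z.1 ∈ F <;> by_cases h2 : z.2.1 ∈ I <;> by_cases h3 : z.2.2 ∈ A <;>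
    simp [boxWeight, indicator, h1, h2, h3]

theorem boxWeight_mul_boxWeight_mul {Ω U : Type*} (I I' : Set ℝ≥0) (F F' : Set Ω) (A A' : Set U)
    (f : Ω × ℝ≥0 × U → ℝ) :
    (fun z => boxWeight I F A z * boxWeight I' F' A' z * f z)
      = ((F ∩ F') ×ˢ ((I ∩ I') ×ˢ (A ∩ A'))).indicator f := by
  ext z
  rw [boxWeight_eq_indicator, boxWeight_eq_indicator, ← prod_inter_prod, ← prod_inter_prod]
  by_cases h1 : z ∈ F ×ˢ (I ×ˢ A) <;> by_cases h2 : z ∈ F' ×ˢ (I' ×ˢ A') <;>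
    simp only [indicator, mem_inter_iff, h1, h2, and_self, and_false, false_and, if_true, if_false,
      Pi.one_apply, one_mul, zero_mul, mul_zero]

section Isometry

set_option linter.unusedSectionVars false

variable {Ω U H : Type*} {mΩ : MeasurableSpace Ω} [NormedAddCommGroup H] [InnerProductSpace ℝ H]
  {P : Measure Ω} [IsProbabilityMeasure P] {ℱ : Filtration ℝ≥0 mΩ} {𝓡 : Set (Set U)}
  {N : ℝ≥0 → Set U → H →ₗ[ℝ] (Ω →ₘ[P] ℝ)}
  [MeasurableSpace U] {μ : Measure U} {lam : Measure ℝ≥0}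
  {p : ℝ≥0 → U → HilbertSeminorm H} {T : ℝ≥0} [SFinite lam] [SFinite μ]
  (hℱ : UsualConditions P ℱ) (h𝓡 : IsSetRing 𝓡) (h𝓡_meas : ∀ A ∈ 𝓡, MeasurableSet A)
  (hμ : ∀ A ∈ 𝓡, μ A < ∞) (hlam : ∀ t, lam (Iic t) < ∞)
  (hN : IsCylMartingaleValuedMeasure P ℱ 𝓡 N) (hI : IncrementsIndepPast P ℱ 𝓡 N)
  (hC : HasCovariance P 𝓡 μ lam p N)

include hℱ h𝓡 h𝓡_meas hμ hlam hN hI hC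

/-- Since s ≤ s', both events are known at s'. The part of the first increment before s', and the
part of either increment after min(t,t'), are orthogonal to the other factor. Over the overlap (s',
min(t,t')], (I) at time s' splits off P(F ∩ F'). -/
theorem integral_indicator_cylIncr_mul_of_le {s t s' t' : ℝ≥0} (hst : s < t) (hst' : s' < t')
    (ht : t ≤ T) (hss' : s ≤ s') {F F' : Set Ω} (hF : MeasurableSet[ℱ s] F)
    (hF' : MeasurableSet[ℱ s'] F') {A B : Set U} (hA : A ∈ 𝓡) (hB : B ∈ 𝓡) (h k : H) :
    ∫ ω, F.indicator (cylIncr N s t A h) ω * F'.indicator (cylIncr N s' t' B k) ω ∂P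
      = P.real (F ∩ F') * ∫ x in (Ioc s t ∩ Ioc s' t') ×ˢ (A ∩ B), (p x.1 x.2).form h k
          ∂(stripMeasure lam μ T) := by
  have hE : MeasurableSet[ℱ s'] (F ∩ F') := (ℱ.mono hss' _ hF).inter hF'
  have e : ∀ ω, F.indicator (cylIncr N s t A h) ω * F'.indicator (cylIncr N s' t' B k) ω
      = (F ∩ F').indicator (fun ω => cylIncr N s t A h ω * cylIncr N s' t' B k ω) ω := by
    intro ω
    by_cases h1 : ω ∈ F <;> by_cases h2 : ω ∈ F' <;> simp [h1, h2]
  simp_rw [e]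
  rw [integral_indicator (ℱ.le s' _ hE), Ioc_inter_Ioc, sup_eq_right.2 hss']
  -- Without overlap the first increment is already known at s', and both sides vanish.
  rcases le_or_gt t s' with hts | hts
  · rw [Ioc_eq_empty (not_lt.2 ((min_le_left t t').trans hts)), empty_prod,
      Measure.restrict_empty, integral_zero_measure, mul_zero,
      ← integral_indicator (ℱ.le s' _ hE)]
    rw [← hN.integral_cylIncr_mul_eq_zero hB hst'.le k
      (((hN.stronglyMeasurable_cylIncr hℱ hA hst.le h).mono (ℱ.mono hts)).indicator hE)
      ((hN.memLp_cylIncr hA s t h).indicator (ℱ.le s' _ hE))]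
    congr 1
    ext ω
    by_cases hω : ω ∈ F ∩ F'
    · simp only [indicator_of_mem hω, mul_comm]
    · simp only [indicator_of_notMem hω, mul_zero]
  · have hi : ∀ s t s' t', Integrable (fun ω => cylIncr N s t A h ω * cylIncr N s' t' B k ω) P :=
      fun s t s' t' => integrable_mul_of_memLp (hN.memLp_cylIncr hA s t h)
        (hN.memLp_cylIncr hB s' t' k)
    -- By the extension lemma the second increment may be shortened to (s',s'], where it is zero.
    have h0 : ∫ ω in F ∩ F', cylIncr N s s' A h ω * cylIncr N s' t' B k ω ∂P = 0 := by
      rw [hN.setIntegral_cylIncr_mul_extend hℱ hA hB hss' hst'.le hE]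
      refine (setIntegral_congr_ae (g := fun _ => (0 : ℝ)) (ℱ.le s' _ hE) ?_).trans (by simp)
      filter_upwards [coeFn_cylIncr (N := N) s' s' B k] with ω hω _
      rw [hω, sub_self, mul_zero]
    have h1 : ∫ ω in F ∩ F', cylIncr N s t A h ω * cylIncr N s' t' B k ω ∂P
        = ∫ ω in F ∩ F', cylIncr N s' t A h ω * cylIncr N s' t' B k ω ∂P := by
      rw [← zero_add (∫ ω in F ∩ F', cylIncr N s' t A h ω * cylIncr N s' t' B k ω ∂P), ← h0,
        ← integral_add (hi _ _ _ _).integrableOn (hi _ _ _ _).integrableOn]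
      refine setIntegral_congr_ae (ℱ.le s' _ hE) ?_
      filter_upwards [cylIncr_add_cylIncr (N := N) s s' t A h] with ω hω _
      rw [← hω, add_mul]
    -- Whichever increment ends later is shortened to the common end.
    have h2 : ∫ ω in F ∩ F', cylIncr N s' t A h ω * cylIncr N s' t' B k ω ∂P
        = ∫ ω in F ∩ F', cylIncr N s' (t ⊓ t') A h ω * cylIncr N s' (t ⊓ t') B k ω ∂P := by
      rcases le_total t t' with htt | htt
      · rw [inf_eq_left.2 htt]
        exact hN.setIntegral_cylIncr_mul_extend hℱ hA hB hts.le htt (ℱ.mono hts.le _ hE) h k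
      · rw [inf_eq_right.2 htt]
        simp_rw [mul_comm (cylIncr N s' t A h _), mul_comm (cylIncr N s' t' A h _)]
        exact hN.setIntegral_cylIncr_mul_extend hℱ hB hA hst'.le htt (ℱ.mono hst'.le _ hE) k h
    rw [h1, h2, hI.setIntegral_mul (lt_min hts hst') hA hB (hi _ _ _ _) hE,
      hC.integral_cylIncr_mul hN h𝓡 h𝓡_meas hμ hlam (lt_min hts hst')
        ((min_le_left t t').trans ht) hA hB]

theorem integral_indicator_cylIncr_mul {s t s' t' : ℝ≥0} (hst : s < t) (hst' : s' < t')
    (ht : t ≤ T) (ht' : t' ≤ T) {F F' : Set Ω} (hF : MeasurableSet[ℱ s] F)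
    (hF' : MeasurableSet[ℱ s'] F') {A B : Set U} (hA : A ∈ 𝓡) (hB : B ∈ 𝓡) (h k : H) :
    ∫ ω, F.indicator (cylIncr N s t A h) ω * F'.indicator (cylIncr N s' t' B k) ω ∂P
      = P.real (F ∩ F') * ∫ x in (Ioc s t ∩ Ioc s' t') ×ˢ (A ∩ B), (p x.1 x.2).form h k
          ∂(stripMeasure lam μ T) := by
  rcases le_total s s' with hss | hss
  · exact integral_indicator_cylIncr_mul_of_le hℱ h𝓡 h𝓡_meas hμ hlam hN hI hC hst hst' ht hss
      hF hF' hA hB h k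
  · simp_rw [mul_comm (F.indicator _ _)]
    rw [integral_indicator_cylIncr_mul_of_le hℱ h𝓡 h𝓡_meas hμ hlam hN hI hC hst' hst ht' hss
      hF' hF hB hA k h, inter_comm F' F, inter_comm (Ioc s' t'), inter_comm B A]
    simp_rw [fun x : ℝ≥0 × U => (p x.1 x.2).form_symm k h]

theorem integrable_boxWeight_mul {s t s' t' : ℝ≥0} (ht : t ≤ T) {F F' : Set Ω}
    (hF : MeasurableSet[ℱ s] F) (hF' : MeasurableSet[ℱ s'] F') {A B : Set U} (hA : A ∈ 𝓡)
    (hB : B ∈ 𝓡) (h k : H) :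
    Integrable (fun z => boxWeight (Ioc s t) F A z * boxWeight (Ioc s' t') F' B z
      * (p z.2.1 z.2.2).form h k) (P.prod (stripMeasure lam μ T)) := by
  rw [boxWeight_mul_boxWeight_mul]
  have hS : MeasurableSet ((F ∩ F') ×ˢ ((Ioc s t ∩ Ioc s' t') ×ˢ (A ∩ B))) :=
    ((ℱ.le _ _ hF).inter (ℱ.le _ _ hF')).prod ((measurableSet_Ioc.inter measurableSet_Ioc).prod
      ((h𝓡_meas _ hA).inter (h𝓡_meas _ hB)))
  rw [integrable_indicator_iff hS]
  obtain ⟨C, hCb⟩ := hC.bounded_form T h k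
  refine Measure.integrableOn_of_bounded (M := C) ?_
    ((hC.measurable_form h k).comp measurable_snd).aestronglyMeasurable ?_
  · rw [Measure.prod_prod]
    exact (ENNReal.mul_lt_top (measure_lt_top _ _) (stripMeasure_prod_lt_top hlam _
      (hμ _ (h𝓡.inter_mem hA hB)))).ne
  · exact (ae_restrict_iff' hS).2 (ae_of_all _ fun z hz => hCb _ (hz.2.1.1.2.trans ht) _)

/-- A product of two boxes is a box, over which the integral of the form factors into the
probability of the events and the integral over time and marks. -/
theorem integral_boxWeight_mul {s t s' t' : ℝ≥0} (hst : s < t) (hst' : s' < t')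
    (ht : t ≤ T) (ht' : t' ≤ T) {F F' : Set Ω} (hF : MeasurableSet[ℱ s] F)
    (hF' : MeasurableSet[ℱ s'] F') {A B : Set U} (hA : A ∈ 𝓡) (hB : B ∈ 𝓡) (h k : H) :
    ∫ ω, F.indicator (cylIncr N s t A h) ω * F'.indicator (cylIncr N s' t' B k) ω ∂P
      = ∫ z, boxWeight (Ioc s t) F A z * boxWeight (Ioc s' t') F' B z
        * (p z.2.1 z.2.2).form h k ∂(P.prod (stripMeasure lam μ T)) := by
  have hS : MeasurableSet ((F ∩ F') ×ˢ ((Ioc s t ∩ Ioc s' t') ×ˢ (A ∩ B))) :=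
    ((ℱ.le _ _ hF).inter (ℱ.le _ _ hF')).prod ((measurableSet_Ioc.inter measurableSet_Ioc).prod
      ((h𝓡_meas _ hA).inter (h𝓡_meas _ hB)))
  rw [boxWeight_mul_boxWeight_mul, integral_indicator hS,
    integral_indicator_cylIncr_mul hℱ h𝓡 h𝓡_meas hμ hlam hN hI hC hst hst' ht ht' hF hF' hA hB]
  have := setIntegral_prod_mul (μ := P) (ν := stripMeasure lam μ T) (fun _ => (1 : ℝ))
    (fun x : ℝ≥0 × U => (p x.1 x.2).form h k) (F ∩ F') ((Ioc s t ∩ Ioc s' t') ×ˢ (A ∩ B))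
  simp only [one_mul, setIntegral_const, smul_eq_mul, mul_one] at this
  exact this.symm

/-- The isometry for linear combinations of scalar increments. -/
theorem lintegral_sum_indicator_cylIncr_sq {ι : Type*} [Fintype ι] {s t : ι → ℝ≥0}
    {F : ι → Set Ω} {A : ι → Set U} (h : ι → H) (hst : ∀ i, s i < t i) (ht : ∀ i, t i ≤ T)
    (hF : ∀ i, MeasurableSet[ℱ (s i)] (F i)) (hA : ∀ i, A i ∈ 𝓡) :
    ∫⁻ ω, ‖∑ i, (F i).indicator (cylIncr N (s i) (t i) (A i) (h i)) ω‖ₑ ^ 2 ∂P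
      = ∫⁻ z : Ω × ℝ≥0 × U, ENNReal.ofReal (p z.2.1 z.2.2
          (∑ i, boxWeight (Ioc (s i) (t i)) (F i) (A i) z • h i) ^ 2)
          ∂(P.prod (stripMeasure lam μ T)) := by
  set c : ι → Ω → ℝ := fun i => (F i).indicator (cylIncr N (s i) (t i) (A i) (h i)) with hcdef
  have hc : ∀ i, MemLp (c i) 2 P := fun i =>
    (hN.memLp_cylIncr (hA i) _ _ _).indicator (ℱ.le _ _ (hF i))
  have hc2 : MemLp (fun ω => ∑ i, c i ω) 2 P := memLp_finsetSum _ fun i _ => hc i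
  have hχi := fun i j => integrable_boxWeight_mul (s := s i) (s' := s j) (t' := t j) hℱ h𝓡 h𝓡_meas
    hμ hlam hN hI hC (ht i) (hF i) (hF j) (hA i) (hA j) (h i) (h j)
  have hpair := fun i j => integral_boxWeight_mul hℱ h𝓡 h𝓡_meas hμ hlam hN hI hC
    (hst i) (hst j) (ht i) (ht j) (hF i) (hF j) (hA i) (hA j) (h i) (h j)
  -- Both sides become double sums over pairs of increments, and these agree pair by pair, diagonal
  -- or not.
  have hsq : ∀ ω, ‖∑ i, c i ω‖ ^ 2 = ∑ i, ∑ j, c i ω * c j ω := fun ω => by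
    rw [Real.norm_eq_abs, sq_abs, sq, Finset.sum_mul_sum]
  rw [lintegral_enorm_sq_eq_ofReal hc2]
  simp_rw [hsq]
  rw [integral_sum_sum fun i j => integrable_mul_of_memLp (hc i) (hc j)]
  simp_rw [HilbertSeminorm.sq_sum_smul]
  rw [← ofReal_integral_eq_lintegral_ofReal, integral_sum_sum hχi]
  · exact congrArg _ (Finset.sum_congr rfl fun i _ => Finset.sum_congr rfl fun j _ => hpair i j)
  · exact integrable_finsetSum _ fun i _ => integrable_finsetSum _ fun j _ => hχi i j
  · refine ae_of_all _ fun z => ?_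
    simp only [Pi.zero_apply]
    rw [← HilbertSeminorm.sq_sum_smul]
    exact sq_nonneg _

end Isometry

/-! ### Approximation of square integrable families of operators -/

section RankOne

variable {E G : Type*} [NormedAddCommGroup E] [InnerProductSpace ℝ E] [CompleteSpace E]
  [NormedAddCommGroup G] [InnerProductSpace ℝ G] [CompleteSpace G]

theorem hsNormSq_rankOne (g : G) (v : E) :
    hsNormSq (InnerProductSpace.rankOne ℝ g v) = ‖g‖ₑ ^ 2 * ‖v‖ₑ ^ 2 := by
  obtain ⟨w, b, -⟩ := exists_hilbertBasis ℝ E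
  rw [hsNormSq_eq_tsum _ b, enorm_sq_eq_tsum b v, ← ENNReal.tsum_mul_left]
  refine tsum_congr fun i => ?_
  rw [InnerProductSpace.rankOne_apply, enorm_smul, mul_pow, mul_comm]

/-- The sum is S followed by the orthogonal projection onto the span of the d_j with j ∈ J, so the
error is the tail of the Hilbert-Schmidt series of S*. -/
theorem hsNormSq_sum_rankOne_sub {ι : Type*} (d : HilbertBasis ι ℝ G) (S : E →L[ℝ] G)
    (J : Finset ι) :
    hsNormSq (∑ j ∈ J, InnerProductSpace.rankOne ℝ (d j) (S.adjoint (d j)) - S)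
      = ∑' j : {j // j ∉ J}, ‖S.adjoint (d j)‖ₑ ^ 2 := by
  classical
  have h0 : ∀ i, ContinuousLinearMap.adjoint
      (∑ j ∈ J, InnerProductSpace.rankOne ℝ (d j) (S.adjoint (d j)) - S) (d i)
      = if i ∈ J then 0 else - S.adjoint (d i) := by
    intro i
    simp only [map_sub, map_sum, InnerProductSpace.adjoint_rankOne, _root_.sub_apply,
      _root_.sum_apply, InnerProductSpace.rankOne_apply]
    have h1 : ∀ j ∈ J, (inner ℝ (d j) (d i) : ℝ) • S.adjoint (d j)
        = if j = i then S.adjoint (d i) else 0 := by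
      intro j _
      rw [orthonormal_iff_ite.1 d.orthonormal j i]
      split_ifs with h
      · rw [h, one_smul]
      · rw [zero_smul]
    rw [Finset.sum_congr rfl h1, Finset.sum_ite_eq']
    split_ifs <;> simp
  rw [hsNormSq_eq_tsum_adjoint _ d]
  simp_rw [h0]
  have h2 : ∀ i, ‖(if i ∈ J then 0 else - S.adjoint (d i) : E)‖ₑ ^ 2
      = {j | j ∉ J}.indicator (fun j => ‖S.adjoint (d j)‖ₑ ^ 2) i := by
    intro i
    by_cases h : i ∈ J <;> simp [h]
  rw [tsum_congr h2, ← tsum_subtype]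
  rfl

end RankOne

/-! ### Reduction of square integrable families to truncated rank-one families -/

section Density

set_option linter.unusedSectionVars false

variable {X H G : Type*} [MeasurableSpace X] [NormedAddCommGroup H] [InnerProductSpace ℝ H]
  [SecondCountableTopology H] {Q : X → HilbertSeminorm H}
  [NormedAddCommGroup G] [InnerProductSpace ℝ G] [CompleteSpace G] [SecondCountableTopology G]
  {π : Measure X}

open HilbertSeminorm

theorem lintegral_hsNormSq_sub_triangle (hQ : ∀ h k, Measurable fun x => (Q x).form h k)
    {Φ₁ Φ₂ Φ₃ : (x : X) → ((Q x).Space →L[ℝ] G)} (h₁ : IsWeaklyMeasurable Q Φ₁)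
    (h₂ : IsWeaklyMeasurable Q Φ₂) :
    ∫⁻ x, hsNormSq (Φ₁ x - Φ₃ x) ∂π ≤ 2 * ∫⁻ x, hsNormSq (Φ₁ x - Φ₂ x) ∂π
      + 2 * ∫⁻ x, hsNormSq (Φ₂ x - Φ₃ x) ∂π := by
  have hm : Measurable fun x => hsNormSq (Φ₁ x - Φ₂ x) := (h₁.sub h₂).hsNormSq hQ
  rw [← lintegral_const_mul _ hm, ← lintegral_const_mul' _ _ (by simp),
    ← lintegral_add_left (hm.const_mul _)]
  refine lintegral_mono fun x => ?_
  have := hsNormSq_add_le (Φ₁ x - Φ₂ x) (Φ₂ x - Φ₃ x)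
  rwa [sub_add_sub_cancel] at this

/-- `Ξ` can be approximated in `L²(π)` by families satisfying `Sm`. -/
def IsL2Approx (π : Measure X) (Sm : ((x : X) → ((Q x).Space →L[ℝ] G)) → Prop)
    (Ξ : (x : X) → ((Q x).Space →L[ℝ] G)) : Prop :=
  ∀ ε : ℝ≥0∞, ε ≠ 0 → ∃ Ψ, Sm Ψ ∧ ∫⁻ x, hsNormSq (Ψ x - Ξ x) ∂π ≤ ε

variable {Sm : ((x : X) → ((Q x).Space →L[ℝ] G)) → Prop}

theorem IsL2Approx.of_forall (hQ : ∀ h k, Measurable fun x => (Q x).form h k)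
    (hSm : ∀ Ψ, Sm Ψ → IsWeaklyMeasurable Q Ψ) {Ξ : (x : X) → ((Q x).Space →L[ℝ] G)}
    (h : ∀ ε : ℝ≥0∞, ε ≠ 0 → ∃ Ξ' : (x : X) → ((Q x).Space →L[ℝ] G), IsWeaklyMeasurable Q Ξ' ∧
      IsL2Approx π Sm Ξ' ∧ ∫⁻ x, hsNormSq (Ξ' x - Ξ x) ∂π ≤ ε) :
    IsL2Approx π Sm Ξ := by
  intro ε hε
  have hε' : ε / 4 ≠ 0 := by simp [hε]
  obtain ⟨Ξ', hw, ha, hle⟩ := h _ hε'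
  obtain ⟨Ψ, hΨ, hle'⟩ := ha _ hε'
  refine ⟨Ψ, hΨ, (lintegral_hsNormSq_sub_triangle hQ (hSm _ hΨ) hw).trans ?_⟩
  calc 2 * ∫⁻ x, hsNormSq (Ψ x - Ξ' x) ∂π + 2 * ∫⁻ x, hsNormSq (Ξ' x - Ξ x) ∂π
      ≤ 2 * (ε / 4) + 2 * (ε / 4) := by gcongr
    _ = 4 * (ε / 4) := by rw [← add_mul]; norm_num
    _ ≤ ε := ENNReal.mul_div_le

theorem IsL2Approx.sub (hQ : ∀ h k, Measurable fun x => (Q x).form h k)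
    (hSm : ∀ Ψ, Sm Ψ → IsWeaklyMeasurable Q Ψ) (hsub : ∀ Ψ Ψ', Sm Ψ → Sm Ψ' → Sm (Ψ - Ψ'))
    {Ξ Ξ' : (x : X) → ((Q x).Space →L[ℝ] G)} (hw : IsWeaklyMeasurable Q Ξ)
    (h : IsL2Approx π Sm Ξ) (h' : IsL2Approx π Sm Ξ') :
    IsL2Approx π Sm fun x => Ξ x - Ξ' x := by
  intro ε hε
  have hε' : ε / 4 ≠ 0 := by simp [hε]
  obtain ⟨Ψ, hΨ, hle⟩ := h _ hε'
  obtain ⟨Ψ', hΨ', hle'⟩ := h' _ hε'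
  have hm : Measurable fun x => hsNormSq (Ψ x - Ξ x) := ((hSm _ hΨ).sub hw).hsNormSq hQ
  refine ⟨Ψ - Ψ', hsub _ _ hΨ hΨ', ?_⟩
  calc ∫⁻ x, hsNormSq ((Ψ - Ψ') x - (Ξ x - Ξ' x)) ∂π
      ≤ ∫⁻ x, 2 * hsNormSq (Ψ x - Ξ x) + 2 * hsNormSq (Ψ' x - Ξ' x) ∂π := by
        refine lintegral_mono fun x => ?_
        have := hsNormSq_sub_le (Ψ x - Ξ x) (Ψ' x - Ξ' x)
        rwa [sub_sub_sub_comm] at this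
    _ = 2 * ∫⁻ x, hsNormSq (Ψ x - Ξ x) ∂π + 2 * ∫⁻ x, hsNormSq (Ψ' x - Ξ' x) ∂π := by
        rw [lintegral_add_left (hm.const_mul _), lintegral_const_mul _ hm,
          lintegral_const_mul' _ _ (by simp)]
    _ ≤ 2 * (ε / 4) + 2 * (ε / 4) := by gcongr
    _ = 4 * (ε / 4) := by rw [← add_mul]; norm_num
    _ ≤ ε := ENNReal.mul_div_le

theorem IsL2Approx.zero (hz : Sm 0) : IsL2Approx π Sm fun x => (0 : (Q x).Space →L[ℝ] G) :=
  fun ε _ => ⟨0, hz, by simp [hsNormSq_zero]⟩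

theorem IsL2Approx.add (hQ : ∀ h k, Measurable fun x => (Q x).form h k)
    (hSm : ∀ Ψ, Sm Ψ → IsWeaklyMeasurable Q Ψ) (hsub : ∀ Ψ Ψ', Sm Ψ → Sm Ψ' → Sm (Ψ - Ψ'))
    (hz : Sm 0) {Ξ Ξ' : (x : X) → ((Q x).Space →L[ℝ] G)} (hw : IsWeaklyMeasurable Q Ξ)
    (h : IsL2Approx π Sm Ξ) (h' : IsL2Approx π Sm Ξ') :
    IsL2Approx π Sm fun x => Ξ x + Ξ' x := by
  have h1 := IsL2Approx.sub hQ hSm hsub hw h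
    (IsL2Approx.sub hQ hSm hsub IsWeaklyMeasurable.zero (IsL2Approx.zero hz) h')
  simpa using h1

theorem IsL2Approx.sum (hQ : ∀ h k, Measurable fun x => (Q x).form h k)
    (hSm : ∀ Ψ, Sm Ψ → IsWeaklyMeasurable Q Ψ) (hsub : ∀ Ψ Ψ', Sm Ψ → Sm Ψ' → Sm (Ψ - Ψ'))
    (hz : Sm 0) {ι : Type*} (s : Finset ι) {Ξ : ι → (x : X) → ((Q x).Space →L[ℝ] G)}
    (hw : ∀ i ∈ s, IsWeaklyMeasurable Q (Ξ i)) (h : ∀ i ∈ s, IsL2Approx π Sm (Ξ i)) :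
    IsL2Approx π Sm fun x => ∑ i ∈ s, Ξ i x := by
  classical
  induction s using Finset.induction_on with
  | empty => simpa using IsL2Approx.zero hz
  | insert a s ha ih =>
    simp_rw [Finset.sum_insert ha]
    exact IsL2Approx.add hQ hSm hsub hz (hw a (Finset.mem_insert_self _ _))
      (h a (Finset.mem_insert_self _ _))
      (ih (fun i hi => hw i (Finset.mem_insert_of_mem hi))
        fun i hi => h i (Finset.mem_insert_of_mem hi))

theorem IsWeaklyMeasurable.indicator_smul {R : (x : X) → ((Q x).Space →L[ℝ] G)}
    (hR : IsWeaklyMeasurable Q R) {E : Set X} (hE : MeasurableSet E) :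
    IsWeaklyMeasurable Q fun x => (E.indicator 1 x : ℝ) • R x :=
  hR.smul (measurable_one.indicator hE)

theorem hsNormSq_indicator_smul (R : (x : X) → ((Q x).Space →L[ℝ] G)) (E : Set X) (x : X) :
    hsNormSq ((E.indicator 1 x : ℝ) • R x) = E.indicator (fun x => hsNormSq (R x)) x := by
  by_cases h : x ∈ E <;> simp [h, hsNormSq_zero]

/-- Truncations of a family of operators to all measurable sets can be approximated if this holds
for the sets of a generating π-system. -/
theorem isL2Approx_indicator_smul (hQ : ∀ h k, Measurable fun x => (Q x).form h k)
    (hSm : ∀ Ψ, Sm Ψ → IsWeaklyMeasurable Q Ψ) (hsub : ∀ Ψ Ψ', Sm Ψ → Sm Ψ' → Sm (Ψ - Ψ'))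
    (hz : Sm 0) {C : Set (Set X)} (hC : IsPiSystem C)
    (hgen : ‹MeasurableSpace X› = MeasurableSpace.generateFrom C)
    {V : Set X} (hV : MeasurableSet V)
    {R : (x : X) → ((Q x).Space →L[ℝ] G)} (hR : IsWeaklyMeasurable Q R)
    (hfin : ∫⁻ x in V, hsNormSq (R x) ∂π ≠ ∞)
    (hbasic : ∀ E ∈ C, IsL2Approx π Sm fun x => ((E ∩ V).indicator 1 x : ℝ) • R x)
    (huniv : IsL2Approx π Sm fun x => (V.indicator 1 x : ℝ) • R x) {E : Set X}
    (hE : MeasurableSet E) : IsL2Approx π Sm fun x => ((E ∩ V).indicator 1 x : ℝ) • R x := by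
  induction E, hE using MeasurableSpace.induction_on_inter hgen hC with
  | empty => simpa using IsL2Approx.zero hz
  | basic E hE => exact hbasic E hE
  | compl E hE ih =>
    -- The complement within V is V minus the set, so only differences of approximable families are
    -- needed.
    have h := IsL2Approx.sub hQ hSm hsub (hR.indicator_smul hV) huniv ih
    convert h using 2 with x
    rw [← sub_smul]
    congr 1
    by_cases h1 : x ∈ E <;> by_cases h2 : x ∈ V <;> simp [h1, h2]
  | iUnion f hd hf ih =>
    -- The measure with density ‖R‖² on V is finite, so tails of the disjoint union are small in it,
    -- and that mass is exactly the approximation error.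
    set ν := (π.restrict V).withDensity fun x => hsNormSq (R x)
    have hfν : IsFiniteMeasure ν := isFiniteMeasure_withDensity hfin
    have hlim := tendsto_measure_biUnion_Ici_zero_of_pairwise_disjoint (μ := ν)
      (fun i => (hf i).nullMeasurableSet) hd
    refine IsL2Approx.of_forall hQ hSm fun ε hε => ?_
    obtain ⟨n, hn⟩ := (hlim.eventually (ge_mem_nhds hε.bot_lt)).exists
    refine ⟨fun x => ∑ i ∈ Finset.range n, ((f i ∩ V).indicator 1 x : ℝ) • R x,
      IsWeaklyMeasurable.sum _ fun i _ => hR.indicator_smul ((hf i).inter hV),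
      IsL2Approx.sum hQ hSm hsub hz _ (fun i _ => hR.indicator_smul ((hf i).inter hV))
        fun i _ => ih i, le_trans ?_ hn⟩
    have hms : MeasurableSet (⋃ i ≥ n, f i) :=
      MeasurableSet.iUnion fun i => MeasurableSet.iUnion fun _ => hf i
    simp only [Function.comp_apply]
    rw [withDensity_apply _ hms, Measure.restrict_restrict hms,
      ← lintegral_indicator (hms.inter hV)]
    refine lintegral_mono fun x => ?_
    rw [← hsNormSq_indicator_smul, ← Finset.sum_smul, ← sub_smul, hsNormSq_smul, hsNormSq_smul]
    gcongr ?_ ^ 2 * _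
    by_cases hxV : x ∈ V
    swap
    · simp [hxV]
    by_cases hx : x ∈ ⋃ i, f i
    swap
    · have : ∀ i, x ∉ f i := by simpa using hx
      simp [this]
    obtain ⟨k, hk⟩ := mem_iUnion.1 hx
    have hne : ∀ i, i ≠ k → x ∉ f i := fun i hi hxi =>
      Set.disjoint_left.1 (hd hi) hxi hk
    have h1 : ((⋃ i, f i) ∩ V).indicator (1 : X → ℝ) x = 1 := by
      simp [hxV, mem_iUnion.1 hx]
    rw [h1]
    by_cases hkn : k < n
    · have h2 : ∑ i ∈ Finset.range n, (f i ∩ V).indicator (1 : X → ℝ) x = 1 := by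
        rw [Finset.sum_eq_single_of_mem k (Finset.mem_range.2 hkn)
          fun i _ hi => by simp [hne i hi]]
        simp [hk, hxV]
      simp [h2]
    · have h2 : ∑ i ∈ Finset.range n, (f i ∩ V).indicator (1 : X → ℝ) x = 0 := by
        refine Finset.sum_eq_zero fun i hi => ?_
        have : i ≠ k := fun h => hkn (h ▸ Finset.mem_range.1 hi)
        simp [hne i this]
      have h3 : x ∈ (⋃ i ≥ n, f i) ∩ V :=
        ⟨mem_iUnion₂.2 ⟨k, not_lt.1 hkn, hk⟩, hxV⟩
      rw [h2, indicator_of_mem h3]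
      simp

variable {V : ℕ → Set X}

theorem isWeaklyMeasurable_rankOne {v : (x : X) → (Q x).Space}
    (hv : ∀ h, Measurable fun x => (inner ℝ (v x) ((Q x).incl h) : ℝ)) (g : G) :
    IsWeaklyMeasurable Q fun x => InnerProductSpace.rankOne ℝ g (v x) := fun h g' => by
  simp only [InnerProductSpace.adjoint_rankOne, InnerProductSpace.rankOne_apply, inner_smul_left,
    conj_trivial]
  exact (hv h).const_mul _

theorem measurable_inner_incl (hQ : ∀ h k, Measurable fun x => (Q x).form h k) (k h : H) :
    Measurable fun x => (inner ℝ ((Q x).incl k) ((Q x).incl h) : ℝ) := by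
  simp_rw [inner_incl]
  exact hQ k h

/-- Square integrable sections can be approximated by countably valued ones. -/
theorem exists_section_approx [SigmaFinite π] (hQ : ∀ h k, Measurable fun x => (Q x).form h k)
    (hV : ∀ n, MeasurableSet (V n)) (hVm : Monotone V) (hVc : π (⋃ n, V n)ᶜ = 0)
    {v : (x : X) → (Q x).Space} (hv : ∀ h, Measurable fun x => (inner ℝ (v x) ((Q x).incl h) : ℝ))
    (hfin : ∫⁻ x, ‖v x‖ₑ ^ 2 ∂π ≠ ∞) {ε : ℝ≥0∞} (hε : ε ≠ 0) :
    ∃ (N : ℕ) (B : ℕ → Set X) (e : ℕ → H), (∀ k, MeasurableSet (B k)) ∧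
      ∫⁻ x, ‖∑ k ∈ Finset.range N, ((B k ∩ V N).indicator 1 x : ℝ) • (Q x).incl (e k) - v x‖ₑ ^ 2
        ∂π ≤ ε := by
  have hε' : ε / 2 ≠ 0 := by simp [hε]
  -- Since π may be infinite, the pointwise tolerance is a positive function of integral below ε/2
  -- instead of a constant.
  obtain ⟨δ, hδ0, hδm, hδ⟩ := exists_pos_lintegral_lt_of_sigmaFinite π hε'
  set e := TopologicalSpace.denseSeq H
  have hsm : ∀ k, Measurable fun x => ‖(Q x).incl (e k) - v x‖ₑ := fun k =>
    measurable_enorm_section hQ fun h => by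
      simp_rw [inner_sub_left]
      exact (measurable_inner_incl hQ _ _).sub (hv h)
  have hnv : Measurable fun x => ‖v x‖ₑ ^ 2 := (measurable_enorm_section hQ hv).pow_const 2
  -- The points where the k-th dense vector is within tolerance of v; made disjoint, these sets
  -- assign to each point the first vector that works.
  set C : ℕ → Set X := fun k => {x | ‖(Q x).incl (e k) - v x‖ₑ ^ 2 < δ x}
  have hC : ∀ k, MeasurableSet (C k) := fun k =>
    measurableSet_lt ((hsm k).pow_const 2) hδm.coe_nnreal_ennreal
  have hCu : ⋃ k, C k = univ := by
    refine eq_univ_of_forall fun x => ?_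
    have hd : DenseRange ((Q x).incl ∘ e) :=
      (Q x).denseRange_incl.comp (TopologicalSpace.denseRange_denseSeq H) (Q x).incl.continuous
    have ho : {w : (Q x).Space | ‖w - v x‖ₑ ^ 2 < δ x} ∈ 𝓝 (v x) := by
      have hc : Continuous fun w : (Q x).Space => ‖w - v x‖ₑ ^ 2 :=
        (ENNReal.continuous_pow 2).comp (continuous_id.sub continuous_const).enorm
      refine hc.continuousAt.eventually (gt_mem_nhds ?_)
      simpa using hδ0 x
    obtain ⟨_, hw, ⟨k, rfl⟩⟩ := mem_closure_iff_nhds.1 (hd (v x)) _ ho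
    exact mem_iUnion.2 ⟨k, hw⟩
  set B := disjointed C
  have hB : ∀ k, MeasurableSet (B k) := fun k => MeasurableSet.disjointed hC k
  have hBd : Pairwise (Function.onFun Disjoint B) := disjoint_disjointed C
  have hBu : ∀ x, ∃ k, x ∈ B k := fun x => by
    have : x ∈ ⋃ k, B k := by rw [iUnion_disjointed, hCu]; trivial
    exact mem_iUnion.1 this
  choose κ hκ using hBu
  have hne : ∀ x k, k ≠ κ x → x ∉ B k := fun x k hk h =>
    Set.disjoint_left.1 (hBd hk) h (hκ x)
  -- Where the truncation gives zero the error is ‖v‖². The single number N bounds both the region V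
  -- N and the index of the vector; this error tends to 0 by dominated convergence.
  set w : ℕ → X → ℝ≥0∞ := fun N x => {x | ¬ (x ∈ V N ∧ κ x < N)}.indicator (fun x => ‖v x‖ₑ ^ 2) x
  have hle : ∀ N x, ‖∑ k ∈ Finset.range N, ((B k ∩ V N).indicator 1 x : ℝ) • (Q x).incl (e k)
      - v x‖ₑ ^ 2 ≤ δ x + w N x := by
    intro N x
    by_cases h : x ∈ V N ∧ κ x < N
    · rw [Finset.sum_eq_single_of_mem (κ x) (Finset.mem_range.2 h.2)
        fun i _ hi => by simp [hne x i hi]]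
      have h1 : (B (κ x) ∩ V N).indicator (1 : X → ℝ) x = 1 := by simp [hκ x, h.1]
      rw [h1, one_smul]
      have h2 : x ∈ C (κ x) := disjointed_subset C _ (hκ x)
      exact h2.le.trans le_self_add
    · rw [Finset.sum_eq_zero, zero_sub, enorm_neg]
      · have : w N x = ‖v x‖ₑ ^ 2 := indicator_of_mem (s := {x | ¬ (x ∈ V N ∧ κ x < N)}) h _
        rw [this]
        exact le_add_self
      · intro i hi
        by_cases hx : x ∈ V N
        · have : i ≠ κ x := fun hh => h ⟨hx, hh ▸ Finset.mem_range.1 hi⟩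
          simp [hne x i this]
        · simp [hx]
  have hκm : Measurable κ := by
    refine measurable_to_countable' fun k => ?_
    have : κ ⁻¹' {k} = B k := by
      ext x
      refine ⟨fun h => h ▸ hκ x, fun h => ?_⟩
      by_contra hk
      exact hne x k (fun h' => hk h'.symm) h
    rw [this]
    exact hB k
  have hwm : ∀ N, Measurable (w N) := fun N =>
    hnv.indicator ((hV N).inter (hκm measurableSet_Iio)).compl
  have hlim : Tendsto (fun N => ∫⁻ x, w N x ∂π) atTop (𝓝 0) := by
    have h0 := tendsto_lintegral_of_dominated_convergence (μ := π) (F := w) (f := fun _ => 0)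
      (fun x => ‖v x‖ₑ ^ 2) hwm (fun N => ae_of_all _ fun x => indicator_le_self _ _ _) hfin ?_
    · simpa using h0
    have hae : ∀ᵐ x ∂π, x ∈ ⋃ n, V n := by
      rw [ae_iff]; exact hVc
    filter_upwards [hae] with x hx
    obtain ⟨n, hn⟩ := mem_iUnion.1 hx
    refine tendsto_const_nhds.congr' ?_
    filter_upwards [eventually_ge_atTop n, eventually_gt_atTop (κ x)] with N h1 h2
    refine (indicator_of_notMem ?_ _).symm
    simp only [mem_ofPred_eq, not_not]
    exact ⟨hVm h1 hn, h2⟩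
  obtain ⟨N, hN⟩ := (hlim.eventually (ge_mem_nhds hε'.bot_lt)).exists
  refine ⟨N, B, e, hB, (lintegral_mono (hle N)).trans ?_⟩
  rw [lintegral_add_left hδm.coe_nnreal_ennreal]
  exact (add_le_add hδ.le hN).trans (ENNReal.add_halves ε).le

/-- If truncations of constant rank-one families can be approximated, then so can all square
integrable families. -/
theorem isL2Approx_of_rankOne [SigmaFinite π] (hQ : ∀ h k, Measurable fun x => (Q x).form h k)
    (hSm : ∀ Ψ, Sm Ψ → IsWeaklyMeasurable Q Ψ) (hsub : ∀ Ψ Ψ', Sm Ψ → Sm Ψ' → Sm (Ψ - Ψ'))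
    (hz : Sm 0) (hV : ∀ n, MeasurableSet (V n)) (hVm : Monotone V) (hVc : π (⋃ n, V n)ᶜ = 0)
    (hind : ∀ (g : G) (h : H) n E, MeasurableSet E → IsL2Approx π Sm fun x =>
      ((E ∩ V n).indicator 1 x : ℝ) • InnerProductSpace.rankOne ℝ g ((Q x).incl h))
    {Ξ : (x : X) → ((Q x).Space →L[ℝ] G)} (hΞ : IsWeaklyMeasurable Q Ξ)
    (hfin : ∫⁻ x, hsNormSq (Ξ x) ∂π ≠ ∞) : IsL2Approx π Sm Ξ := by
  obtain ⟨s, d, -⟩ := exists_hilbertBasis ℝ G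
  have := d.countable
  have hm : ∀ j, Measurable fun x => ‖(Ξ x).adjoint (d j)‖ₑ ^ 2 := fun j =>
    (measurable_enorm_section hQ fun h => hΞ h (d j)).pow_const 2
  have hsum : ∑' j, ∫⁻ x, ‖(Ξ x).adjoint (d j)‖ₑ ^ 2 ∂π = ∫⁻ x, hsNormSq (Ξ x) ∂π := by
    rw [← lintegral_tsum fun j => (hm j).aemeasurable]
    simp_rw [fun x => hsNormSq_eq_tsum_adjoint (Ξ x) d]
  -- For a unit vector d j, the Hilbert-Schmidt norm of the rank-one operator is the norm of its
  -- section, so section approximation applies.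
  have hone : ∀ j, IsL2Approx π Sm fun x =>
      InnerProductSpace.rankOne ℝ (d j) ((Ξ x).adjoint (d j)) := by
    intro j
    have hfj : ∫⁻ x, ‖(Ξ x).adjoint (d j)‖ₑ ^ 2 ∂π ≠ ∞ :=
      ne_top_of_le_ne_top (hsum ▸ hfin)
        (ENNReal.le_tsum (f := fun j => ∫⁻ x, ‖(Ξ x).adjoint (d j)‖ₑ ^ 2 ∂π) j)
    refine IsL2Approx.of_forall hQ hSm fun ε hε => ?_
    obtain ⟨N, B, e, hB, hle⟩ := exists_section_approx hQ hV hVm hVc (fun h => hΞ h (d j)) hfj hε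
    have hw : ∀ k, IsWeaklyMeasurable Q fun x =>
        ((B k ∩ V N).indicator 1 x : ℝ) • InnerProductSpace.rankOne ℝ (d j) ((Q x).incl (e k)) :=
      fun k => (isWeaklyMeasurable_rankOne (fun h => measurable_inner_incl hQ _ h) (d j)).indicator_smul
        ((hB k).inter (hV N))
    refine ⟨fun x => ∑ k ∈ Finset.range N, ((B k ∩ V N).indicator 1 x : ℝ) •
      InnerProductSpace.rankOne ℝ (d j) ((Q x).incl (e k)),
      IsWeaklyMeasurable.sum _ fun k _ => hw k,
      IsL2Approx.sum hQ hSm hsub hz _ (fun k _ => hw k) fun k _ => hind _ _ _ _ (hB k),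
      le_trans (le_of_eq (lintegral_congr fun x => ?_)) hle⟩
    have : (∑ k ∈ Finset.range N, ((B k ∩ V N).indicator 1 x : ℝ) •
        InnerProductSpace.rankOne ℝ (d j : G) ((Q x).incl (e k)))
        - InnerProductSpace.rankOne ℝ (d j : G) ((Ξ x).adjoint (d j))
        = InnerProductSpace.rankOne ℝ (d j : G) (∑ k ∈ Finset.range N,
          ((B k ∩ V N).indicator 1 x : ℝ) • (Q x).incl (e k) - (Ξ x).adjoint (d j)) := by
      simp only [map_sub, map_sum, map_smulₛₗ, conj_trivial]
    rw [this, hsNormSq_rankOne]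
    have h1 : ‖d j‖ₑ = 1 := by
      rw [← ofReal_norm, d.orthonormal.1 j, ENNReal.ofReal_one]
    rw [h1, one_pow, one_mul]
  refine IsL2Approx.of_forall hQ hSm fun ε hε => ?_
  -- Finitely many rows of Φ suffice, because the integrated Hilbert-Schmidt series over the basis
  -- converges.
  have hlim := ENNReal.tendsto_tsum_compl_atTop_zero (hsum ▸ hfin)
  obtain ⟨J, hJ⟩ := (hlim.eventually (ge_mem_nhds hε.bot_lt)).exists
  have hw : ∀ j, IsWeaklyMeasurable Q fun x =>
      InnerProductSpace.rankOne ℝ (d j) ((Ξ x).adjoint (d j)) := fun j =>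
    isWeaklyMeasurable_rankOne (fun h => hΞ h (d j)) (d j)
  refine ⟨fun x => ∑ j ∈ J, InnerProductSpace.rankOne ℝ (d j) ((Ξ x).adjoint (d j)),
    IsWeaklyMeasurable.sum _ fun j _ => hw j,
    IsL2Approx.sum hQ hSm hsub hz _ (fun j _ => hw j) fun j _ => hone j, le_trans ?_ hJ⟩
  simp_rw [fun x => hsNormSq_sum_rankOne_sub d (Ξ x) J]
  rw [lintegral_tsum fun j : {j // j ∉ J} => (hm j).aemeasurable]

end Density

/-! ### Density of simple integrands -/

section PredictableDomain

set_option linter.unusedSectionVars false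

variable {Ω U H G : Type*} {mΩ : MeasurableSpace Ω} [mU : MeasurableSpace U]

/-- The space `[0,T] × Ω × U` with the product of the predictable σ-algebra and that of `U`. -/
def PredDomain (_ℱ : Filtration ℝ≥0 mΩ) (T : ℝ≥0) (U : Type*) : Type _ := (Iic T × Ω) × U

instance (ℱ : Filtration ℝ≥0 mΩ) (T : ℝ≥0) : MeasurableSpace (PredDomain ℱ T U) :=
  (predictableUpTo ℱ T).prod inferInstance

/-- The projection of `Ω × ℝ₊ × U` onto `[0,T] × Ω × U`. -/
def clampTime (ℱ : Filtration ℝ≥0 mΩ) (T : ℝ≥0) (z : Ω × ℝ≥0 × U) : PredDomain ℱ T U :=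
  ((⟨min T z.2.1, mem_Iic.2 (min_le_left _ _)⟩, z.1), z.2.2)

variable {ℱ : Filtration ℝ≥0 mΩ} {T : ℝ≥0}

theorem predictable_le_prod : ℱ.predictable ≤ (inferInstance : MeasurableSpace (ℝ≥0 × Ω)) :=
  measurableSpace_le_predictable_of_measurableSet
    (fun _ hA => (measurableSet_singleton _).prod (ℱ.le _ _ hA))
    fun _ _ hA => measurableSet_Ioi.prod (ℱ.le _ _ hA)

/-- Clamping makes the map total on Ω × ℝ₊ × U; predictable sets are product measurable, and no
finer measurability is required of the source. -/
theorem measurable_clampTime : Measurable (clampTime (U := U) ℱ T) := by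
  have h1 : Measurable[_, predictableUpTo ℱ T] fun z : Ω × ℝ≥0 × U =>
      ((⟨min T z.2.1, mem_Iic.2 (min_le_left _ _)⟩, z.1) : Iic T × Ω) := by
    refine measurable_comap_iff.2 ?_
    have h2 : Measurable fun z : Ω × ℝ≥0 × U => (min T z.2.1, z.1) := by fun_prop
    exact h2.mono le_rfl predictable_le_prod
  exact @Measurable.prodMk _ _ _ _ (predictableUpTo ℱ T) _ _ _ h1
    (measurable_snd.comp measurable_snd)

theorem measurable_time_predictable : Measurable[ℱ.predictable] (Prod.fst : ℝ≥0 × Ω → ℝ≥0) := by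
  refine @measurable_of_Ioi _ _ _ _ _ ℱ.predictable _ _ _ _ fun s => ?_
  have : (Prod.fst : ℝ≥0 × Ω → ℝ≥0) ⁻¹' Ioi s = Ioi s ×ˢ univ := by ext; simp
  rw [this]
  exact measurableSet_predictable_Ioi_prod MeasurableSet.univ

theorem measurable_time_mark :
    Measurable fun x : PredDomain ℱ T U => ((x.1.1 : ℝ≥0), x.2) := by
  have h1 : Measurable[predictableUpTo ℱ T] fun x : Iic T × Ω => (x.1 : ℝ≥0) :=
    @Measurable.comp _ _ _ (predictableUpTo ℱ T) ℱ.predictable _ _ _ measurable_time_predictable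
      (comap_measurable _)
  have h2 : Measurable fun x : PredDomain ℱ T U => x.1.1.1 :=
    h1.comp (@measurable_fst _ _ (predictableUpTo ℱ T) _)
  exact h2.prodMk (@measurable_snd _ _ (predictableUpTo ℱ T) _)

/-- The measure `λ ⊗ P ⊗ μ` on `[0,T] × Ω × U`, without mass at time `0`. -/
noncomputable def predMeasure (ℱ : Filtration ℝ≥0 mΩ) (P : Measure Ω) (μ : Measure U)
    (lam : Measure ℝ≥0) (T : ℝ≥0) : Measure (PredDomain ℱ T U) :=
  (P.prod (stripMeasure lam μ T)).map (clampTime ℱ T)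

variable {P : Measure Ω} [IsProbabilityMeasure P] {μ : Measure U} {lam : Measure ℝ≥0}
  [SFinite lam] [SFinite μ]

theorem ae_mem_Ioc_strip :
    ∀ᵐ z : Ω × ℝ≥0 × U ∂(P.prod (stripMeasure lam μ T)), z.2.1 ∈ Ioc 0 T := by
  have h1 : ∀ᵐ x : ℝ≥0 × U ∂(stripMeasure lam μ T), x.1 ∈ Ioc 0 T :=
    Measure.quasiMeasurePreserving_fst.ae (ae_restrict_mem measurableSet_Ioc)
  exact Measure.quasiMeasurePreserving_snd.ae h1

theorem ae_predMeasure_time_pos : ∀ᵐ x ∂(predMeasure (U := U) ℱ P μ lam T), 0 < (x.1.1 : ℝ≥0) := by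
  have hm : MeasurableSet {x : PredDomain ℱ T U | 0 < (x.1.1 : ℝ≥0)} :=
    measurable_time_mark.fst measurableSet_Ioi
  refine (ae_map_iff measurable_clampTime.aemeasurable hm).2 ?_
  filter_upwards [ae_mem_Ioc_strip (P := P)] with z hz
  exact lt_min (hz.1.trans_le hz.2) hz.1

theorem predMeasure_univ_prod (hlam : ∀ t, lam (Iic t) < ∞) {A : Set U} (hAm : MeasurableSet A)
    (hA : μ A < ∞) : predMeasure ℱ P μ lam T {x | x.2 ∈ A} < ∞ := by
  have hm : MeasurableSet {x : PredDomain ℱ T U | x.2 ∈ A} := measurable_time_mark.snd hAm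
  rw [predMeasure, Measure.map_apply measurable_clampTime hm]
  have : clampTime ℱ T ⁻¹' {x : PredDomain ℱ T U | x.2 ∈ A}
      = (univ : Set Ω) ×ˢ ((univ : Set ℝ≥0) ×ˢ A) := by
    ext z
    simp [clampTime]
  rw [this, Measure.prod_prod]
  exact ENNReal.mul_lt_top (measure_lt_top _ _) (stripMeasure_prod_lt_top hlam _ hA)

theorem predMeasure_univ_prod_eq_zero {A : Set U} (hAm : MeasurableSet A)
    (hA : μ A = 0) : predMeasure ℱ P μ lam T {x | x.2 ∈ A} = 0 := by
  have hm : MeasurableSet {x : PredDomain ℱ T U | x.2 ∈ A} := measurable_time_mark.snd hAm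
  rw [predMeasure, Measure.map_apply measurable_clampTime hm]
  have : clampTime ℱ T ⁻¹' {x : PredDomain ℱ T U | x.2 ∈ A}
      = (univ : Set Ω) ×ˢ ((univ : Set ℝ≥0) ×ˢ A) := by
    ext z
    simp [clampTime]
  rw [this, Measure.prod_prod, Measure.prod_prod, hA]
  simp

variable [NormedAddCommGroup H] [InnerProductSpace ℝ H] [CompleteSpace H]
  [SecondCountableTopology H]
  [NormedAddCommGroup G] [InnerProductSpace ℝ G] [CompleteSpace G] [SecondCountableTopology G]
  {q : ℝ≥0 → U → HilbertSeminorm H}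

theorem measurable_form_predDomain
    (hqm : ∀ h₁ h₂, Measurable fun x : ℝ≥0 × U => (q x.1 x.2).form h₁ h₂) (h k : H) :
    Measurable fun x : PredDomain ℱ T U => (q x.1.1 x.2).form h k :=
  (hqm h k).comp measurable_time_mark

/-- Weak predictability of a family of operators. -/
def IsPredictableFamily (ℱ : Filtration ℝ≥0 mΩ) (T : ℝ≥0) (q : ℝ≥0 → U → HilbertSeminorm H)
    (Φ : OpFamily Ω G q) : Prop :=
  IsWeaklyMeasurable (fun x : PredDomain ℱ T U => q x.1.1 x.2) fun x => Φ x.1.1 x.1.2 x.2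

theorem IsPredictableFamily.measurable_hsNormSq
    (hqm : ∀ h₁ h₂, Measurable fun x : ℝ≥0 × U => (q x.1 x.2).form h₁ h₂)
    {Φ : OpFamily Ω G q} (hΦ : IsPredictableFamily ℱ T q Φ) :
    Measurable fun x : PredDomain ℱ T U => hsNormSq (Φ x.1.1 x.1.2 x.2) :=
  IsWeaklyMeasurable.hsNormSq (measurable_form_predDomain hqm) hΦ

/-- Turns the iterated integral of the Λ² norm into a single integral on the space where weak
predictability is a statement of measurability. Clamping is invisible on (0,T]. -/
theorem lintegral_strip_eq_predMeasure {f : Ω → ℝ≥0 → U → ℝ≥0∞}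
    (hf : Measurable fun x : PredDomain ℱ T U => f x.1.2 x.1.1 x.2) :
    ∫⁻ ω, ∫⁻ r in Ioc 0 T, ∫⁻ u, f ω r u ∂μ ∂lam ∂P
      = ∫⁻ x, f x.1.2 x.1.1 x.2 ∂(predMeasure ℱ P μ lam T) := by
  have hm : Measurable fun z : Ω × ℝ≥0 × U => f z.1 (min T z.2.1) z.2.2 :=
    hf.comp measurable_clampTime
  rw [predMeasure, lintegral_map hf measurable_clampTime]
  change _ = ∫⁻ z : Ω × ℝ≥0 × U, f z.1 (min T z.2.1) z.2.2 ∂_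
  rw [lintegral_prod _ hm.aemeasurable]
  refine lintegral_congr fun ω => ?_
  have hm' : Measurable fun x : ℝ≥0 × U => f ω (min T x.1) x.2 := hm.comp measurable_prodMk_left
  rw [lintegral_prod _ hm'.aemeasurable]
  refine setLIntegral_congr_fun measurableSet_Ioc fun r hr => ?_
  simp only
  rw [min_eq_right hr.2]

theorem lintegral_strip_eq_prod {f : Ω → ℝ≥0 → U → ℝ≥0∞}
    (hf : Measurable fun x : PredDomain ℱ T U => f x.1.2 x.1.1 x.2) :
    ∫⁻ ω, ∫⁻ r in Ioc 0 T, ∫⁻ u, f ω r u ∂μ ∂lam ∂P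
      = ∫⁻ z : Ω × ℝ≥0 × U, f z.1 z.2.1 z.2.2 ∂(P.prod (stripMeasure lam μ T)) := by
  rw [lintegral_strip_eq_predMeasure hf, predMeasure, lintegral_map hf measurable_clampTime]
  refine lintegral_congr_ae ?_
  filter_upwards [ae_mem_Ioc_strip (P := P)] with z hz
  change f z.1 (min T z.2.1) z.2.2 = _
  rw [min_eq_right hz.2]

theorem lambdaNormSq_eq_lintegral_prod
    (hqm : ∀ h₁ h₂, Measurable fun x : ℝ≥0 × U => (q x.1 x.2).form h₁ h₂)
    {Φ : OpFamily Ω G q} (hΦ : IsPredictableFamily ℱ T q Φ) :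
    lambdaNormSq P μ lam T q Φ
      = ∫⁻ z : Ω × ℝ≥0 × U, hsNormSq (Φ z.2.1 z.1 z.2.2) ∂(P.prod (stripMeasure lam μ T)) :=
  lintegral_strip_eq_prod (f := fun ω r u => hsNormSq (Φ r ω u)) (hΦ.measurable_hsNormSq hqm)

theorem lambdaNormSq_eq_lintegral_predMeasure
    (hqm : ∀ h₁ h₂, Measurable fun x : ℝ≥0 × U => (q x.1 x.2).form h₁ h₂)
    {Φ : OpFamily Ω G q} (hΦ : IsPredictableFamily ℱ T q Φ) :
    lambdaNormSq P μ lam T q Φ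
      = ∫⁻ x, hsNormSq (Φ x.1.1 x.1.2 x.2) ∂(predMeasure ℱ P μ lam T) :=
  lintegral_strip_eq_predMeasure (f := fun ω r u => hsNormSq (Φ r ω u))
    (hΦ.measurable_hsNormSq hqm)

theorem IsPredictableFamily.sub {Φ Ψ : OpFamily Ω G q} (hΦ : IsPredictableFamily ℱ T q Φ)
    (hΨ : IsPredictableFamily ℱ T q Ψ) :
    IsPredictableFamily ℱ T q fun r ω u => Φ r ω u - Ψ r ω u :=
  IsWeaklyMeasurable.sub hΦ hΨ

theorem lambdaNormSq_sub_comm (Φ Ψ : OpFamily Ω G q) :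
    lambdaNormSq P μ lam T q (fun r ω u => Φ r ω u - Ψ r ω u)
      = lambdaNormSq P μ lam T q (fun r ω u => Ψ r ω u - Φ r ω u) := by
  simp only [lambdaNormSq, fun r ω u => hsNormSq_sub_comm (Φ r ω u) (Ψ r ω u)]

theorem lambdaNormSq_sub_triangle
    (hqm : ∀ h₁ h₂, Measurable fun x : ℝ≥0 × U => (q x.1 x.2).form h₁ h₂)
    {Φ₁ Φ₂ Φ₃ : OpFamily Ω G q} (h₁ : IsPredictableFamily ℱ T q Φ₁)
    (h₂ : IsPredictableFamily ℱ T q Φ₂) (h₃ : IsPredictableFamily ℱ T q Φ₃) :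
    lambdaNormSq P μ lam T q (fun r ω u => Φ₁ r ω u - Φ₃ r ω u)
      ≤ 2 * lambdaNormSq P μ lam T q (fun r ω u => Φ₁ r ω u - Φ₂ r ω u)
      + 2 * lambdaNormSq P μ lam T q (fun r ω u => Φ₂ r ω u - Φ₃ r ω u) := by
  rw [lambdaNormSq_eq_lintegral_predMeasure hqm (h₁.sub h₃),
    lambdaNormSq_eq_lintegral_predMeasure hqm (h₁.sub h₂),
    lambdaNormSq_eq_lintegral_predMeasure hqm (h₂.sub h₃)]
  exact lintegral_hsNormSq_sub_triangle (measurable_form_predDomain hqm) h₁ h₂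

/-- Each term is a constant operator composed with i_q*, weakly measurable because the forms are,
times the indicator of a predictable rectangle and of a set in the ring. -/
theorem SimpleIntegrand.isPredictableFamily {𝓡 : Set (Set U)}
    (h𝓡_meas : ∀ A ∈ 𝓡, MeasurableSet A)
    (hqm : ∀ h₁ h₂, Measurable fun x : ℝ≥0 × U => (q x.1 x.2).form h₁ h₂)
    (Ψ : SimpleIntegrand ℱ 𝓡 T H G) : IsPredictableFamily ℱ T q (Ψ.toFamily q) := by
  refine IsWeaklyMeasurable.sum _ fun i _ => IsWeaklyMeasurable.sum _ fun j _ =>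
    IsWeaklyMeasurable.smul (isWeaklyMeasurable_comp_incl_adjoint
      (measurable_form_predDomain hqm) (Ψ.S i j)) ?_
  have h1 : Measurable[ℱ.predictable]
      ((Ioc (Ψ.s i) (Ψ.t i) ×ˢ Ψ.F i).indicator (1 : ℝ≥0 × Ω → ℝ)) :=
    letI := ℱ.predictable
    Measurable.indicator (f := (1 : ℝ≥0 × Ω → ℝ)) measurable_const
      (measurableSet_predictable_Ioc_prod _ _ (Ψ.measurable_F i))
  have h2 : Measurable[predictableUpTo ℱ T] fun x : Iic T × Ω =>
      (Ioc (Ψ.s i) (Ψ.t i) ×ˢ Ψ.F i).indicator (1 : ℝ≥0 × Ω → ℝ) ((x.1 : ℝ≥0), x.2) :=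
    @Measurable.comp _ _ _ (predictableUpTo ℱ T) ℱ.predictable _ _ _ h1 (comap_measurable _)
  have h3 : Measurable fun x : PredDomain ℱ T U =>
      (Ioc (Ψ.s i) (Ψ.t i) ×ˢ Ψ.F i).indicator (1 : ℝ≥0 × Ω → ℝ) ((x.1.1 : ℝ≥0), x.1.2) :=
    h2.comp (@measurable_fst _ _ (predictableUpTo ℱ T) _)
  have h4 : Measurable fun x : PredDomain ℱ T U => (Ψ.A j).indicator (1 : U → ℝ) x.2 :=
    (measurable_one.indicator (h𝓡_meas _ (Ψ.A_mem j))).comp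
      (@measurable_snd _ _ (predictableUpTo ℱ T) _)
  convert h3.mul h4 using 1
  ext x
  by_cases h : (x.1.1 : ℝ≥0) ∈ Ioc (Ψ.s i) (Ψ.t i) <;> by_cases h' : x.1.2 ∈ Ψ.F i <;>
    simp [indicator, h, h', -mem_Ioc]

end PredictableDomain

/-! ### Operations on simple integrands -/

section SimpleSub

set_option linter.unusedSectionVars false

variable {Ω U H G : Type*} {mΩ : MeasurableSpace Ω}
  [NormedAddCommGroup H] [InnerProductSpace ℝ H] [CompleteSpace H]
  [NormedAddCommGroup G] [InnerProductSpace ℝ G] [CompleteSpace G]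
  {ℱ : Filtration ℝ≥0 mΩ} {T : ℝ≥0} {𝓡 : Set (Set U)}

/-- The difference of two simple integrands. -/
def SimpleIntegrand.sub (Ψ Ψ' : SimpleIntegrand ℱ 𝓡 T H G) : SimpleIntegrand ℱ 𝓡 T H G where
  n := Ψ.n + Ψ'.n
  m := Ψ.m + Ψ'.m
  s := Fin.append Ψ.s Ψ'.s
  t := Fin.append Ψ.t Ψ'.t
  F := Fin.append Ψ.F Ψ'.F
  A := Fin.append Ψ.A Ψ'.A
  -- The coefficients form a full matrix over time pieces and mark sets, so concatenation is block
  -- diagonal, with zeros off the diagonal.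
  S := Fin.append (fun i => Fin.append (Ψ.S i) fun _ => 0)
    fun i => Fin.append (fun _ => 0) fun j => -Ψ'.S i j
  s_lt_t i := by
    refine Fin.addCases (fun i => ?_) (fun i => ?_) i
    · simpa using Ψ.s_lt_t i
    · simpa using Ψ'.s_lt_t i
  t_le i := by
    refine Fin.addCases (fun i => ?_) (fun i => ?_) i
    · simpa using Ψ.t_le i
    · simpa using Ψ'.t_le i
  measurable_F i := by
    refine Fin.addCases (fun i => ?_) (fun i => ?_) i
    · rw [Fin.append_left, Fin.append_left]
      exact Ψ.measurable_F i
    · rw [Fin.append_right, Fin.append_right]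
      exact Ψ'.measurable_F i
  A_mem j := by
    refine Fin.addCases (fun i => ?_) (fun i => ?_) j
    · simpa using Ψ.A_mem i
    · simpa using Ψ'.A_mem i
  S_hs i j := by
    refine Fin.addCases (fun i => ?_) (fun i => ?_) i <;>
      refine Fin.addCases (fun j => ?_) (fun j => ?_) j
    · simpa using Ψ.S_hs i j
    · simpa using IsHilbertSchmidt.zero
    · simpa using IsHilbertSchmidt.zero
    · simpa using (Ψ'.S_hs i j).neg

theorem SimpleIntegrand.toFamily_sub (Ψ Ψ' : SimpleIntegrand ℱ 𝓡 T H G)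
    (q : ℝ≥0 → U → HilbertSeminorm H) (r : ℝ≥0) (ω : Ω) (u : U) :
    (Ψ.sub Ψ').toFamily q r ω u = Ψ.toFamily q r ω u - Ψ'.toFamily q r ω u := by
  change ∑ i : Fin (Ψ.n + Ψ'.n), ∑ j : Fin (Ψ.m + Ψ'.m), _ = _
  simp only [toFamily, sub, Fin.sum_univ_add, Fin.append_left, Fin.append_right,
    ContinuousLinearMap.zero_comp, ContinuousLinearMap.neg_comp, smul_zero, smul_neg,
    Finset.sum_const_zero, add_zero, zero_add, Finset.sum_neg_distrib, sub_eq_add_neg]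

/-- The simple integrand without terms. -/
def SimpleIntegrand.nil (ℱ : Filtration ℝ≥0 mΩ) (𝓡 : Set (Set U)) (T : ℝ≥0) (H G : Type*)
    [NormedAddCommGroup H] [InnerProductSpace ℝ H] [CompleteSpace H]
    [NormedAddCommGroup G] [InnerProductSpace ℝ G] : SimpleIntegrand ℱ 𝓡 T H G where
  n := 0
  m := 0
  s := Fin.elim0
  t := Fin.elim0
  F := Fin.elim0
  A := Fin.elim0
  S := Fin.elim0
  s_lt_t i := i.elim0
  t_le i := i.elim0
  measurable_F i := i.elim0
  A_mem i := i.elim0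
  S_hs i := i.elim0

theorem SimpleIntegrand.toFamily_nil (q : ℝ≥0 → U → HilbertSeminorm H) (r : ℝ≥0) (ω : Ω) (u : U) :
    (SimpleIntegrand.nil ℱ 𝓡 T H G).toFamily q r ω u = 0 := by
  simp [toFamily, nil]

/-- The simple integrand `1_{(s,t]} 1_F 1_A S ∘ i*`. -/
def SimpleIntegrand.single {s t : ℝ≥0} (hst : s < t) (ht : t ≤ T) {F : Set Ω}
    (hF : MeasurableSet[ℱ s] F) {A : Set U} (hA : A ∈ 𝓡) {S : H →L[ℝ] G}
    (hS : IsHilbertSchmidt S) : SimpleIntegrand ℱ 𝓡 T H G where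
  n := 1
  m := 1
  s _ := s
  t _ := t
  F _ := F
  A _ := A
  S _ _ := S
  s_lt_t _ := hst
  t_le _ := ht
  measurable_F _ := hF
  A_mem _ := hA
  S_hs _ _ := hS

theorem SimpleIntegrand.toFamily_single {s t : ℝ≥0} (hst : s < t) (ht : t ≤ T) {F : Set Ω}
    (hF : MeasurableSet[ℱ s] F) {A : Set U} (hA : A ∈ 𝓡) {S : H →L[ℝ] G}
    (hS : IsHilbertSchmidt S) (q : ℝ≥0 → U → HilbertSeminorm H) (r : ℝ≥0) (ω : Ω) (u : U) :
    (SimpleIntegrand.single hst ht hF hA hS).toFamily q r ω u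
      = ((Ioc s t).indicator 1 r * F.indicator 1 ω * A.indicator 1 u : ℝ) •
        S.comp (q r u).incl.adjoint := by
  change ∑ _i : Fin 1, ∑ _j : Fin 1, _ = _
  simp [single]

/-- Adjoint of i_p = i_{p,q} ∘ i_q: the same data describe the simple integrand for q and its
restriction for p. -/
theorem SimpleIntegrand.toFamily_comp_inclLE_adjoint (Ψ : SimpleIntegrand ℱ 𝓡 T H G)
    (p q : ℝ≥0 → U → HilbertSeminorm H) (hpq : ∀ r u h, p r u h ≤ q r u h) (r : ℝ≥0) (ω : Ω)
    (u : U) : (Ψ.toFamily q r ω u).comp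
      (HilbertSeminorm.inclLE (p r u) (q r u) (hpq r u)).adjoint = Ψ.toFamily p r ω u := by
  simp only [toFamily, ContinuousLinearMap.finsetSum_comp, ContinuousLinearMap.smul_comp]
  refine Finset.sum_congr rfl fun i _ => Finset.sum_congr rfl fun j _ => ?_
  rw [ContinuousLinearMap.comp_assoc, ← ContinuousLinearMap.adjoint_comp,
    HilbertSeminorm.inclLE_comp_incl]

end SimpleSub

/-! ### Generating π-systems for the predictable σ-algebra -/

section PredictableGenerator

variable {Ω U : Type*} {mΩ : MeasurableSpace Ω}

/-- The sets generating the predictable σ-algebra. -/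
def predictableRects (ℱ : Filtration ℝ≥0 mΩ) : Set (Set (ℝ≥0 × Ω)) :=
  {s | ∃ A, MeasurableSet[ℱ ⊥] A ∧ s = {⊥} ×ˢ A} ∪
    {s | ∃ i A, MeasurableSet[ℱ i] A ∧ s = Ioi i ×ˢ A}

/-- Rectangles at time 0 and rectangles over open half-lines never meet, so only like shapes
intersect. -/
theorem isPiSystem_predictableRects (ℱ : Filtration ℝ≥0 mΩ) : IsPiSystem (predictableRects ℱ) := by
  rintro _ (⟨A, hA, rfl⟩ | ⟨i, A, hA, rfl⟩) _ (⟨B, hB, rfl⟩ | ⟨j, B, hB, rfl⟩) hne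
  · exact Or.inl ⟨A ∩ B, hA.inter hB, by rw [prod_inter_prod, inter_self]⟩
  · obtain ⟨x, hx1, hx2⟩ := hne
    have h1 : x.1 = ⊥ := hx1.1
    have h2 : j < x.1 := hx2.1
    exact absurd (h1 ▸ h2) not_lt_bot
  · obtain ⟨x, hx1, hx2⟩ := hne
    have h1 : x.1 = ⊥ := hx2.1
    have h2 : i < x.1 := hx1.1
    exact absurd (h1 ▸ h2) not_lt_bot
  · refine Or.inr ⟨max i j, A ∩ B, (ℱ.mono (le_max_left i j) _ hA).inter
      (ℱ.mono (le_max_right i j) _ hB), ?_⟩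
    rw [prod_inter_prod, Ioi_inter_Ioi]

theorem predictableUpTo_eq_generateFrom (ℱ : Filtration ℝ≥0 mΩ) (T : ℝ≥0) :
    predictableUpTo ℱ T = MeasurableSpace.generateFrom
      (insert univ (preimage (fun x : Iic T × Ω => ((x.1 : ℝ≥0), x.2)) '' predictableRects ℱ)) := by
  rw [MeasurableSpace.generateFrom_insert_univ, ← MeasurableSpace.comap_generateFrom]
  rfl

/-- A generating π-system of `[0,T] × Ω × U`. -/
def predDomainRects (ℱ : Filtration ℝ≥0 mΩ) (T : ℝ≥0) (𝓡 : Set (Set U)) :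
    Set (Set ((Iic T × Ω) × U)) :=
  image2 (· ×ˢ ·)
    (insert univ (preimage (fun x : Iic T × Ω => ((x.1 : ℝ≥0), x.2)) '' predictableRects ℱ))
    (insert univ 𝓡)

theorem isPiSystem_predDomainRects (ℱ : Filtration ℝ≥0 mΩ) (T : ℝ≥0) {𝓡 : Set (Set U)}
    (h𝓡 : IsSetRing 𝓡) : IsPiSystem (predDomainRects ℱ T 𝓡) :=
  ((isPiSystem_predictableRects ℱ).comap _).insert_univ.prod
    (IsPiSystem.insert_univ fun _ hs _ ht _ => h𝓡.inter_mem hs ht)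

/-- The ring need not contain U or cover it countably; adjoining the whole space to both generators
supplies the covering needed for the product σ-algebra. -/
theorem predDomain_eq_generateFrom [mU : MeasurableSpace U] (ℱ : Filtration ℝ≥0 mΩ) (T : ℝ≥0)
    {𝓡 : Set (Set U)} (h𝓡_gen : MeasurableSpace.generateFrom 𝓡 = mU) :
    (inferInstance : MeasurableSpace (PredDomain ℱ T U))
      = MeasurableSpace.generateFrom (predDomainRects ℱ T 𝓡) := by
  have h := generateFrom_prod_eq (α := Iic T × Ω) (β := U)
    (C := insert univ (preimage (fun x : Iic T × Ω => ((x.1 : ℝ≥0), x.2)) '' predictableRects ℱ))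
    (D := insert univ 𝓡) ⟨fun _ => univ, fun _ => mem_insert _ _, iUnion_const _⟩
    ⟨fun _ => univ, fun _ => mem_insert _ _, iUnion_const _⟩
  rw [MeasurableSpace.generateFrom_insert_univ 𝓡, h𝓡_gen, ← predictableUpTo_eq_generateFrom] at h
  exact h

end PredictableGenerator

/-! ### Simple integrands are dense -/

section SimpleDensity

set_option linter.unusedSectionVars false

variable {Ω U H G : Type*} {mΩ : MeasurableSpace Ω} [mU : MeasurableSpace U]
  {ℱ : Filtration ℝ≥0 mΩ} {T : ℝ≥0} {𝓡 : Set (Set U)}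
  {P : Measure Ω} [IsProbabilityMeasure P] {μ : Measure U} {lam : Measure ℝ≥0}
  [SFinite lam] [SFinite μ]
  [NormedAddCommGroup H] [InnerProductSpace ℝ H] [CompleteSpace H]
  [SecondCountableTopology H]
  [NormedAddCommGroup G] [InnerProductSpace ℝ G] [CompleteSpace G] [SecondCountableTopology G]
  {q : ℝ≥0 → U → HilbertSeminorm H}

/-- Families of operators on `[0,T] × Ω × U` which come from simple integrands. -/
def IsSimpleFamily (ℱ : Filtration ℝ≥0 mΩ) (T : ℝ≥0) (𝓡 : Set (Set U))
    (q : ℝ≥0 → U → HilbertSeminorm H)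
    (Ψ : (x : PredDomain ℱ T U) → ((q x.1.1 x.2).Space →L[ℝ] G)) : Prop :=
  ∃ Θ : SimpleIntegrand ℱ 𝓡 T H G, ∀ x, Ψ x = Θ.toFamily q x.1.1 x.1.2 x.2

theorem IsSimpleFamily.zero : IsSimpleFamily (G := G) ℱ T 𝓡 q 0 :=
  ⟨SimpleIntegrand.nil ℱ 𝓡 T H G, fun _ => (SimpleIntegrand.toFamily_nil q _ _ _).symm⟩

theorem IsSimpleFamily.sub {Ψ Ψ' : (x : PredDomain ℱ T U) → ((q x.1.1 x.2).Space →L[ℝ] G)}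
    (h : IsSimpleFamily ℱ T 𝓡 q Ψ) (h' : IsSimpleFamily ℱ T 𝓡 q Ψ') :
    IsSimpleFamily ℱ T 𝓡 q (Ψ - Ψ') := by
  obtain ⟨Θ, hΘ⟩ := h
  obtain ⟨Θ', hΘ'⟩ := h'
  refine ⟨Θ.sub Θ', fun x => ?_⟩
  rw [SimpleIntegrand.toFamily_sub, Pi.sub_apply, hΘ, hΘ']

theorem isHilbertSchmidt_rankOne (g : G) (h : H) :
    IsHilbertSchmidt (InnerProductSpace.rankOne ℝ g h) := by
  rw [IsHilbertSchmidt, hsNormSq_rankOne]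
  exact ENNReal.mul_lt_top (ENNReal.pow_lt_top enorm_lt_top) (ENNReal.pow_lt_top enorm_lt_top)

/-- On (s,T] × F × A the family g ⊗ i_q h is itself simple, with S the rank-one operator g ⊗ h on H,
since (g ⊗ h) ∘ i_q* = g ⊗ i_q h. -/
theorem isL2Approx_box {E : Set (PredDomain ℱ T U)} {s : ℝ≥0} {F : Set Ω}
    (hF : MeasurableSet[ℱ s] F) {A : Set U} (hA : A ∈ 𝓡)
    (hE : ∀ᵐ x ∂(predMeasure ℱ P μ lam T), x ∈ E ↔ s < (x.1.1 : ℝ≥0) ∧ x.1.2 ∈ F ∧ x.2 ∈ A)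
    (g : G) (h : H) :
    IsL2Approx (predMeasure ℱ P μ lam T) (IsSimpleFamily ℱ T 𝓡 q) fun x =>
      (E.indicator 1 x : ℝ) • InnerProductSpace.rankOne ℝ g ((q x.1.1 x.2).incl h) := by
  intro ε _
  -- For s ≥ T the box has no times in [0,T], and a simple integrand over (s,T] would be illegal;
  -- zero is used.
  rcases lt_or_ge s T with hs | hs
  · refine ⟨_, ⟨SimpleIntegrand.single hs le_rfl hF hA (isHilbertSchmidt_rankOne g h),
      fun x => rfl⟩, le_of_eq_of_le ?_ zero_le⟩
    rw [lintegral_eq_zero_of_ae_eq_zero]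
    filter_upwards [hE] with x hx
    have hT : (x.1.1 : ℝ≥0) ≤ T := x.1.1.2
    rw [SimpleIntegrand.toFamily_single, InnerProductSpace.rankOne_comp,
      ContinuousLinearMap.adjoint_adjoint, ← sub_smul, hsNormSq_smul]
    by_cases hxE : x ∈ E
    · obtain ⟨h1, h2, h3⟩ := hx.1 hxE
      simp [hxE, h1, h2, h3, hT]
    · have h0 : ¬ (s < (x.1.1 : ℝ≥0) ∧ x.1.2 ∈ F ∧ x.2 ∈ A) := fun h => hxE (hx.2 h)
      by_cases h1 : s < (x.1.1 : ℝ≥0) <;> by_cases h2 : x.1.2 ∈ F <;> by_cases h3 : x.2 ∈ A <;>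
        simp_all
  · refine ⟨0, IsSimpleFamily.zero, le_of_eq_of_le ?_ zero_le⟩
    rw [lintegral_eq_zero_of_ae_eq_zero]
    filter_upwards [hE] with x hx
    have hT : (x.1.1 : ℝ≥0) ≤ T := x.1.1.2
    have hxE : x ∉ E := fun h => absurd (hx.1 h).1 (not_lt.2 (hT.trans hs))
    simp [hxE, hsNormSq_zero]

theorem isL2Approx_predDomainRects (h𝓡 : IsSetRing 𝓡) {E : Set (PredDomain ℱ T U)}
    (hE : E ∈ predDomainRects ℱ T 𝓡) {A : Set U} (hA : A ∈ 𝓡) (g : G) (h : H) :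
    IsL2Approx (predMeasure ℱ P μ lam T) (IsSimpleFamily ℱ T 𝓡 q) fun x =>
      ((E ∩ {x | x.2 ∈ A}).indicator 1 x : ℝ) •
        InnerProductSpace.rankOne ℝ g ((q x.1.1 x.2).incl h) := by
  obtain ⟨D, hD, B, hB, rfl⟩ := hE
  have hBA : B ∩ A ∈ 𝓡 := by
    rcases hB with rfl | hB
    · rwa [univ_inter]
    · exact h𝓡.inter_mem hB hA
  rcases hD with rfl | ⟨_, ⟨F, hF, rfl⟩ | ⟨s, F, hF, rfl⟩, rfl⟩
  · refine isL2Approx_box (s := 0) (F := univ) MeasurableSet.univ hBA ?_ g h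
    filter_upwards [ae_predMeasure_time_pos] with x hx
    change (x.1 ∈ univ ∧ x.2 ∈ B) ∧ x.2 ∈ A ↔ _
    simp only [mem_inter_iff, mem_univ, true_and, hx]
  -- Rectangles at time 0 are null for the measure, so the empty event represents them.
  · refine isL2Approx_box (s := 0) (F := ∅) (@MeasurableSet.empty _ (ℱ 0)) hBA ?_ g h
    filter_upwards [ae_predMeasure_time_pos] with x hx
    change (((x.1.1 : ℝ≥0) = 0 ∧ x.1.2 ∈ F) ∧ x.2 ∈ B) ∧ x.2 ∈ A ↔ _
    simp [hx.ne']
  · refine isL2Approx_box hF hBA (ae_of_all _ fun x => ?_) g h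
    change ((s < (x.1.1 : ℝ≥0) ∧ x.1.2 ∈ F) ∧ x.2 ∈ B) ∧ x.2 ∈ A ↔ _
    simp only [mem_inter_iff, and_assoc]

theorem lintegral_rankOne_lt_top (hlam : ∀ t, lam (Iic t) < ∞)
    (hqb : ∀ (T : ℝ≥0) h₁ h₂, ∃ C : ℝ, ∀ r ≤ T, ∀ u, |(q r u).form h₁ h₂| ≤ C)
    {A : Set U} (hAm : MeasurableSet A) (hA : μ A < ∞) (g : G) (h : H) :
    ∫⁻ x in {x : PredDomain ℱ T U | x.2 ∈ A},
      hsNormSq (InnerProductSpace.rankOne ℝ g ((q x.1.1 x.2).incl h))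
        ∂(predMeasure ℱ P μ lam T) ≠ ∞ := by
  obtain ⟨C, hC⟩ := hqb T h h
  have hle : ∀ x : PredDomain ℱ T U,
      hsNormSq (InnerProductSpace.rankOne ℝ g ((q x.1.1 x.2).incl h))
        ≤ ‖g‖ₑ ^ 2 * ENNReal.ofReal C := by
    intro x
    rw [hsNormSq_rankOne]
    gcongr
    rw [← ofReal_norm, ← ENNReal.ofReal_pow (norm_nonneg _), HilbertSeminorm.norm_incl,
      HilbertSeminorm.sq_apply]
    exact ENNReal.ofReal_le_ofReal ((le_abs_self _).trans (hC _ x.1.1.2 _))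
  refine ne_top_of_le_ne_top ?_ (lintegral_mono hle)
  rw [setLIntegral_const]
  exact ENNReal.mul_ne_top (ENNReal.mul_ne_top (ENNReal.pow_ne_top enorm_ne_top)
    ENNReal.ofReal_ne_top) (predMeasure_univ_prod hlam hAm hA).ne

/-- Simple integrands are dense in `Λ²`. -/
theorem exists_simpleIntegrand_tendsto (h𝓡 : IsSetRing 𝓡) (h𝓡_meas : ∀ A ∈ 𝓡, MeasurableSet A)
    (h𝓡_gen : MeasurableSpace.generateFrom 𝓡 = mU) (hμ : ∀ A ∈ 𝓡, μ A < ∞)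
    (hμ_cover : ∃ A : ℕ → Set U, (∀ n, A n ∈ 𝓡) ∧ μ (⋃ n, A n)ᶜ = 0)
    (hlam : ∀ t, lam (Iic t) < ∞)
    (hqm : ∀ h₁ h₂, Measurable fun x : ℝ≥0 × U => (q x.1 x.2).form h₁ h₂)
    (hqb : ∀ (T : ℝ≥0) h₁ h₂, ∃ C : ℝ, ∀ r ≤ T, ∀ u, |(q r u).form h₁ h₂| ≤ C)
    {Φ : OpFamily Ω G q} (hΦ : IsPredictableFamily ℱ T q Φ)
    (hfin : lambdaNormSq P μ lam T q Φ < ∞) :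
    ∃ Ψ : ℕ → SimpleIntegrand ℱ 𝓡 T H G, Tendsto (fun k =>
      lambdaNormSq P μ lam T q fun r ω u => (Ψ k).toFamily q r ω u - Φ r ω u) atTop (𝓝 0) := by
  obtain ⟨A, hA, hAc⟩ := hμ_cover
  have hAcc : ∀ n, accumulate A n ∈ 𝓡 := h𝓡.accumulate_mem hA
  -- Finite unions of the covering sets remain in the ring, increase, and have finite measure;
  -- rank-one families are square integrable on each because the forms are bounded.
  set V : ℕ → Set (PredDomain ℱ T U) := fun n => {x | x.2 ∈ accumulate A n} with hVdef
  have hV : ∀ n, MeasurableSet (V n) := fun n => measurable_time_mark.snd (h𝓡_meas _ (hAcc n))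
  have hVm : Monotone V := fun m n hmn x hx => monotone_accumulate hmn hx
  have hVf : ∀ n, predMeasure ℱ P μ lam T (V n) < ∞ := fun n =>
    predMeasure_univ_prod hlam (h𝓡_meas _ (hAcc n)) (hμ _ (hAcc n))
  have hVc : predMeasure ℱ P μ lam T (⋃ n, V n)ᶜ = 0 := by
    rw [← predMeasure_univ_prod_eq_zero (ℱ := ℱ) (P := P) (lam := lam) (T := T)
      (MeasurableSet.iUnion fun n => h𝓡_meas _ (hA n)).compl hAc]
    congr 1
    ext x
    have : (∃ n, x.2 ∈ accumulate A n) ↔ ∃ n, x.2 ∈ A n := by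
      rw [← mem_iUnion, ← mem_iUnion, iUnion_accumulate]
    simp only [hVdef, mem_compl_iff, mem_iUnion, mem_ofPred_eq, this]
  -- The null complement of the union is added to every V n to obtain an honest cover.
  have hσ : SigmaFinite (predMeasure ℱ P μ lam T) := by
    refine ⟨⟨{ set := fun n => V n ∪ (⋃ n, V n)ᶜ, set_mem := fun _ => trivial,
               finite := fun n => ?_, spanning := ?_ }⟩⟩
    · refine (measure_union_le _ _).trans_lt ?_
      rw [hVc, add_zero]
      exact hVf n
    · rw [← iUnion_union, union_compl_self]
  have hQ := measurable_form_predDomain (ℱ := ℱ) (T := T) hqm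
  have hsm : ∀ Ψ : (x : PredDomain ℱ T U) → ((q x.1.1 x.2).Space →L[ℝ] G),
      IsSimpleFamily ℱ T 𝓡 q Ψ → IsWeaklyMeasurable (fun x : PredDomain ℱ T U => q x.1.1 x.2) Ψ := by
    rintro Ψ ⟨Θ, hΘ⟩
    rw [funext hΘ]
    exact Θ.isPredictableFamily h𝓡_meas hqm
  have hap : IsL2Approx (predMeasure ℱ P μ lam T) (IsSimpleFamily ℱ T 𝓡 q)
      fun x => Φ x.1.1 x.1.2 x.2 := by
    refine isL2Approx_of_rankOne hQ hsm (fun _ _ => IsSimpleFamily.sub) IsSimpleFamily.zero hV hVm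
      hVc (fun g h n E hE => ?_) hΦ ?_
    · refine isL2Approx_indicator_smul hQ hsm (fun _ _ => IsSimpleFamily.sub) IsSimpleFamily.zero
        (isPiSystem_predDomainRects ℱ T h𝓡) (predDomain_eq_generateFrom ℱ T h𝓡_gen) (hV n)
        (isWeaklyMeasurable_rankOne (measurable_inner_incl hQ h) g)
        (lintegral_rankOne_lt_top hlam hqb (h𝓡_meas _ (hAcc n)) (hμ _ (hAcc n)) g h)
        (fun E hE => isL2Approx_predDomainRects h𝓡 hE (hAcc n) g h) ?_ hE
      have hu : (univ : Set (PredDomain ℱ T U)) ∈ predDomainRects ℱ T 𝓡 :=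
        ⟨univ, mem_insert _ _, univ, mem_insert _ _, univ_prod_univ⟩
      have := isL2Approx_predDomainRects (P := P) (μ := μ) (lam := lam) (q := q) h𝓡 hu (hAcc n) g h
      simpa only [univ_inter] using this
    · rw [← lambdaNormSq_eq_lintegral_predMeasure hqm hΦ]
      exact hfin.ne
  have hex : ∀ k : ℕ, ∃ Θ : SimpleIntegrand ℱ 𝓡 T H G, lambdaNormSq P μ lam T q
      (fun r ω u => Θ.toFamily q r ω u - Φ r ω u) ≤ ((k : ℝ≥0∞) + 1)⁻¹ := by
    intro k
    obtain ⟨Ψ, ⟨Θ, hΘ⟩, hle⟩ := hap ((k : ℝ≥0∞) + 1)⁻¹ (by simp)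
    refine ⟨Θ, ?_⟩
    rw [lambdaNormSq_eq_lintegral_predMeasure hqm ((Θ.isPredictableFamily h𝓡_meas hqm).sub hΦ)]
    simpa only [hΘ] using hle
  choose Ψ hΨ using hex
  refine ⟨Ψ, tendsto_of_tendsto_of_tendsto_of_le_of_le tendsto_const_nhds ?_
    (fun _ => zero_le) hΨ⟩
  have h := (ENNReal.tendsto_inv_nat_nhds_zero.comp (tendsto_add_atTop_nat 1))
  simpa [Function.comp_def] using h

end SimpleDensity

/-! ### Right continuity in `L²` and stopping -/

section RightCont

set_option linter.unusedSectionVars false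

variable {Ω G : Type*} {mΩ : MeasurableSpace Ω} {P : Measure Ω} {ℱ : Filtration ℝ≥0 mΩ}
  [NormedAddCommGroup G] [InnerProductSpace ℝ G] [CompleteSpace G] [IsProbabilityMeasure P]
  {T : ℝ≥0}

/-- Right continuity in `L²` on `[0,T)`. -/
def IsRightContL2 (P : Measure Ω) (T : ℝ≥0) (X : ℝ≥0 → Ω → G) : Prop :=
  ∀ t < T, Tendsto (fun s => ∫⁻ ω, ‖X s ω - X t ω‖ₑ ^ 2 ∂P) (𝓝[Icc t T] t) (𝓝 0)

namespace IsRightContL2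

variable {X Y : ℝ≥0 → Ω → G}

theorem zero : IsRightContL2 P T fun _ _ => (0 : G) := fun t _ => by
  simpa using tendsto_const_nhds

theorem add (hX : IsRightContL2 P T X) (hY : IsRightContL2 P T Y)
    (hXm : ∀ t ≤ T, AEStronglyMeasurable (X t) P) :
    IsRightContL2 P T fun t ω => X t ω + Y t ω := by
  intro t ht
  have h := (ENNReal.Tendsto.const_mul (a := 2) (hX t ht) (Or.inr ENNReal.ofNat_ne_top)).add
    (ENNReal.Tendsto.const_mul (a := 2) (hY t ht) (Or.inr ENNReal.ofNat_ne_top))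
  simp only [mul_zero, add_zero] at h
  refine tendsto_of_tendsto_of_tendsto_of_le_of_le' tendsto_const_nhds h
    (Eventually.of_forall fun _ => zero_le) ?_
  filter_upwards [self_mem_nhdsWithin] with s hs
  simp_rw [add_sub_add_comm]
  exact lintegral_enorm_add_sq_le ((hXm s hs.2).sub (hXm t ht.le))

theorem neg (hX : IsRightContL2 P T X) : IsRightContL2 P T fun t ω => - X t ω := by
  intro t ht
  have e : ∀ s ω, ‖- X s ω - - X t ω‖ₑ = ‖X s ω - X t ω‖ₑ := fun s ω => by
    rw [← neg_sub', enorm_neg]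
  simp_rw [e]
  exact hX t ht

theorem sub (hX : IsRightContL2 P T X) (hY : IsRightContL2 P T Y)
    (hXm : ∀ t ≤ T, AEStronglyMeasurable (X t) P) :
    IsRightContL2 P T fun t ω => X t ω - Y t ω := by
  simpa only [sub_eq_add_neg] using hX.add hY.neg hXm

theorem sum {ι : Type*} {X : ι → ℝ≥0 → Ω → G} (s : Finset ι)
    (h : ∀ i ∈ s, IsRightContL2 P T (X i))
    (hm : ∀ i ∈ s, ∀ t ≤ T, AEStronglyMeasurable (X i t) P) :
    IsRightContL2 P T fun t ω => ∑ i ∈ s, X i t ω := by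
  classical
  induction s using Finset.induction_on with
  | empty => simpa using zero
  | insert a s ha ih =>
    simp only [Finset.sum_insert ha]
    exact (h a (Finset.mem_insert_self _ _)).add
      (ih (fun i hi => h i (Finset.mem_insert_of_mem hi))
        fun i hi => hm i (Finset.mem_insert_of_mem hi)) (hm a (Finset.mem_insert_self _ _))

theorem smul_const {X : ℝ≥0 → Ω → ℝ} (hX : IsRightContL2 P T X) (g : G) :
    IsRightContL2 P T fun t ω => X t ω • g := by
  intro t ht
  simp_rw [← sub_smul, enorm_smul, mul_pow]
  simp_rw [fun s => lintegral_mul_const' (μ := P) (‖g‖ₑ ^ 2) (fun ω => ‖X s ω - X t ω‖ₑ ^ 2)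
    (ENNReal.pow_ne_top enorm_ne_top)]
  have := ENNReal.Tendsto.mul_const (b := ‖g‖ₑ ^ 2) (hX t ht)
    (Or.inr (ENNReal.pow_ne_top enorm_ne_top))
  rwa [zero_mul] at this

theorem congr (hX : IsRightContL2 P T X) (h : ∀ t ≤ T, X t =ᵐ[P] Y t) :
    IsRightContL2 P T Y := by
  intro t ht
  refine (hX t ht).congr' ?_
  filter_upwards [self_mem_nhdsWithin] with s hs
  refine lintegral_congr_ae ?_
  filter_upwards [h s hs.2, h t ht.le] with ω h1 h2
  rw [h1, h2]

theorem stopped (hX : IsRightContL2 P T X) (a : ℝ≥0) : IsRightContL2 P T fun t => X (min a t) := by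
  intro t ht
  refine (hX (min a t) ((min_le_right _ _).trans_lt ht)).comp ?_
  refine tendsto_nhdsWithin_iff.2 ⟨?_, ?_⟩
  · have : Continuous fun s : ℝ≥0 => min a s := by fun_prop
    exact (this.tendsto t).mono_left nhdsWithin_le_nhds
  · filter_upwards [self_mem_nhdsWithin] with s hs
    exact ⟨min_le_min_left _ hs.1, (min_le_right _ _).trans hs.2⟩

end IsRightContL2

theorem IsCadlagSqIntMartingale.isRightContL2 {X : ℝ≥0 → Ω → G}
    (hX : IsCadlagSqIntMartingale P ℱ T X) : IsRightContL2 P T X :=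
  fun _ ht => hX.isL2Martingale.tendsto_lintegral_sub hX.cadlag ht.le

theorem IsL2Martingale.stopped {X : ℝ≥0 → Ω → G} (hX : IsL2Martingale P ℱ T X) (a : ℝ≥0) :
    IsL2Martingale P ℱ T fun t => X (min a t) where
  adapted t ht := (hX.adapted _ ((min_le_right _ _).trans ht)).mono (ℱ.mono (min_le_right _ _))
  memLp t ht := hX.memLp _ ((min_le_right _ _).trans ht)
  orthogonal s t hst ht V hV hV2 := by
    rcases le_total a s with h | h
    · simp [min_eq_left h, min_eq_left (h.trans hst)]
    · rw [min_eq_right h]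
      exact hX.orthogonal s _ (le_min h hst) ((min_le_right _ _).trans ht) V hV hV2

theorem IsL2Martingale.smul_const {X : ℝ≥0 → Ω → ℝ} (hX : IsL2Martingale P ℱ T X) (g : G) :
    IsL2Martingale P ℱ T fun t ω => X t ω • g where
  adapted t ht := (hX.adapted t ht).smul_const g
  memLp t ht := by
    have := (hX.memLp t ht)
    refine MemLp.of_le_mul (c := ‖g‖) this (this.1.smul_const g) (ae_of_all _ fun ω => ?_)
    rw [norm_smul, mul_comm]
  orthogonal s t hst ht V hV hV2 := by
    have e : ∀ ω, (inner ℝ (X t ω • g - X s ω • g) (V ω) : ℝ)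
        = inner ℝ (X t ω - X s ω) (inner ℝ g (V ω) : ℝ) := fun ω => by
      rw [← sub_smul, inner_smul_left, conj_trivial]
      simp [mul_comm]
    simp_rw [e]
    exact hX.orthogonal s t hst ht _ (stronglyMeasurable_const.inner hV) (hV2.const_inner g)

end RightCont

/-! ### Bounds from the covariance -/

section CovarianceBound

set_option linter.unusedSectionVars false

/-- Continuity from above along intervals shrinking to the empty set. The filter also charges the
point t, where the interval is already empty. -/
theorem tendsto_measure_Ioc_nhdsWithin {lam : Measure ℝ≥0} (hlam : ∀ t, lam (Iic t) < ∞)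
    (t T : ℝ≥0) : Tendsto (fun s => lam (Ioc t s)) (𝓝[Icc t T] t) (𝓝 0) := by
  have h := tendsto_measure_biInter_gt (μ := lam) (s := fun s => Ioc t s) (a := t)
    (fun _ _ => measurableSet_Ioc.nullMeasurableSet) (fun _ _ _ hij => Ioc_subset_Ioc_right hij)
    ⟨t + 1, lt_add_one t, ((measure_mono Ioc_subset_Iic_self).trans_lt (hlam (t + 1))).ne⟩
  have h0 : (⋂ r > t, Ioc t r) = ∅ := by
    refine eq_empty_of_forall_notMem fun x hx => ?_
    simp only [mem_iInter, mem_Ioc] at hx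
    have h1 : t < x := (hx (t + 1) (lt_add_one t)).1
    obtain ⟨y, hy1, hy2⟩ := exists_between h1
    exact absurd (hx y hy1).2 (not_le.2 hy2)
  rw [h0, measure_empty] at h
  have h1 : 𝓝[Icc t T] t ≤ 𝓝[≥] t := nhdsWithin_mono _ Icc_subset_Ici_self
  refine Tendsto.mono_left ?_ h1
  rw [← Ioi_insert, nhdsWithin_insert]
  refine Tendsto.sup ?_ h
  rw [tendsto_pure_left]
  intro s hs
  simpa using mem_of_mem_nhds hs

variable {Ω U H : Type*} {mΩ : MeasurableSpace Ω} [NormedAddCommGroup H] [InnerProductSpace ℝ H]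
  {P : Measure Ω} [IsProbabilityMeasure P] {ℱ : Filtration ℝ≥0 mΩ} {𝓡 : Set (Set U)}
  {N : ℝ≥0 → Set U → H →ₗ[ℝ] (Ω →ₘ[P] ℝ)}
  [MeasurableSpace U] {μ : Measure U} {lam : Measure ℝ≥0}
  {p : ℝ≥0 → U → HilbertSeminorm H} {T : ℝ≥0}

/-- The uniform boundedness principle for families of Hilbertian seminorms. -/
theorem exists_forall_hilbertSeminorm_le [CompleteSpace H]
    (hb : ∀ h₁ h₂, ∃ C : ℝ, ∀ r ≤ T, ∀ u, |(p r u).form h₁ h₂| ≤ C) :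
    ∃ C : ℝ≥0, ∀ r ≤ T, ∀ u h, p r u h ≤ C * ‖h‖ := by
  set f : Iic T × U → Seminorm ℝ H := fun x =>
    (normSeminorm ℝ (p x.1 x.2).Space).comp ((p x.1 x.2).incl : H →ₗ[ℝ] (p x.1 x.2).Space)
  have hf : ∀ x h, f x h = p x.1 x.2 h := fun x h => (p x.1 x.2).norm_incl h
  have hbdd : BddAbove (range f) := by
    rw [Seminorm.bddAbove_range_iff]
    intro h
    obtain ⟨C, hC⟩ := hb h h
    refine ⟨√C, ?_⟩
    rintro _ ⟨x, rfl⟩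
    simp only [hf]
    exact Real.sqrt_le_sqrt ((le_abs_self _).trans (hC _ x.1.2 _))
  have hcont : Continuous ⇑(⨆ x, f x) := by
    rw [Seminorm.coe_iSup_eq hbdd]
    exact Seminorm.continuous_iSup f (fun x => continuous_norm.comp (p x.1 x.2).incl.continuous)
      hbdd
  obtain ⟨C, hC0, hC⟩ := Seminorm.bound_of_continuous_normedSpace (⨆ x, f x) hcont
  refine ⟨⟨C, hC0.le⟩, fun r hr u h => ?_⟩
  rw [← hf (⟨r, hr⟩, u)]
  exact ((le_ciSup hbdd (⟨r, hr⟩, u)) h).trans (hC h)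

/-- Uniform boundedness gives one constant for all r ≤ T and all u. The bound serves twice: for L²
right continuity in time and for L² continuity in h. -/
theorem HasCovariance.exists_lintegral_cylIncr_le [CompleteSpace H]
    (hC : HasCovariance P 𝓡 μ lam p N) (T : ℝ≥0) :
    ∃ C : ℝ≥0, ∀ A ∈ 𝓡, ∀ s t, s ≤ t → t ≤ T → ∀ h : H,
      ∫⁻ ω, ‖cylIncr N s t A h ω‖ₑ ^ 2 ∂P ≤ C * ‖h‖ₑ ^ 2 * (μ A * lam (Ioc s t)) := by
  obtain ⟨C, hb⟩ := exists_forall_hilbertSeminorm_le (hC.bounded_form T)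
  refine ⟨C ^ 2, fun A hA s t hst ht h => ?_⟩
  rcases hst.eq_or_lt with rfl | hst
  · refine le_of_eq_of_le ?_ zero_le
    rw [lintegral_eq_zero_of_ae_eq_zero]
    filter_upwards [coeFn_cylIncr (N := N) s s A h] with ω hω
    rw [hω]
    simp
  rw [hC.covariance A hA s t hst h]
  have hle : ∀ r ∈ Ioc s t, ∫⁻ u in A, ENNReal.ofReal (p r u h ^ 2) ∂μ
      ≤ C ^ 2 * ‖h‖ₑ ^ 2 * μ A := by
    intro r hr
    rw [← setLIntegral_const]
    refine lintegral_mono fun u => ?_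
    rw [← mul_pow, ENNReal.ofReal_pow (Real.sqrt_nonneg _)]
    gcongr
    refine (ENNReal.ofReal_le_ofReal (hb r (hr.2.trans ht) u h)).trans ?_
    rw [ENNReal.ofReal_mul NNReal.zero_le_coe, ENNReal.ofReal_coe_nnreal, ofReal_norm]
  refine (setLIntegral_mono measurable_const hle).trans ?_
  rw [setLIntegral_const, ENNReal.coe_pow, mul_assoc]

/-- No path regularity is assumed of the scalar martingales; this L² regularity is what the càdlàg
versions are built from. -/
theorem IsCylMartingaleValuedMeasure.isRightContL2 [CompleteSpace H]
    (hC : HasCovariance P 𝓡 μ lam p N) (hμ : ∀ A ∈ 𝓡, μ A < ∞) (hlam : ∀ t, lam (Iic t) < ∞)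
    {A : Set U} (hA : A ∈ 𝓡) (h : H) (T : ℝ≥0) :
    IsRightContL2 P T fun t => (N t A h : Ω → ℝ) := by
  intro t ht
  obtain ⟨C, hb⟩ := hC.exists_lintegral_cylIncr_le T
  have hlim : Tendsto (fun s => (C * ‖h‖ₑ ^ 2 * μ A) * lam (Ioc t s)) (𝓝[Icc t T] t) (𝓝 0) := by
    have := ENNReal.Tendsto.const_mul (a := C * ‖h‖ₑ ^ 2 * μ A)
      (tendsto_measure_Ioc_nhdsWithin hlam t T)
      (Or.inr (ENNReal.mul_ne_top (ENNReal.mul_ne_top ENNReal.coe_ne_top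
        (ENNReal.pow_ne_top enorm_ne_top)) (hμ A hA).ne))
    rwa [mul_zero] at this
  refine tendsto_of_tendsto_of_tendsto_of_le_of_le' tendsto_const_nhds hlim
    (Eventually.of_forall fun _ => zero_le) ?_
  filter_upwards [self_mem_nhdsWithin] with s hs
  refine le_of_eq_of_le (lintegral_congr_ae ?_) ((hb A hA t s hs.1 hs.2 h).trans_eq
    (mul_assoc _ _ _).symm)
  filter_upwards [coeFn_cylIncr (N := N) t s A h] with ω hω
  rw [hω]

end CovarianceBound

/-! ### Radonification -/

/-- The coordinates of the difference vanish on F, common to both sums, and elsewhere are 0 or ± c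
i. -/
theorem enorm_sum_smul_sub_sq_le {ι G : Type*} [NormedAddCommGroup G] [InnerProductSpace ℝ G]
    (d : HilbertBasis ι ℝ G) (c : ι → ℝ) {F J K : Finset ι} (hJ : F ⊆ J) (hK : F ⊆ K) :
    ‖∑ i ∈ J, c i • d i - ∑ i ∈ K, c i • d i‖ₑ ^ 2 ≤ ∑' i : {i // i ∉ F}, ‖c i‖ₑ ^ 2 := by
  classical
  have h1 : ∀ (L : Finset ι) i, (inner ℝ (∑ j ∈ L, c j • d j) (d i) : ℝ)
      = if i ∈ L then c i else 0 := by
    intro L i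
    simp_rw [sum_inner, inner_smul_left, conj_trivial, orthonormal_iff_ite.1 d.orthonormal]
    simp
  have h2 : ∑' i : {i // i ∉ F}, ‖c i‖ₑ ^ 2
      = ∑' i, {i | i ∉ F}.indicator (fun i => ‖c i‖ₑ ^ 2) i := by
    rw [← tsum_subtype]
    rfl
  rw [enorm_sq_eq_tsum d, h2]
  refine ENNReal.tsum_le_tsum fun i => ?_
  rw [inner_sub_left, h1, h1]
  by_cases hF : i ∈ F
  · simp [hF, hJ hF, hK hF]
  · by_cases h3 : i ∈ J <;> by_cases h4 : i ∈ K <;> simp [hF, h3, h4]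

section Radonification

set_option linter.unusedSectionVars false

variable {Ω U H G : Type*} {mΩ : MeasurableSpace Ω} [NormedAddCommGroup H] [InnerProductSpace ℝ H]
  [CompleteSpace H] [NormedAddCommGroup G] [InnerProductSpace ℝ G] [CompleteSpace G]
  {P : Measure Ω} [IsProbabilityMeasure P] {ℱ : Filtration ℝ≥0 mΩ} {𝓡 : Set (Set U)}
  {N : ℝ≥0 → Set U → H →ₗ[ℝ] (Ω →ₘ[P] ℝ)}
  [MeasurableSpace U] {μ : Measure U} {lam : Measure ℝ≥0}
  {p : ℝ≥0 → U → HilbertSeminorm H} {T : ℝ≥0}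

theorem cylIncr_self (s : ℝ≥0) (A : Set U) (h : H) : cylIncr N s s A h =ᵐ[P] fun _ => 0 := by
  filter_upwards [coeFn_cylIncr (N := N) s s A h] with ω hω
  rw [hω, sub_self]

theorem cylIncr_zero (s t : ℝ≥0) (A : Set U) : cylIncr N s t A 0 =ᵐ[P] fun _ => 0 := by
  have : cylIncr N s t A 0 = 0 := by simp [cylIncr]
  rw [this]
  exact AEEqFun.coeFn_zero

theorem cylIncr_smul (s t : ℝ≥0) (A : Set U) (a : ℝ) (h : H) :
    (fun ω => a * cylIncr N s t A h ω) =ᵐ[P] cylIncr N s t A (a • h) := by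
  have : cylIncr N s t A (a • h) = a • cylIncr N s t A h := by
    simp only [cylIncr, map_smul, smul_sub]
  rw [this]
  filter_upwards [AEEqFun.coeFn_smul a (cylIncr N s t A h)] with ω hω
  rw [hω]
  rfl

theorem cylIncr_sum_smul {ι : Type*} (s t : ℝ≥0) (A : Set U) (J : Finset ι) (a : ι → ℝ)
    (h : ι → H) : (fun ω => ∑ i ∈ J, a i * cylIncr N s t A (h i) ω)
      =ᵐ[P] cylIncr N s t A (∑ i ∈ J, a i • h i) := by
  classical
  induction J using Finset.induction_on with
  | empty =>
    simp only [Finset.sum_empty]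
    exact (cylIncr_zero s t A).symm
  | insert j J hj ih =>
    simp only [Finset.sum_insert hj]
    filter_upwards [ih, cylIncr_smul (N := N) s t A (a j) (h j),
      cylIncr_add (N := N) s t A (a j • h j) (∑ i ∈ J, a i • h i)] with ω h1 h2 h3
    rw [← h3, ← h1, ← h2]

theorem IsCylMartingaleValuedMeasure.isL2Martingale_cylIncr (hℱ : UsualConditions P ℱ)
    (hN : IsCylMartingaleValuedMeasure P ℱ 𝓡 N) {A : Set U} (hA : A ∈ 𝓡) (s t : ℝ≥0) (h : H) :
    IsL2Martingale P ℱ T fun r => (cylIncr N (min s r) (min t r) A h : Ω → ℝ) :=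
  (((hN.isL2Martingale hA h T).stopped t).sub ((hN.isL2Martingale hA h T).stopped s)).congr hℱ
    fun _ _ => (coeFn_cylIncr _ _ A h).symm

theorem HasCovariance.isRightContL2_cylIncr (hN : IsCylMartingaleValuedMeasure P ℱ 𝓡 N)
    (hC : HasCovariance P 𝓡 μ lam p N) (hμ : ∀ A ∈ 𝓡, μ A < ∞) (hlam : ∀ t, lam (Iic t) < ∞)
    {A : Set U} (hA : A ∈ 𝓡) (s t : ℝ≥0) (h : H) :
    IsRightContL2 P T fun r => (cylIncr N (min s r) (min t r) A h : Ω → ℝ) := by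
  have hr := IsCylMartingaleValuedMeasure.isRightContL2 hC hμ hlam hA h T
  exact ((hr.stopped t).sub (hr.stopped s) fun r _ => (hN.memLp _ A hA h).1).congr
    fun _ _ => (coeFn_cylIncr _ _ A h).symm

theorem HasCovariance.exists_lintegral_cylIncr_le' (hC : HasCovariance P 𝓡 μ lam p N)
    (hμ : ∀ A ∈ 𝓡, μ A < ∞) (hlam : ∀ t, lam (Iic t) < ∞) {A : Set U} (hA : A ∈ 𝓡) (T : ℝ≥0) :
    ∃ C : ℝ≥0∞, C ≠ ∞ ∧ ∀ s t, s ≤ t → t ≤ T → ∀ h : H,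
      ∫⁻ ω, ‖cylIncr N s t A h ω‖ₑ ^ 2 ∂P ≤ C * ‖h‖ₑ ^ 2 := by
  obtain ⟨C, hb⟩ := hC.exists_lintegral_cylIncr_le T
  refine ⟨C * (μ A * lam (Iic T)), ENNReal.mul_ne_top ENNReal.coe_ne_top
    (ENNReal.mul_ne_top (hμ A hA).ne (hlam T).ne), fun s t hst ht h => ?_⟩
  refine (hb A hA s t hst ht h).trans ?_
  rw [mul_right_comm]
  gcongr
  exact fun x hx => hx.2.trans ht

variable [SecondCountableTopology G]

/-- Y is the series over a basis of G of the scalar martingales N((s ∧ r, t ∧ r],A)(S* d_i) times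
d_i. Its L² tails are bounded by a constant times the tails of Σ ‖S* d_i‖², so it converges because
S is Hilbert-Schmidt. -/
theorem exists_isRadonification (hℱ : UsualConditions P ℱ)
    (hN : IsCylMartingaleValuedMeasure P ℱ 𝓡 N) (hC : HasCovariance P 𝓡 μ lam p N)
    (hμ : ∀ A ∈ 𝓡, μ A < ∞) (hlam : ∀ t, lam (Iic t) < ∞) {s t : ℝ≥0} (hst : s ≤ t) (ht : t ≤ T)
    {A : Set U} (hA : A ∈ 𝓡) {S : H →L[ℝ] G} (hS : IsHilbertSchmidt S) :
    ∃ Y : ℝ≥0 → Ω → G, IsRadonification P ℱ T N s t A S Y := by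
  obtain ⟨w, d, -⟩ := exists_hilbertBasis ℝ G
  have := d.countable
  obtain ⟨K, hK, hb⟩ := hC.exists_lintegral_cylIncr_le' hμ hlam hA T
  -- Separability makes the basis countable, so a sequence of finite sets exhausts it and sequential
  -- limit theorems apply.
  obtain ⟨J, hJ⟩ := exists_seq_tendsto (atTop : Filter (Finset w))
  have hmin : ∀ r, min s r ≤ min t r := fun r => min_le_min_right r hst
  have hle : ∀ r, min t r ≤ T := fun r => (min_le_left _ _).trans ht
  set c : w → ℝ≥0 → Ω → ℝ := fun i r => cylIncr N (min s r) (min t r) A (S.adjoint (d i))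
  have hcL : ∀ i, IsL2Martingale P ℱ T (c i) := fun i =>
    hN.isL2Martingale_cylIncr hℱ hA s t (S.adjoint (d i))
  have hcR : ∀ i, IsRightContL2 P T (c i) := fun i =>
    hC.isRightContL2_cylIncr hN hμ hlam hA s t (S.adjoint (d i))
  set Z : ℕ → ℝ≥0 → Ω → G := fun n r ω => ∑ i ∈ J n, c i r ω • (d i : G)
  have hZL : ∀ n, IsL2Martingale P ℱ T (Z n) := fun n =>
    IsL2Martingale.sum _ fun i _ => (hcL i).smul_const (d i)
  have hZR : ∀ n, IsRightContL2 P T (Z n) := fun n =>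
    IsRightContL2.sum _ (fun i _ => (hcR i).smul_const (d i))
      fun i _ r hr => (((hcL i).smul_const (d i)).memLp r hr).1
  have hsum : ∑' i, ∫⁻ ω, ‖c i T ω‖ₑ ^ 2 ∂P ≠ ∞ := by
    refine ne_top_of_le_ne_top ?_ (ENNReal.tsum_le_tsum fun i => hb _ _ (hmin T) (hle T) _)
    rw [ENNReal.tsum_mul_left, ← hsNormSq_eq_tsum_adjoint]
    exact ENNReal.mul_ne_top hK hS.ne
  have hCau : Tendsto (fun a : ℕ × ℕ => ∫⁻ ω, ‖Z a.1 T ω - Z a.2 T ω‖ₑ ^ 2 ∂P) atTop (𝓝 0) := by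
    rw [ENNReal.tendsto_nhds_zero]
    intro ε hε
    obtain ⟨F, hF⟩ := ((ENNReal.tendsto_tsum_compl_atTop_zero hsum).eventually
      (ge_mem_nhds hε)).exists
    obtain ⟨n₀, hn₀⟩ := eventually_atTop.1 (hJ.eventually (eventually_ge_atTop F))
    filter_upwards [eventually_ge_atTop (n₀, n₀)] with a ha
    refine (lintegral_mono fun ω => enorm_sum_smul_sub_sq_le d (fun i => c i T ω)
      (hn₀ _ ha.1) (hn₀ _ ha.2)).trans ?_
    rw [lintegral_tsum fun i : {i // i ∉ F} => ((hcL i).memLp T le_rfl).1.enorm.pow_const 2]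
    exact hF
  obtain ⟨X, hX, hXlim⟩ := exists_limit_martingale hℱ hZL hZR hCau
  refine ⟨X, hX, fun r hr g => ?_⟩
  set V : ℕ → H := fun n => S.adjoint (∑ i ∈ J n, (inner ℝ (d i : G) g : ℝ) • (d i : G))
  have hZV : ∀ n, (fun ω => (inner ℝ (Z n r ω) g : ℝ))
      =ᵐ[P] cylIncr N (min s r) (min t r) A (V n) := by
    intro n
    have h1 : V n = ∑ i ∈ J n, (inner ℝ (d i : G) g : ℝ) • S.adjoint (d i) := by
      simp only [V, map_sum, map_smul]
    rw [h1]
    refine EventuallyEq.trans (Eventually.of_forall fun ω => ?_) (cylIncr_sum_smul _ _ A _ _ _)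
    simp only [Z, sum_inner, inner_smul_left, conj_trivial, c]
    exact Finset.sum_congr rfl fun i _ => mul_comm _ _
  have hXr := (hX.memLp r hr)
  have hZr : ∀ n, MemLp (Z n r) 2 P := fun n => (hZL n).memLp r hr
  -- Both sides are L² limits of ⟨Z_n,g⟩: one since Z_n → X, the other since S* applied to the
  -- partial expansions of g tends to S* g.
  refine ae_eq_of_tendsto_lintegral (l := atTop) (X := fun n ω => (inner ℝ (Z n r ω) g : ℝ))
    (fun n => (hZr n).1.inner aestronglyMeasurable_const)
    (hXr.1.inner aestronglyMeasurable_const)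
    (hN.memLp_cylIncr hA (min s r) (min t r) (S.adjoint g)).1 ?_ ?_
  · have hlim := ENNReal.Tendsto.mul_const (b := ‖g‖ₑ ^ 2) (hXlim r hr)
      (Or.inr (ENNReal.pow_ne_top enorm_ne_top))
    rw [zero_mul] at hlim
    refine tendsto_of_tendsto_of_tendsto_of_le_of_le tendsto_const_nhds hlim
      (fun _ => zero_le) fun n => ?_
    rw [← lintegral_mul_const' _ _ (ENNReal.pow_ne_top enorm_ne_top)]
    refine lintegral_mono fun ω => ?_
    rw [← inner_sub_left, ← mul_pow]
    gcongr
    simp only [← ofReal_norm]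
    rw [← ENNReal.ofReal_mul (norm_nonneg _)]
    exact ENNReal.ofReal_le_ofReal (norm_inner_le_norm _ _)
  · have hV : Tendsto (fun n => V n) atTop (𝓝 (S.adjoint g)) := by
      refine (S.adjoint.continuous.tendsto g).comp ?_
      have := (d.hasSum_repr g).comp hJ
      simpa only [HilbertBasis.repr_apply_apply, Function.comp_def] using this
    have hlim : Tendsto (fun n => K * ‖V n - S.adjoint g‖ₑ ^ 2) atTop (𝓝 0) := by
      have h1 : Tendsto (fun n => V n - S.adjoint g) atTop (𝓝 0) := by
        simpa using hV.sub_const (S.adjoint g)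
      have h2 := tendsto_pow_two_zero_iff.2 ((continuous_enorm.tendsto (0 : H)).comp h1 |>.trans
        (by simp))
      simpa using ENNReal.Tendsto.const_mul (a := K) h2 (Or.inr hK)
    refine tendsto_of_tendsto_of_tendsto_of_le_of_le tendsto_const_nhds hlim
      (fun _ => zero_le) fun n => ?_
    refine le_of_eq_of_le (lintegral_congr_ae ?_) (hb _ _ (hmin r) (hle r) (V n - S.adjoint g))
    filter_upwards [hZV n, cylIncr_sub (N := N) (min s r) (min t r) A (V n) (S.adjoint g)]
      with ω h1 h2
    rw [← h2, h1]

end Radonification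

/-! ### The integral of simple integrands -/

section SimpleIntegral

set_option linter.unusedSectionVars false

variable {Ω U H G : Type*} {mΩ : MeasurableSpace Ω} [NormedAddCommGroup H] [InnerProductSpace ℝ H]
  [CompleteSpace H] [NormedAddCommGroup G] [InnerProductSpace ℝ G] [CompleteSpace G]
  [SecondCountableTopology G]
  {P : Measure Ω} [IsProbabilityMeasure P] {ℱ : Filtration ℝ≥0 mΩ} {𝓡 : Set (Set U)}
  {N : ℝ≥0 → Set U → H →ₗ[ℝ] (Ω →ₘ[P] ℝ)}
  [MeasurableSpace U] {μ : Measure U} {lam : Measure ℝ≥0}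
  {p : ℝ≥0 → U → HilbertSeminorm H} {T : ℝ≥0}

namespace IsRadonification

variable {s t : ℝ≥0} {A : Set U} {S : H →L[ℝ] G} {Y : ℝ≥0 → Ω → G}

theorem zero : IsRadonification P ℱ T N s t A (0 : H →L[ℝ] G) fun _ _ => 0 where
  martingale := IsCadlagSqIntMartingale.zero
  inner_eq r hr g := by
    have h := (cylIncr_zero (N := N) (min s r) (min t r) A).symm
    simpa only [cylIncr, inner_zero_left, map_zero, _root_.zero_apply] using h

theorem neg (hY : IsRadonification P ℱ T N s t A S Y) :
    IsRadonification P ℱ T N s t A (-S) fun r ω => - Y r ω where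
  martingale := hY.martingale.neg
  inner_eq r hr g := by
    simp only [inner_neg_left, map_neg, _root_.neg_apply]
    have h0 := cylIncr_smul (N := N) (min s r) (min t r) A (-1) (S.adjoint g)
    simp only [cylIncr, neg_one_smul, map_neg] at h0
    filter_upwards [hY.inner_eq r hr g, h0] with ω h1 h2
    rw [h1, ← h2]
    ring

theorem ae_eq_zero (hY : IsRadonification P ℱ T N s t A S Y) (hst : s ≤ t) {r : ℝ≥0}
    (hrs : r ≤ s) (hr : r ≤ T) : Y r =ᵐ[P] fun _ => 0 := by
  refine ae_eq_zero_of_forall_inner (𝕜 := ℝ) fun g => ?_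
  have h := hY.inner_eq r hr g
  rw [min_eq_right hrs, min_eq_right (hrs.trans hst)] at h
  filter_upwards [h, cylIncr_self (N := N) r A (S.adjoint g)] with ω h1 h2
  rw [real_inner_comm, h1, h2]
  rfl

/-- The event is known only from time s on, but Y vanishes almost surely before s, so nothing is
lost; orthogonality is tested with 1_F V at times not before s. -/
theorem isL2Martingale_indicator (hℱ : UsualConditions P ℱ)
    (hY : IsRadonification P ℱ T N s t A S Y) (hst : s ≤ t) (hsT : s ≤ T) {F : Set Ω}
    (hF : MeasurableSet[ℱ s] F) : IsL2Martingale P ℱ T fun r => F.indicator (Y r) := by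
  have hL := hY.martingale.isL2Martingale
  have hF' := ℱ.le s _ hF
  have hmax : ∀ a ≤ T, Y a =ᵐ[P] Y (max a s) := by
    intro a ha
    rcases le_total s a with h | h
    · rw [max_eq_left h]
    · rw [max_eq_right h]
      exact (hY.ae_eq_zero hst h ha).trans (hY.ae_eq_zero hst le_rfl hsT).symm
  refine ⟨fun a ha => ?_, fun a ha => (hL.memLp a ha).indicator hF', fun a b hab hb V hV hV2 => ?_⟩
  · rcases le_total s a with h | h
    · exact (hL.adapted a ha).indicator (ℱ.mono h _ hF)
    · refine hℱ.stronglyMeasurable_congr (X := fun _ => 0) stronglyMeasurable_const ?_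
      filter_upwards [hY.ae_eq_zero hst h ha] with ω hω
      simp [indicator, hω]
  · have hV' : StronglyMeasurable[ℱ (max a s)] (F.indicator V) :=
      (hV.mono (ℱ.mono (le_max_left _ _))).indicator (ℱ.mono (le_max_right _ _) _ hF)
    rw [← hL.orthogonal (max a s) (max b s) (max_le_max_right s hab) (max_le hb hsT)
      (F.indicator V) hV' (hV2.indicator hF')]
    refine integral_congr_ae ?_
    filter_upwards [hmax a (hab.trans hb), hmax b hb] with ω h1 h2
    by_cases hω : ω ∈ F
    · simp [hω, h1, h2]
    · simp [hω]

theorem isCadlagSqIntMartingale_indicator (hℱ : UsualConditions P ℱ)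
    (hY : IsRadonification P ℱ T N s t A S Y) (hst : s ≤ t) (hsT : s ≤ T) {F : Set Ω}
    (hF : MeasurableSet[ℱ s] F) : IsCadlagSqIntMartingale P ℱ T fun r => F.indicator (Y r) := by
  refine (hY.isL2Martingale_indicator hℱ hst hsT hF).isCadlagSqIntMartingale ?_
  filter_upwards [hY.martingale.cadlag] with ω hω
  by_cases h : ω ∈ F
  · simpa [h] using hω
  · simpa [h] using CadlagOn.zero

end IsRadonification

theorem IsCadlagSqIntMartingale.sum {ι : Type*} {X : ι → ℝ≥0 → Ω → G} (s : Finset ι)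
    (h : ∀ i ∈ s, IsCadlagSqIntMartingale P ℱ T (X i)) :
    IsCadlagSqIntMartingale P ℱ T fun t ω => ∑ i ∈ s, X i t ω := by
  classical
  induction s using Finset.induction_on with
  | empty => simpa using IsCadlagSqIntMartingale.zero
  | insert a s ha ih =>
    simp only [Finset.sum_insert ha]
    exact (h a (Finset.mem_insert_self _ _)).add
      (ih fun i hi => h i (Finset.mem_insert_of_mem hi))

theorem CadlagOn.congr {x y : ℝ≥0 → G} (hx : CadlagOn T x) (h : ∀ t ≤ T, x t = y t) :
    CadlagOn T y := fun t ht => by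
  obtain ⟨l, hl⟩ := (hx t ht).2
  refine ⟨(hx t ht).1.congr (fun s hs => (h s hs.2).symm) (h t ht).symm, l, hl.congr' ?_⟩
  filter_upwards [self_mem_nhdsWithin] with s hs
  exact h s ((mem_Iio.1 hs).le.trans ht)

theorem IsCadlagSqIntMartingale.congr {X Y : ℝ≥0 → Ω → G}
    (hX : IsCadlagSqIntMartingale P ℱ T X) (hℱ : UsualConditions P ℱ)
    (h : ∀ t ≤ T, ∀ ω, X t ω = Y t ω) : IsCadlagSqIntMartingale P ℱ T Y := by
  refine (hX.isL2Martingale.congr hℱ fun t ht => ae_of_all _ (h t ht)).isCadlagSqIntMartingale ?_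
  filter_upwards [hX.cadlag] with ω hω
  exact hω.congr fun t ht => h t ht ω

namespace IsSimpleIntegral

variable {Ψ Ψ' : SimpleIntegrand ℱ 𝓡 T H G} {Z Z' : ℝ≥0 → Ω → G}

theorem isCadlagSqIntMartingale (hℱ : UsualConditions P ℱ)
    (hZ : IsSimpleIntegral P ℱ 𝓡 T N Ψ Z) : IsCadlagSqIntMartingale P ℱ T Z := by
  obtain ⟨Y, hY, hZY⟩ := hZ
  have h : IsCadlagSqIntMartingale P ℱ T
      fun t ω => ∑ i, ∑ j, (Ψ.F i).indicator (Y i j t) ω :=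
    IsCadlagSqIntMartingale.sum _ fun i _ => IsCadlagSqIntMartingale.sum _ fun j _ =>
      (hY i j).isCadlagSqIntMartingale_indicator hℱ (Ψ.s_lt_t i).le
        ((Ψ.s_lt_t i).le.trans (Ψ.t_le i)) (Ψ.measurable_F i)
  exact h.congr hℱ fun t ht ω => (hZY t ht ω).symm

/-- Concatenated data make the integral additive term by term, so independence of the representation
never has to be proved. -/
theorem sub (hZ : IsSimpleIntegral P ℱ 𝓡 T N Ψ Z) (hZ' : IsSimpleIntegral P ℱ 𝓡 T N Ψ' Z') :
    IsSimpleIntegral P ℱ 𝓡 T N (Ψ.sub Ψ') fun t ω => Z t ω - Z' t ω := by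
  obtain ⟨Y, hY, hZY⟩ := hZ
  obtain ⟨Y', hY', hZY'⟩ := hZ'
  refine ⟨Fin.append (fun i => Fin.append (Y i) fun _ _ _ => 0)
    fun i => Fin.append (fun _ _ _ => 0) fun j r ω => - Y' i j r ω, fun i j => ?_,
    fun t ht ω => ?_⟩
  · refine Fin.addCases (fun i => ?_) (fun i => ?_) i <;>
      refine Fin.addCases (fun j => ?_) (fun j => ?_) j <;>
      simp only [SimpleIntegrand.sub, Fin.append_left, Fin.append_right]
    · exact hY i j
    · exact IsRadonification.zero
    · exact IsRadonification.zero
    · exact (hY' i j).neg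
  · change Z t ω - Z' t ω = ∑ i : Fin (Ψ.n + Ψ'.n), ∑ j : Fin (Ψ.m + Ψ'.m),
      (Fin.append Ψ.F Ψ'.F i).indicator (Fin.append (fun i => Fin.append (Y i) fun _ _ _ => 0)
        (fun i => Fin.append (fun _ _ _ => 0) fun j r ω => - Y' i j r ω) i j t) ω
    rw [hZY t ht, hZY' t ht, Fin.sum_univ_add]
    simp only [Fin.sum_univ_add, Fin.append_left, Fin.append_right]
    have e : ∀ i j, (Ψ'.F i).indicator (fun ω => - Y' i j t ω) ω
        = - (Ψ'.F i).indicator (Y' i j t) ω := fun i j => by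
      by_cases h : ω ∈ Ψ'.F i <;> simp [h]
    simp only [e, indicator_zero, Finset.sum_const_zero, add_zero, zero_add,
      Finset.sum_neg_distrib, sub_eq_add_neg]

end IsSimpleIntegral

theorem SimpleIntegrand.exists_isSimpleIntegral (hℱ : UsualConditions P ℱ)
    (hN : IsCylMartingaleValuedMeasure P ℱ 𝓡 N) (hC : HasCovariance P 𝓡 μ lam p N)
    (hμ : ∀ A ∈ 𝓡, μ A < ∞) (hlam : ∀ t, lam (Iic t) < ∞) (Ψ : SimpleIntegrand ℱ 𝓡 T H G) :
    ∃ Z : ℝ≥0 → Ω → G, IsSimpleIntegral P ℱ 𝓡 T N Ψ Z := by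
  have h := fun i j => exists_isRadonification hℱ hN hC hμ hlam (Ψ.s_lt_t i).le (Ψ.t_le i)
    (Ψ.A_mem j) (Ψ.S_hs i j)
  choose Y hY using h
  exact ⟨fun t ω => ∑ i, ∑ j, (Ψ.F i).indicator (Y i j t) ω, Y, hY, fun _ _ _ => rfl⟩

/-- For fixed g the adjoint takes values in the image of H, so each coordinate of the
Hilbert-Schmidt norm is the seminorm of a combination of boxes, as in the scalar isometry. -/
theorem SimpleIntegrand.adjoint_toFamily (Ψ : SimpleIntegrand ℱ 𝓡 T H G)
    (z : Ω × ℝ≥0 × U) (g : G) :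
    (Ψ.toFamily p z.2.1 z.1 z.2.2).adjoint g
      = (p z.2.1 z.2.2).incl (∑ x : Fin Ψ.n × Fin Ψ.m,
        boxWeight (Ioc (Ψ.s x.1) (Ψ.t x.1)) (Ψ.F x.1) (Ψ.A x.2) z • (Ψ.S x.1 x.2).adjoint g) := by
  simp only [toFamily, map_sum, map_smulₛₗ, _root_.sum_apply, _root_.smul_apply, conj_trivial,
    ContinuousLinearMap.adjoint_comp, ContinuousLinearMap.adjoint_adjoint,
    ContinuousLinearMap.comp_apply, Fintype.sum_prod_type, RingHom.id_apply]
  rfl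

variable [SFinite lam] [SFinite μ] [SecondCountableTopology H]

/-- The isometry for the integral of simple integrands. -/
theorem IsSimpleIntegral.lintegral_sq (hℱ : UsualConditions P ℱ) (h𝓡 : IsSetRing 𝓡)
    (h𝓡_meas : ∀ A ∈ 𝓡, MeasurableSet A) (hμ : ∀ A ∈ 𝓡, μ A < ∞) (hlam : ∀ t, lam (Iic t) < ∞)
    (hN : IsCylMartingaleValuedMeasure P ℱ 𝓡 N) (hI : IncrementsIndepPast P ℱ 𝓡 N)
    (hC : HasCovariance P 𝓡 μ lam p N) {Ψ : SimpleIntegrand ℱ 𝓡 T H G} {Z : ℝ≥0 → Ω → G}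
    (hZ : IsSimpleIntegral P ℱ 𝓡 T N Ψ Z) :
    ∫⁻ ω, ‖Z T ω‖ₑ ^ 2 ∂P = lambdaNormSq P μ lam T p (Ψ.toFamily p) := by
  obtain ⟨w, d, -⟩ := exists_hilbertBasis ℝ G
  have := d.countable
  have hZm := ((hZ.isCadlagSqIntMartingale hℱ).memLp T le_rfl).1
  have hΨ := Ψ.isPredictableFamily (q := p) h𝓡_meas hC.measurable_form
  obtain ⟨Y, hY, hZY⟩ := hZ
  -- Coordinates of the integral are sums of scalar increments times indicators; at the terminal
  -- time the minima with T disappear.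
  have hcoord : ∀ k, (fun ω => (inner ℝ (Z T ω) (d k : G) : ℝ)) =ᵐ[P]
      fun ω => ∑ x : Fin Ψ.n × Fin Ψ.m, (Ψ.F x.1).indicator
        (cylIncr N (Ψ.s x.1) (Ψ.t x.1) (Ψ.A x.2) ((Ψ.S x.1 x.2).adjoint (d k))) ω := by
    intro k
    have h : ∀ i j, (fun ω => (inner ℝ (Y i j T ω) (d k : G) : ℝ)) =ᵐ[P]
        cylIncr N (Ψ.s i) (Ψ.t i) (Ψ.A j) ((Ψ.S i j).adjoint (d k)) := fun i j => by
      have := (hY i j).inner_eq T le_rfl (d k)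
      rwa [min_eq_left (Ψ.t_le i), min_eq_left ((Ψ.s_lt_t i).le.trans (Ψ.t_le i))] at this
    have h' := eventually_all.2 fun i => eventually_all.2 fun j => h i j
    filter_upwards [h'] with ω hω
    rw [hZY T le_rfl ω, Fintype.sum_prod_type]
    simp_rw [sum_inner]
    refine Finset.sum_congr rfl fun i _ => Finset.sum_congr rfl fun j _ => ?_
    by_cases hF : ω ∈ Ψ.F i
    · simp only [indicator_of_mem hF]
      exact hω i j
    · simp only [indicator_of_notMem hF, inner_zero_left]
  have hmz : ∀ k, Measurable fun z : Ω × ℝ≥0 × U => ENNReal.ofReal (p z.2.1 z.2.2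
      (∑ x : Fin Ψ.n × Fin Ψ.m, boxWeight (Ioc (Ψ.s x.1) (Ψ.t x.1)) (Ψ.F x.1) (Ψ.A x.2) z •
        (Ψ.S x.1 x.2).adjoint (d k)) ^ 2) := by
    intro k
    refine ENNReal.measurable_ofReal.comp ?_
    simp_rw [HilbertSeminorm.sq_sum_smul, boxWeight_eq_indicator]
    have hb : ∀ x : Fin Ψ.n × Fin Ψ.m, Measurable (((Ψ.F x.1) ×ˢ ((Ioc (Ψ.s x.1) (Ψ.t x.1)) ×ˢ
        (Ψ.A x.2))).indicator (1 : Ω × ℝ≥0 × U → ℝ)) := fun x =>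
      measurable_one.indicator ((ℱ.le _ _ (Ψ.measurable_F x.1)).prod
        (measurableSet_Ioc.prod (h𝓡_meas _ (Ψ.A_mem x.2))))
    exact Finset.measurable_fun_sum _ fun x _ => Finset.measurable_fun_sum _ fun y _ =>
      ((hb x).mul (hb y)).mul ((hC.measurable_form _ _).comp measurable_snd)
  rw [lambdaNormSq_eq_lintegral_prod hC.measurable_form hΨ]
  simp_rw [fun ω => enorm_sq_eq_tsum d (Z T ω)]
  rw [lintegral_tsum fun k => (hZm.inner aestronglyMeasurable_const).enorm.pow_const 2]
  have hhs : ∀ z : Ω × ℝ≥0 × U, hsNormSq (Ψ.toFamily p z.2.1 z.1 z.2.2)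
      = ∑' k, ENNReal.ofReal (p z.2.1 z.2.2 (∑ x : Fin Ψ.n × Fin Ψ.m,
        boxWeight (Ioc (Ψ.s x.1) (Ψ.t x.1)) (Ψ.F x.1) (Ψ.A x.2) z •
          (Ψ.S x.1 x.2).adjoint (d k)) ^ 2) := by
    intro z
    rw [hsNormSq_eq_tsum_adjoint _ d]
    refine tsum_congr fun k => ?_
    rw [Ψ.adjoint_toFamily, enorm_sq_eq_ofReal, HilbertSeminorm.norm_incl]
  simp_rw [hhs]
  rw [lintegral_tsum fun k => (hmz k).aemeasurable]
  refine tsum_congr fun k => ?_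
  rw [← lintegral_sum_indicator_cylIncr_sq hℱ h𝓡 h𝓡_meas hμ hlam hN hI hC
    (fun x : Fin Ψ.n × Fin Ψ.m => (Ψ.S x.1 x.2).adjoint (d k)) (fun x => Ψ.s_lt_t x.1)
    (fun x => Ψ.t_le x.1) (fun x => Ψ.measurable_F x.1) fun x => Ψ.A_mem x.2]
  refine lintegral_congr_ae ?_
  filter_upwards [hcoord k] with ω hω
  rw [hω]

end SimpleIntegral

/-! ### Stochastic integrals -/

section CompInclAdjoint

set_option linter.unusedSectionVars false

variable {Ω U H G : Type*} {mΩ : MeasurableSpace Ω} [NormedAddCommGroup H] [InnerProductSpace ℝ H]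
  [CompleteSpace H] [SecondCountableTopology H]
  [NormedAddCommGroup G] [InnerProductSpace ℝ G] [CompleteSpace G]
  {P : Measure Ω} {ℱ : Filtration ℝ≥0 mΩ} {𝓡 : Set (Set U)}
  [MeasurableSpace U] {μ : Measure U} {lam : Measure ℝ≥0}
  {p q : ℝ≥0 → U → HilbertSeminorm H} {T : ℝ≥0}

theorem hsNormSq_comp_inclLE_adjoint_le (p q : HilbertSeminorm H) (hpq : ∀ h, p h ≤ q h)
    (S : q.Space →L[ℝ] G) :
    hsNormSq (S.comp (HilbertSeminorm.inclLE p q hpq).adjoint) ≤ hsNormSq S := by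
  refine (hsNormSq_comp_le _ _).trans ?_
  have h1 : ‖(HilbertSeminorm.inclLE p q hpq).adjoint‖ₑ ≤ 1 := by
    rw [← ofReal_norm, LinearIsometryEquiv.norm_map]
    exact ENNReal.ofReal_le_one.2 (HilbertSeminorm.norm_inclLE_le p q hpq)
  calc _ ≤ 1 ^ 2 * hsNormSq S := by gcongr
    _ = hsNormSq S := by rw [one_pow, one_mul]

theorem lambdaNormSq_compInclAdjoint_le (hpq : ∀ r u h, p r u h ≤ q r u h) (Φ : OpFamily Ω G q) :
    lambdaNormSq P μ lam T p (Φ.compInclAdjoint p hpq) ≤ lambdaNormSq P μ lam T q Φ :=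
  lintegral_mono fun _ => lintegral_mono fun _ => lintegral_mono fun _ =>
    hsNormSq_comp_inclLE_adjoint_le _ _ _ _

/-- This transfers approximation: data good for Φ under q are, unchanged, at least as good for Φ ∘
i_{p,q}* under p. -/
theorem lambdaNormSq_toFamily_sub_compInclAdjoint_le (hpq : ∀ r u h, p r u h ≤ q r u h)
    (Φ : OpFamily Ω G q) (Ψ : SimpleIntegrand ℱ 𝓡 T H G) :
    lambdaNormSq P μ lam T p
        (fun r ω u => Ψ.toFamily p r ω u - Φ.compInclAdjoint p hpq r ω u)
      ≤ lambdaNormSq P μ lam T q (fun r ω u => Ψ.toFamily q r ω u - Φ r ω u) := by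
  refine le_of_eq_of_le ?_ (lambdaNormSq_compInclAdjoint_le hpq _)
  congr 1
  funext r ω u
  rw [← Ψ.toFamily_comp_inclLE_adjoint p q hpq, OpFamily.compInclAdjoint, OpFamily.compInclAdjoint,
    ContinuousLinearMap.sub_comp]

theorem IsPredictableFamily.compInclAdjoint
    (hqm : ∀ h₁ h₂, Measurable fun x : ℝ≥0 × U => (q x.1 x.2).form h₁ h₂)
    (hpm : ∀ h₁ h₂, Measurable fun x : ℝ≥0 × U => (p x.1 x.2).form h₁ h₂)
    (hpq : ∀ r u h, p r u h ≤ q r u h) {Φ : OpFamily Ω G q} (hΦ : IsPredictableFamily ℱ T q Φ) :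
    IsPredictableFamily ℱ T p (Φ.compInclAdjoint p hpq) :=
  IsWeaklyMeasurable.comp_inclLE_adjoint (measurable_form_predDomain hqm)
    (measurable_form_predDomain hpm) (fun x => hpq x.1.1 x.2) hΦ

theorem MemLambda2.compInclAdjoint
    (hqm : ∀ h₁ h₂, Measurable fun x : ℝ≥0 × U => (q x.1 x.2).form h₁ h₂)
    (hpm : ∀ h₁ h₂, Measurable fun x : ℝ≥0 × U => (p x.1 x.2).form h₁ h₂)
    (hpq : ∀ r u h, p r u h ≤ q r u h) {Φ : OpFamily Ω G q} (hΦ : MemLambda2 P ℱ μ lam T q Φ) :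
    MemLambda2 P ℱ μ lam T p (Φ.compInclAdjoint p hpq) where
  isHilbertSchmidt r hr ω u :=
    (hsNormSq_comp_inclLE_adjoint_le _ _ _ _).trans_lt (hΦ.isHilbertSchmidt r hr ω u)
  predictable := IsPredictableFamily.compInclAdjoint hqm hpm hpq hΦ.predictable
  norm_lt_top := (lambdaNormSq_compInclAdjoint_le hpq Φ).trans_lt hΦ.norm_lt_top

end CompInclAdjoint

/-! ### Additivity of simple integrals in the integrator -/

section SumOfMeasures

set_option linter.unusedSectionVars false

variable {Ω U H G : Type*} {mΩ : MeasurableSpace Ω} [NormedAddCommGroup H] [InnerProductSpace ℝ H]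
  [CompleteSpace H] [NormedAddCommGroup G] [InnerProductSpace ℝ G] [CompleteSpace G]
  [SecondCountableTopology G]
  {P : Measure Ω} [IsProbabilityMeasure P] {ℱ : Filtration ℝ≥0 mΩ} {𝓡 : Set (Set U)}
  {N N₁ N₂ M : ℝ≥0 → Set U → H →ₗ[ℝ] (Ω →ₘ[P] ℝ)} {T : ℝ≥0}

theorem cylIncr_sum_measure (hM : ∀ t, ∀ A ∈ 𝓡, M t A = N₁ t A + N₂ t A) {A : Set U} (hA : A ∈ 𝓡)
    (s t : ℝ≥0) (h : H) :
    cylIncr M s t A h =ᵐ[P] fun ω => cylIncr N₁ s t A h ω + cylIncr N₂ s t A h ω := by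
  have e : cylIncr M s t A h = cylIncr N₁ s t A h + cylIncr N₂ s t A h := by
    simp only [cylIncr, hM _ A hA, LinearMap.add_apply]
    abel
  rw [e]
  exact AEEqFun.coeFn_add _ _

theorem IsRadonification.ae_eq {s t : ℝ≥0} {A : Set U} {S : H →L[ℝ] G} {Y Y' : ℝ≥0 → Ω → G}
    (hY : IsRadonification P ℱ T N s t A S Y) (hY' : IsRadonification P ℱ T N s t A S Y')
    {r : ℝ≥0} (hr : r ≤ T) : Y r =ᵐ[P] Y' r := by
  have h : (fun ω => Y r ω - Y' r ω) =ᵐ[P] 0 := by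
    refine ae_eq_zero_of_forall_inner (𝕜 := ℝ) fun g => ?_
    filter_upwards [hY.inner_eq r hr g, hY'.inner_eq r hr g] with ω h1 h2
    rw [real_inner_comm, inner_sub_left, h1, h2, sub_self]
    rfl
  filter_upwards [h] with ω hω
  exact sub_eq_zero.1 hω

theorem IsRadonification.add_measure (hM : ∀ t, ∀ A ∈ 𝓡, M t A = N₁ t A + N₂ t A) {s t : ℝ≥0}
    {A : Set U} (hA : A ∈ 𝓡) {S : H →L[ℝ] G} {Y Y' : ℝ≥0 → Ω → G}
    (hY : IsRadonification P ℱ T N₁ s t A S Y) (hY' : IsRadonification P ℱ T N₂ s t A S Y') :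
    IsRadonification P ℱ T M s t A S fun r ω => Y r ω + Y' r ω where
  martingale := hY.martingale.add hY'.martingale
  inner_eq r hr g := by
    filter_upwards [hY.inner_eq r hr g, hY'.inner_eq r hr g,
      cylIncr_sum_measure hM hA (min s r) (min t r) (S.adjoint g)] with ω h1 h2 h3
    rw [inner_add_left, h1, h2]
    exact h3.symm

theorem IsSimpleIntegral.ae_eq {Ψ : SimpleIntegrand ℱ 𝓡 T H G} {Z Z' : ℝ≥0 → Ω → G}
    (hZ : IsSimpleIntegral P ℱ 𝓡 T N Ψ Z) (hZ' : IsSimpleIntegral P ℱ 𝓡 T N Ψ Z') {t : ℝ≥0}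
    (ht : t ≤ T) : Z t =ᵐ[P] Z' t := by
  obtain ⟨Y, hY, hZY⟩ := hZ
  obtain ⟨Y', hY', hZY'⟩ := hZ'
  filter_upwards [eventually_all.2 fun i => eventually_all.2 fun j =>
    (hY i j).ae_eq (hY' i j) ht] with ω hω
  rw [hZY t ht, hZY' t ht]
  refine Finset.sum_congr rfl fun i _ => Finset.sum_congr rfl fun j _ => ?_
  by_cases hF : ω ∈ Ψ.F i
  · simp [hF, hω i j]
  · simp [hF]

theorem IsSimpleIntegral.add_measure (hM : ∀ t, ∀ A ∈ 𝓡, M t A = N₁ t A + N₂ t A)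
    {Ψ : SimpleIntegrand ℱ 𝓡 T H G} {Z Z' : ℝ≥0 → Ω → G}
    (hZ : IsSimpleIntegral P ℱ 𝓡 T N₁ Ψ Z) (hZ' : IsSimpleIntegral P ℱ 𝓡 T N₂ Ψ Z') :
    IsSimpleIntegral P ℱ 𝓡 T M Ψ fun t ω => Z t ω + Z' t ω := by
  obtain ⟨Y, hY, hZY⟩ := hZ
  obtain ⟨Y', hY', hZY'⟩ := hZ'
  refine ⟨fun i j r ω => Y i j r ω + Y' i j r ω,
    fun i j => (hY i j).add_measure hM (Ψ.A_mem j) (hY' i j), fun t ht ω => ?_⟩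
  change Z t ω + Z' t ω = _
  rw [hZY t ht, hZY' t ht]
  simp only [← Finset.sum_add_distrib]
  refine Finset.sum_congr rfl fun i _ => Finset.sum_congr rfl fun j _ => ?_
  by_cases hF : ω ∈ Ψ.F i <;> simp [hF]

theorem IsCadlagSqIntMartingale.supNormSq_sub_le {X Y : ℝ≥0 → Ω → G}
    (hX : IsCadlagSqIntMartingale P ℱ T X) (hY : IsCadlagSqIntMartingale P ℱ T Y) :
    supNormSq P T (fun t ω => X t ω - Y t ω) ≤ 4 * ∫⁻ ω, ‖X T ω - Y T ω‖ₑ ^ 2 ∂P :=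
  (hX.sub hY).isL2Martingale.supNormSq_le (hX.sub hY).cadlag

theorem lintegral_le_supNormSq (X : ℝ≥0 → Ω → G) :
    ∫⁻ ω, ‖X T ω‖ₑ ^ 2 ∂P ≤ supNormSq P T X :=
  lintegral_mono fun ω => le_iSup₂ (f := fun t (_ : t ∈ Iic T) => ‖X t ω‖ₑ ^ 2) T self_mem_Iic

end SumOfMeasures

/-! ### Existence and uniqueness of limits by the isometry -/

section StochasticIntegral

set_option linter.unusedSectionVars false

variable {Ω U H G : Type*} {mΩ : MeasurableSpace Ω} [NormedAddCommGroup H] [InnerProductSpace ℝ H]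
  [CompleteSpace H] [SecondCountableTopology H]
  [NormedAddCommGroup G] [InnerProductSpace ℝ G] [CompleteSpace G]
  [SecondCountableTopology G]
  {P : Measure Ω} [IsProbabilityMeasure P] {ℱ : Filtration ℝ≥0 mΩ} {𝓡 : Set (Set U)}
  {N : ℝ≥0 → Set U → H →ₗ[ℝ] (Ω →ₘ[P] ℝ)}
  [MeasurableSpace U] {μ : Measure U} {lam : Measure ℝ≥0}
  {p : ℝ≥0 → U → HilbertSeminorm H} {T : ℝ≥0} [SFinite lam] [SFinite μ]
  (hℱ : UsualConditions P ℱ) (h𝓡 : IsSetRing 𝓡) (h𝓡_meas : ∀ A ∈ 𝓡, MeasurableSet A)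
  (hμ : ∀ A ∈ 𝓡, μ A < ∞) (hlam : ∀ t, lam (Iic t) < ∞)
  (hN : IsCylMartingaleValuedMeasure P ℱ 𝓡 N) (hI : IncrementsIndepPast P ℱ 𝓡 N)
  (hC : HasCovariance P 𝓡 μ lam p N)

include hℱ h𝓡 h𝓡_meas hμ hlam hN hI hC

/-- Two simple integrals are close at the terminal time if their integrands are close to the same
family. -/
theorem IsSimpleIntegral.lintegral_sub_sq_le {Φ : OpFamily Ω G p}
    (hΦ : IsPredictableFamily ℱ T p Φ) {Ψ Ψ' : SimpleIntegrand ℱ 𝓡 T H G} {Z Z' : ℝ≥0 → Ω → G}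
    (hZ : IsSimpleIntegral P ℱ 𝓡 T N Ψ Z) (hZ' : IsSimpleIntegral P ℱ 𝓡 T N Ψ' Z') :
    ∫⁻ ω, ‖Z T ω - Z' T ω‖ₑ ^ 2 ∂P
      ≤ 2 * lambdaNormSq P μ lam T p (fun r ω u => Ψ.toFamily p r ω u - Φ r ω u)
      + 2 * lambdaNormSq P μ lam T p (fun r ω u => Ψ'.toFamily p r ω u - Φ r ω u) := by
  rw [(hZ.sub hZ').lintegral_sq hℱ h𝓡 h𝓡_meas hμ hlam hN hI hC]
  have e : (Ψ.sub Ψ').toFamily p = fun r ω u => Ψ.toFamily p r ω u - Ψ'.toFamily p r ω u := by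
    funext r ω u
    exact SimpleIntegrand.toFamily_sub Ψ Ψ' p r ω u
  rw [e, lambdaNormSq_sub_comm (Ψ'.toFamily p) Φ]
  exact lambdaNormSq_sub_triangle hC.measurable_form
    (Ψ.isPredictableFamily h𝓡_meas hC.measurable_form) hΦ
    (Ψ'.isPredictableFamily h𝓡_meas hC.measurable_form)

/-- The isometry turns convergence of the integrands into the Cauchy property of the integrals at
time T. -/
theorem exists_limit_simpleIntegral {Φ : OpFamily Ω G p}
    (hΦ : IsPredictableFamily ℱ T p Φ) {Ψ : ℕ → SimpleIntegrand ℱ 𝓡 T H G}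
    (hΨ : Tendsto (fun k => lambdaNormSq P μ lam T p
      (fun r ω u => (Ψ k).toFamily p r ω u - Φ r ω u)) atTop (𝓝 0)) {Z : ℕ → ℝ≥0 → Ω → G}
    (hZ : ∀ k, IsSimpleIntegral P ℱ 𝓡 T N (Ψ k) (Z k)) :
    ∃ X : ℝ≥0 → Ω → G, IsCadlagSqIntMartingale P ℱ T X ∧
      Tendsto (fun k => ∫⁻ ω, ‖Z k T ω - X T ω‖ₑ ^ 2 ∂P) atTop (𝓝 0) := by
  have hZc := fun k => (hZ k).isCadlagSqIntMartingale hℱ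
  have hCau : Tendsto (fun a : ℕ × ℕ => ∫⁻ ω, ‖Z a.1 T ω - Z a.2 T ω‖ₑ ^ 2 ∂P) atTop (𝓝 0) := by
    have h2 := ENNReal.Tendsto.const_mul (a := 2) hΨ (Or.inr ENNReal.ofNat_ne_top)
    rw [mul_zero] at h2
    have hfst : Tendsto (Prod.fst : ℕ × ℕ → ℕ) atTop atTop := by
      rw [← prod_atTop_atTop_eq]; exact tendsto_fst
    have hsnd : Tendsto (Prod.snd : ℕ × ℕ → ℕ) atTop atTop := by
      rw [← prod_atTop_atTop_eq]; exact tendsto_snd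
    have h3 := (h2.comp hfst).add (h2.comp hsnd)
    rw [add_zero] at h3
    exact tendsto_of_tendsto_of_tendsto_of_le_of_le tendsto_const_nhds h3 (fun _ => zero_le)
      fun a => IsSimpleIntegral.lintegral_sub_sq_le hℱ h𝓡 h𝓡_meas hμ hlam hN hI hC hΦ
        (hZ a.1) (hZ a.2)
  obtain ⟨X, hX, hlim⟩ := exists_limit_martingale hℱ (fun k => (hZc k).isL2Martingale)
    (fun k => (hZc k).isRightContL2) hCau
  exact ⟨X, hX, hlim T le_rfl⟩

/-- The simple integrals of any approximating sequence converge to the stochastic integral. -/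
theorem IsStochasticIntegral.tendsto_simpleIntegral {Φ : OpFamily Ω G p}
    (hΦ : IsPredictableFamily ℱ T p Φ) {X : ℝ≥0 → Ω → G}
    (hX : IsStochasticIntegral P ℱ 𝓡 μ lam T p N Φ X) {Ψ : ℕ → SimpleIntegrand ℱ 𝓡 T H G}
    (hΨ : Tendsto (fun k => lambdaNormSq P μ lam T p
      (fun r ω u => (Ψ k).toFamily p r ω u - Φ r ω u)) atTop (𝓝 0)) {Z : ℕ → ℝ≥0 → Ω → G}
    (hZ : ∀ k, IsSimpleIntegral P ℱ 𝓡 T N (Ψ k) (Z k)) :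
    Tendsto (fun k => ∫⁻ ω, ‖Z k T ω - X T ω‖ₑ ^ 2 ∂P) atTop (𝓝 0) := by
  obtain ⟨hXc, Ψ', Z', hZ', hΨ', hlim⟩ := hX
  have h2 := fun {f : ℕ → ℝ≥0∞} (hf : Tendsto f atTop (𝓝 0)) =>
    ENNReal.Tendsto.const_mul (a := 2) hf (Or.inr ENNReal.ofNat_ne_top)
  -- The given simple integrals are compared with those defining X through the isometry, and the
  -- latter with X through the defining convergence.
  have h3 := (h2 (by simpa using (h2 hΨ).add (h2 hΨ'))).add (h2 hlim)
  simp only [mul_zero, add_zero] at h3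
  refine tendsto_of_tendsto_of_tendsto_of_le_of_le tendsto_const_nhds h3 (fun _ => zero_le)
    fun k => ?_
  have hm := (((hZ k).isCadlagSqIntMartingale hℱ).memLp T le_rfl).1
  have hm' := (((hZ' k).isCadlagSqIntMartingale hℱ).memLp T le_rfl).1
  refine (lintegral_enorm_sub_sq_triangle hm hm').trans ?_
  gcongr
  · exact IsSimpleIntegral.lintegral_sub_sq_le hℱ h𝓡 h𝓡_meas hμ hlam hN hI hC hΦ (hZ k) (hZ' k)
  · exact lintegral_le_supNormSq (fun t ω => Z' k t ω - X t ω)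

end StochasticIntegral

/-- Doob's inequality upgrades terminal convergence. Neither the isometry nor (I) enters, so this
applies to `M` as well. -/
theorem isStochasticIntegral_of_tendsto {Ω U H G : Type*} {mΩ : MeasurableSpace Ω}
    [NormedAddCommGroup H] [InnerProductSpace ℝ H] [CompleteSpace H]
    [NormedAddCommGroup G] [InnerProductSpace ℝ G] [CompleteSpace G] [SecondCountableTopology G]
    {P : Measure Ω} [IsProbabilityMeasure P] {ℱ : Filtration ℝ≥0 mΩ} {𝓡 : Set (Set U)}
    {N : ℝ≥0 → Set U → H →ₗ[ℝ] (Ω →ₘ[P] ℝ)} [MeasurableSpace U] {μ : Measure U}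
    {lam : Measure ℝ≥0} {p : ℝ≥0 → U → HilbertSeminorm H} {T : ℝ≥0} (hℱ : UsualConditions P ℱ)
    {Φ : OpFamily Ω G p} {Ψ : ℕ → SimpleIntegrand ℱ 𝓡 T H G}
    (hΨ : Tendsto (fun k => lambdaNormSq P μ lam T p
      (fun r ω u => (Ψ k).toFamily p r ω u - Φ r ω u)) atTop (𝓝 0)) {Z : ℕ → ℝ≥0 → Ω → G}
    (hZ : ∀ k, IsSimpleIntegral P ℱ 𝓡 T N (Ψ k) (Z k)) {X : ℝ≥0 → Ω → G}
    (hX : IsCadlagSqIntMartingale P ℱ T X)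
    (hlim : Tendsto (fun k => ∫⁻ ω, ‖Z k T ω - X T ω‖ₑ ^ 2 ∂P) atTop (𝓝 0)) :
    IsStochasticIntegral P ℱ 𝓡 μ lam T p N Φ X := by
  refine ⟨hX, Ψ, Z, hZ, hΨ, ?_⟩
  have h4 := ENNReal.Tendsto.const_mul (a := 4) hlim (Or.inr ENNReal.ofNat_ne_top)
  rw [mul_zero] at h4
  exact tendsto_of_tendsto_of_tendsto_of_le_of_le tendsto_const_nhds h4 (fun _ => zero_le)
    fun k => ((hZ k).isCadlagSqIntMartingale hℱ).supNormSq_sub_le hX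

/-! ### The sum of two cylindrical martingale-valued measures -/

theorem tendstoInMeasure_add {Ω : Type*} {mΩ : MeasurableSpace Ω} {P : Measure Ω}
    {E : Type*} [SeminormedAddCommGroup E] {ι : Type*}
    {l : Filter ι} {f f' : ι → Ω → E} {g g' : Ω → E} (hf : TendstoInMeasure P f l g)
    (hf' : TendstoInMeasure P f' l g') :
    TendstoInMeasure P (fun i ω => f i ω + f' i ω) l fun ω => g ω + g' ω := by
  intro ε hε
  have h := (hf (ε / 2) (ENNReal.half_pos hε.ne')).add (hf' (ε / 2) (ENNReal.half_pos hε.ne'))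
  rw [add_zero] at h
  refine tendsto_of_tendsto_of_tendsto_of_le_of_le tendsto_const_nhds h (fun _ => zero_le)
    fun i => (measure_mono fun ω hω => ?_).trans (measure_union_le _ _)
  by_contra hc
  simp only [mem_union, mem_ofPred_eq, not_or, not_le] at hc
  refine absurd (show ε ≤ edist (f i ω + f' i ω) (g ω + g' ω) from hω) (not_le.2 ?_)
  calc edist (f i ω + f' i ω) (g ω + g' ω) ≤ edist (f i ω) (g ω) + edist (f' i ω) (g' ω) :=
        edist_add_add_le _ _ _ _
    _ < ε / 2 + ε / 2 := ENNReal.add_lt_add hc.1 hc.2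
    _ = ε := ENNReal.add_halves ε

theorem Martingale.congr_ae {Ω : Type*} {mΩ : MeasurableSpace Ω} {P : Measure Ω}
    {ℱ : Filtration ℝ≥0 mΩ} (hℱ : UsualConditions P ℱ) {X Y : ℝ≥0 → Ω → ℝ}
    (hX : Martingale X ℱ P) (h : ∀ t, X t =ᵐ[P] Y t) : Martingale Y ℱ P :=
  ⟨fun t => hℱ.stronglyMeasurable_congr (hX.1 t) (h t), fun s t hst =>
    (condExp_congr_ae (h t).symm).trans ((hX.2 s t hst).trans (h s))⟩

/-- Events of the completion differ from events of the σ-algebra by null sets, which no probability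
sees. -/
theorem ProbabilityTheory.Indep.eventuallyMeasurableSpace_left {Ω : Type*}
    {m m' mΩ : MeasurableSpace Ω} {P : Measure Ω} (h : Indep m m' P) : Indep (eventuallyMeasurableSpace m (ae P)) m' P := by
  rw [Indep_iff] at h ⊢
  rintro s t ⟨s', hs', hss'⟩ ht
  rw [measure_congr hss', measure_congr (hss'.inter (ae_eq_refl t)), h s' t hs' ht]

theorem lintegral_lintegral_add_left {α β : Type*} [MeasurableSpace α] [MeasurableSpace β]
    {ν : Measure α} {μ : Measure β} [SFinite μ] {f : α → β → ℝ≥0∞}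
    (hf : Measurable fun x : α × β => f x.1 x.2) (g : α → β → ℝ≥0∞) :
    ∫⁻ a, ∫⁻ b, f a b + g a b ∂μ ∂ν = ∫⁻ a, ∫⁻ b, f a b ∂μ ∂ν + ∫⁻ a, ∫⁻ b, g a b ∂μ ∂ν := by
  rw [← lintegral_add_left hf.lintegral_prod_right']
  exact lintegral_congr fun a => lintegral_add_left (hf.comp measurable_prodMk_left) _

/-! ### Axioms, covariance and independence for the sum -/

section SumProperties

set_option linter.unusedSectionVars false

variable {Ω U H : Type*} {mΩ : MeasurableSpace Ω} [NormedAddCommGroup H] [InnerProductSpace ℝ H]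
  [CompleteSpace H] {P : Measure Ω} [IsProbabilityMeasure P] {ℱ : Filtration ℝ≥0 mΩ} {𝓡 : Set (Set U)}
  {N₁ N₂ M : ℝ≥0 → Set U → H →ₗ[ℝ] (Ω →ₘ[P] ℝ)}

theorem coeFn_sum_measure (hM : ∀ t, ∀ A ∈ 𝓡, M t A = N₁ t A + N₂ t A) {A : Set U} (hA : A ∈ 𝓡)
    (t : ℝ≥0) (h : H) : (fun ω => N₁ t A h ω + N₂ t A h ω) =ᵐ[P] M t A h := by
  rw [hM t A hA]
  exact (AEEqFun.coeFn_add _ _).symm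

/-- Independence factors the expectation, and one factor has mean zero. -/
theorem integral_mul_eq_zero_of_indep (hN₁ : IsCylMartingaleValuedMeasure P ℱ 𝓡 N₁)
    (hN₂ : IsCylMartingaleValuedMeasure P ℱ 𝓡 N₂)
    (hindep : ∀ A ∈ 𝓡, ∀ B ∈ 𝓡, Indep (cylProcessSigma N₁ A) (cylProcessSigma N₂ B) P)
    {A B : Set U} (hA : A ∈ 𝓡) (hB : B ∈ 𝓡) (t s : ℝ≥0) (h k : H) :
    ∫ ω, N₁ t A h ω * N₂ s B k ω ∂P = 0 := by
  have hi : IndepFun (N₁ t A h : Ω → ℝ) (N₂ s B k : Ω → ℝ) P := by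
    rw [IndepFun_iff_Indep]
    refine indep_of_indep_of_le (hindep A hA B hB) ?_ ?_
    · exact le_iSup_of_le t (le_iSup_of_le h le_rfl)
    · exact le_iSup_of_le s (le_iSup_of_le k le_rfl)
  rw [hi.integral_fun_mul_eq_mul_integral (hN₁.memLp t A hA h).1 (hN₂.memLp s B hB k).1,
    hN₁.mean_zero t A hA h, zero_mul]

theorem IsCylMartingaleValuedMeasure.sum (hℱ : UsualConditions P ℱ) (h𝓡 : IsSetRing 𝓡)
    (hN₁ : IsCylMartingaleValuedMeasure P ℱ 𝓡 N₁) (hN₂ : IsCylMartingaleValuedMeasure P ℱ 𝓡 N₂)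
    (hindep : ∀ A ∈ 𝓡, ∀ B ∈ 𝓡, Indep (cylProcessSigma N₁ A) (cylProcessSigma N₂ B) P)
    (hM : ∀ t, ∀ A ∈ 𝓡, M t A = N₁ t A + N₂ t A) : IsCylMartingaleValuedMeasure P ℱ 𝓡 M where
  zero_time A hA h := by
    rw [hM 0 A hA, LinearMap.add_apply, hN₁.zero_time A hA h, hN₂.zero_time A hA h, add_zero]
  empty t h := by
    rw [hM t ∅ h𝓡.empty_mem, LinearMap.add_apply, hN₁.empty, hN₂.empty, add_zero]
  union t A hA B hB hAB h := by
    rw [hM t _ (h𝓡.union_mem hA hB), hM t A hA, hM t B hB]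
    simp only [LinearMap.add_apply, hN₁.union t A hA B hB hAB, hN₂.union t A hA B hB hAB]
    abel
  martingale A hA h := Martingale.congr_ae hℱ
    ((hN₁.martingale A hA h).add (hN₂.martingale A hA h)) fun t => coeFn_sum_measure hM hA t h
  memLp t A hA h := (memLp_congr_ae (coeFn_sum_measure hM hA t h)).1
    ((hN₁.memLp t A hA h).add (hN₂.memLp t A hA h))
  mean_zero t A hA h := by
    rw [← integral_congr_ae (coeFn_sum_measure hM hA t h),
      integral_add ((hN₁.memLp t A hA h).integrable one_le_two)
        ((hN₂.memLp t A hA h).integrable one_le_two), hN₁.mean_zero t A hA h,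
      hN₂.mean_zero t A hA h, add_zero]
  continuous t A hA x h hx :=
    (tendstoInMeasure_add (hN₁.continuous t A hA x h hx) (hN₂.continuous t A hA x h hx)).congr
      (fun n => coeFn_sum_measure hM hA t (x n)) (coeFn_sum_measure hM hA t h)
  orthogonal A hA B hB hAB t s h k := by
    have e : (fun ω => M t A h ω * M s B k ω) =ᵐ[P] fun ω =>
        (N₁ t A h ω * N₁ s B k ω + N₁ t A h ω * N₂ s B k ω)
          + (N₁ s B k ω * N₂ t A h ω + N₂ t A h ω * N₂ s B k ω) := by
      filter_upwards [coeFn_sum_measure hM hA t h, coeFn_sum_measure hM hB s k] with ω h1 h2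
      rw [← h1, ← h2]
      ring
    have i1 := integrable_mul_of_memLp (hN₁.memLp t A hA h) (hN₁.memLp s B hB k)
    have i2 := integrable_mul_of_memLp (hN₁.memLp t A hA h) (hN₂.memLp s B hB k)
    have i3 := integrable_mul_of_memLp (hN₁.memLp s B hB k) (hN₂.memLp t A hA h)
    have i4 := integrable_mul_of_memLp (hN₂.memLp t A hA h) (hN₂.memLp s B hB k)
    have i12 : Integrable
        (fun ω => N₁ t A h ω * N₁ s B k ω + N₁ t A h ω * N₂ s B k ω) P := i1.add i2
    have i34 : Integrable
        (fun ω => N₁ s B k ω * N₂ t A h ω + N₂ t A h ω * N₂ s B k ω) P := i3.add i4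
    rw [integral_congr_ae e, integral_add i12 i34, integral_add i1 i2,
      integral_add i3 i4, hN₁.orthogonal A hA B hB hAB, hN₂.orthogonal A hA B hB hAB,
      integral_mul_eq_zero_of_indep hN₁ hN₂ hindep hA hB,
      integral_mul_eq_zero_of_indep hN₁ hN₂ hindep hB hA]
    simp

theorem integral_cylIncr_mul_of_indep (hN₁ : IsCylMartingaleValuedMeasure P ℱ 𝓡 N₁)
    (hN₂ : IsCylMartingaleValuedMeasure P ℱ 𝓡 N₂)
    (hindep : ∀ A ∈ 𝓡, ∀ B ∈ 𝓡, Indep (cylProcessSigma N₁ A) (cylProcessSigma N₂ B) P)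
    {A : Set U} (hA : A ∈ 𝓡) (s t : ℝ≥0) (h : H) :
    ∫ ω, cylIncr N₁ s t A h ω * cylIncr N₂ s t A h ω ∂P = 0 := by
  have hi : ∀ r r', Integrable (fun ω => N₁ r A h ω * N₂ r' A h ω) P := fun r r' =>
    integrable_mul_of_memLp (hN₁.memLp r A hA h) (hN₂.memLp r' A hA h)
  have e : (fun ω => cylIncr N₁ s t A h ω * cylIncr N₂ s t A h ω) =ᵐ[P] fun ω =>
      (N₁ t A h ω * N₂ t A h ω - N₁ t A h ω * N₂ s A h ω)
        - (N₁ s A h ω * N₂ t A h ω - N₁ s A h ω * N₂ s A h ω) := by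
    filter_upwards [coeFn_cylIncr (N := N₁) s t A h, coeFn_cylIncr (N := N₂) s t A h] with ω h1 h2
    rw [h1, h2]
    ring
  have hi' : ∀ r, Integrable
      (fun ω => N₁ r A h ω * N₂ t A h ω - N₁ r A h ω * N₂ s A h ω) P := fun r =>
    (hi r t).sub (hi r s)
  rw [integral_congr_ae e, integral_sub (hi' t) (hi' s),
    integral_sub (hi t t) (hi t s), integral_sub (hi s t) (hi s s)]
  simp only [integral_mul_eq_zero_of_indep hN₁ hN₂ hindep hA hA, sub_zero]

/-- On expanding the square, the cross term of the two independent increments has mean zero. -/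
theorem lintegral_enorm_sq_cylIncr_sum (hN₁ : IsCylMartingaleValuedMeasure P ℱ 𝓡 N₁)
    (hN₂ : IsCylMartingaleValuedMeasure P ℱ 𝓡 N₂)
    (hindep : ∀ A ∈ 𝓡, ∀ B ∈ 𝓡, Indep (cylProcessSigma N₁ A) (cylProcessSigma N₂ B) P)
    (hM : ∀ t, ∀ A ∈ 𝓡, M t A = N₁ t A + N₂ t A) {A : Set U} (hA : A ∈ 𝓡) (s t : ℝ≥0) (h : H) :
    ∫⁻ ω, ‖cylIncr M s t A h ω‖ₑ ^ 2 ∂P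
      = ∫⁻ ω, ‖cylIncr N₁ s t A h ω‖ₑ ^ 2 ∂P + ∫⁻ ω, ‖cylIncr N₂ s t A h ω‖ₑ ^ 2 ∂P := by
  have h1 := hN₁.memLp_cylIncr hA s t h
  have h2 := hN₂.memLp_cylIncr hA s t h
  have e : (fun ω => ‖cylIncr M s t A h ω‖ ^ 2) =ᵐ[P] fun ω =>
      (‖cylIncr N₁ s t A h ω‖ ^ 2 + ‖cylIncr N₂ s t A h ω‖ ^ 2)
        + 2 * (cylIncr N₁ s t A h ω * cylIncr N₂ s t A h ω) := by
    filter_upwards [cylIncr_sum_measure hM hA s t h] with ω hω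
    rw [hω]
    simp only [Real.norm_eq_abs, sq_abs]
    ring
  have hMm : MemLp (cylIncr M s t A h) 2 P :=
    (memLp_congr_ae (cylIncr_sum_measure hM hA s t h)).2 (h1.add h2)
  have h12 : Integrable
      (fun ω => ‖cylIncr N₁ s t A h ω‖ ^ 2 + ‖cylIncr N₂ s t A h ω‖ ^ 2) P :=
    h1.integrable_norm_sq.add h2.integrable_norm_sq
  rw [lintegral_enorm_sq_eq_ofReal hMm, lintegral_enorm_sq_eq_ofReal h1,
    lintegral_enorm_sq_eq_ofReal h2, ← ENNReal.ofReal_add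
      (integral_nonneg fun _ => sq_nonneg _) (integral_nonneg fun _ => sq_nonneg _),
    integral_congr_ae e, integral_add h12 ((integrable_mul_of_memLp h1 h2).const_mul 2),
    integral_add h1.integrable_norm_sq h2.integrable_norm_sq, integral_const_mul,
    integral_cylIncr_mul_of_indep hN₁ hN₂ hindep hA, mul_zero, add_zero]

theorem HasCovariance.sum [MeasurableSpace U] {μ : Measure U} [SFinite μ] {lam : Measure ℝ≥0}
    {p₁ p₂ : ℝ≥0 → U → HilbertSeminorm H}
    (hN₁ : IsCylMartingaleValuedMeasure P ℱ 𝓡 N₁) (hN₂ : IsCylMartingaleValuedMeasure P ℱ 𝓡 N₂)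
    (hindep : ∀ A ∈ 𝓡, ∀ B ∈ 𝓡, Indep (cylProcessSigma N₁ A) (cylProcessSigma N₂ B) P)
    (hM : ∀ t, ∀ A ∈ 𝓡, M t A = N₁ t A + N₂ t A)
    (hC₁ : HasCovariance P 𝓡 μ lam p₁ N₁) (hC₂ : HasCovariance P 𝓡 μ lam p₂ N₂) :
    HasCovariance P 𝓡 μ lam (fun r u => (p₁ r u).hilbertSum (p₂ r u)) M where
  measurable_form h k := (hC₁.measurable_form h k).add (hC₂.measurable_form h k)
  bounded_form T h k := by
    obtain ⟨C₁, h₁⟩ := hC₁.bounded_form T h k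
    obtain ⟨C₂, h₂⟩ := hC₂.bounded_form T h k
    exact ⟨C₁ + C₂, fun r hr u => (abs_add_le _ _).trans (add_le_add (h₁ r hr u) (h₂ r hr u))⟩
  covariance A hA s t hst h := by
    have hm : Measurable fun x : ℝ≥0 × U => (p₁ x.1 x.2) h ^ 2 := by
      simp only [HilbertSeminorm.sq_apply]
      exact hC₁.measurable_form h h
    refine (lintegral_enorm_sq_cylIncr_sum hN₁ hN₂ hindep hM hA s t h).trans ?_
    rw [hC₁.covariance A hA s t hst h, hC₂.covariance A hA s t hst h,
      ← lintegral_lintegral_add_left hm.ennreal_ofReal]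
    refine lintegral_congr fun r => lintegral_congr fun u => ?_
    rw [HilbertSeminorm.hilbertSum_sq, ENNReal.ofReal_add (sq_nonneg _) (sq_nonneg _)]

/-- The chosen representative of an increment of `M` equals the sum of the other two representatives
only almost surely, which forces the passage to the completion. -/
theorem JointIncrementsIndepPast.sum (hM : ∀ t, ∀ A ∈ 𝓡, M t A = N₁ t A + N₂ t A)
    (hI : JointIncrementsIndepPast P ℱ 𝓡 N₁ N₂) : IncrementsIndepPast P ℱ 𝓡 M := by
  intro s t hst
  refine indep_of_indep_of_le_left (hI s t hst).eventuallyMeasurableSpace_left ?_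
  refine iSup₂_le fun A hA => iSup_le fun h => ?_
  have h1 : Measurable[incrementSigma 𝓡 N₁ s t ⊔ incrementSigma 𝓡 N₂ s t] (cylIncr N₁ s t A h) :=
    measurable_iff_comap_le.2 (le_sup_of_le_left
      (le_iSup₂_of_le A hA (le_iSup_of_le h le_rfl)))
  have h2 : Measurable[incrementSigma 𝓡 N₁ s t ⊔ incrementSigma 𝓡 N₂ s t] (cylIncr N₂ s t A h) :=
    measurable_iff_comap_le.2 (le_sup_of_le_right
      (le_iSup₂_of_le A hA (le_iSup_of_le h le_rfl)))
  rintro _ ⟨B, hB, rfl⟩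
  refine ⟨(fun ω => cylIncr N₁ s t A h ω + cylIncr N₂ s t A h ω) ⁻¹' B, (h1.add h2) hB, ?_⟩
  filter_upwards [cylIncr_sum_measure hM hA s t h] with ω hω
  exact congrArg (· ∈ B) hω

end SumProperties

/-! ### The proposition -/

theorem mainTheorem9
    {Ω U H G : Type*} {mΩ : MeasurableSpace Ω}
    -- filtered probability space
    (P : Measure Ω) [IsProbabilityMeasure P]
    (ℱ : Filtration ℝ≥0 mΩ) (hℱ : UsualConditions P ℱ)
    -- real separable Hilbert spaces
    [NormedAddCommGroup H] [InnerProductSpace ℝ H] [CompleteSpace H] [SecondCountableTopology H]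
    [NormedAddCommGroup G] [InnerProductSpace ℝ G] [CompleteSpace G] [SecondCountableTopology G]
    -- a topological space with a ring of Borel sets generating the Borel sets
    [TopologicalSpace U] [mU : MeasurableSpace U] [BorelSpace U]
    (𝓡 : Set (Set U)) (h𝓡 : IsSetRing 𝓡) (h𝓡_meas : ∀ A ∈ 𝓡, MeasurableSet A)
    (h𝓡_gen : MeasurableSpace.generateFrom 𝓡 = mU)
    -- the measures
    (μ : Measure U) [SigmaFinite μ] (hμ : ∀ A ∈ 𝓡, μ A < ∞)
    (hμ_cover : ∃ A : ℕ → Set U, (∀ n, A n ∈ 𝓡) ∧ μ (⋃ n, A n)ᶜ = 0)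
    (lam : Measure ℝ≥0) [SigmaFinite lam] (hlam : ∀ t, lam (Iic t) < ∞)
    -- the two cylindrical martingale-valued measures
    (p₁ p₂ : ℝ≥0 → U → HilbertSeminorm H)
    (N₁ N₂ : ℝ≥0 → Set U → H →ₗ[ℝ] (Ω →ₘ[P] ℝ))
    (hN₁ : IsCylMartingaleValuedMeasure P ℱ 𝓡 N₁) (hN₁_indep : IncrementsIndepPast P ℱ 𝓡 N₁)
    (hN₁_cov : HasCovariance P 𝓡 μ lam p₁ N₁)
    (hN₂ : IsCylMartingaleValuedMeasure P ℱ 𝓡 N₂) (hN₂_indep : IncrementsIndepPast P ℱ 𝓡 N₂)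
    (hN₂_cov : HasCovariance P 𝓡 μ lam p₂ N₂)
    (hindep : ∀ A ∈ 𝓡, ∀ B ∈ 𝓡, Indep (cylProcessSigma N₁ A) (cylProcessSigma N₂ B) P)
    -- their sum, and the family of seminorms `q` with `q² = p₁² + p₂²`
    (M : ℝ≥0 → Set U → H →ₗ[ℝ] (Ω →ₘ[P] ℝ)) (hM : ∀ t, ∀ A ∈ 𝓡, M t A = N₁ t A + N₂ t A)
    (q : ℝ≥0 → U → HilbertSeminorm H) (hq : q = fun r u => (p₁ r u).hilbertSum (p₂ r u)) :
    (∀ r u h, q r u h ^ 2 = p₁ r u h ^ 2 + p₂ r u h ^ 2) ∧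
    IsCylMartingaleValuedMeasure P ℱ 𝓡 M ∧
    HasCovariance P 𝓡 μ lam q M ∧
    (JointIncrementsIndepPast P ℱ 𝓡 N₁ N₂ → IncrementsIndepPast P ℱ 𝓡 M) ∧
    ∃ (hp₁ : ∀ r u h, p₁ r u h ≤ q r u h) (hp₂ : ∀ r u h, p₂ r u h ≤ q r u h),
    ∀ T : ℝ≥0, 0 < T → ∀ Φ : OpFamily Ω G q, MemLambda2 P ℱ μ lam T q Φ →
      MemLambda2 P ℱ μ lam T p₁ (Φ.compInclAdjoint p₁ hp₁) ∧
      MemLambda2 P ℱ μ lam T p₂ (Φ.compInclAdjoint p₂ hp₂) ∧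
      (∃ X, IsStochasticIntegral P ℱ 𝓡 μ lam T q M Φ X) ∧
      (∃ X₁, IsStochasticIntegral P ℱ 𝓡 μ lam T p₁ N₁ (Φ.compInclAdjoint p₁ hp₁) X₁) ∧
      (∃ X₂, IsStochasticIntegral P ℱ 𝓡 μ lam T p₂ N₂ (Φ.compInclAdjoint p₂ hp₂) X₂) ∧
      ∀ X X₁ X₂ : ℝ≥0 → Ω → G,
        IsStochasticIntegral P ℱ 𝓡 μ lam T q M Φ X →
        IsStochasticIntegral P ℱ 𝓡 μ lam T p₁ N₁ (Φ.compInclAdjoint p₁ hp₁) X₁ →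
        IsStochasticIntegral P ℱ 𝓡 μ lam T p₂ N₂ (Φ.compInclAdjoint p₂ hp₂) X₂ →
        ∀ᵐ ω ∂P, ∀ t ≤ T, X t ω = X₁ t ω + X₂ t ω := by
  subst hq
  have hMm := hN₁.sum hℱ h𝓡 hN₂ hindep hM
  have hMC := HasCovariance.sum hN₁ hN₂ hindep hM hN₁_cov hN₂_cov
  refine ⟨fun r u h => HilbertSeminorm.hilbertSum_sq _ _ h, hMm, hMC,
    JointIncrementsIndepPast.sum hM, fun r u h => HilbertSeminorm.left_le_hilbertSum _ _ h,
    fun r u h => HilbertSeminorm.right_le_hilbertSum _ _ h, fun T _ Φ hΦ => ?_⟩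
  have hΦ₁ := hΦ.compInclAdjoint hMC.measurable_form hN₁_cov.measurable_form
    fun r u h => HilbertSeminorm.left_le_hilbertSum (p₁ r u) (p₂ r u) h
  have hΦ₂ := hΦ.compInclAdjoint hMC.measurable_form hN₂_cov.measurable_form
    fun r u h => HilbertSeminorm.right_le_hilbertSum (p₁ r u) (p₂ r u) h
  -- Any simple data approximating Φ for q approximate the restricted family for p₁; this is used
  -- both for existence and for the decomposition.
  have hproj₁ := fun {Ψ : ℕ → SimpleIntegrand ℱ 𝓡 T H G} hΨ =>
    tendsto_of_tendsto_of_tendsto_of_le_of_le (b := atTop) tendsto_const_nhds hΨ (fun _ => zero_le)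
      fun k => lambdaNormSq_toFamily_sub_compInclAdjoint_le (P := P) (μ := μ) (lam := lam)
        (fun r u h => HilbertSeminorm.left_le_hilbertSum (p₁ r u) (p₂ r u) h) Φ (Ψ k)
  have hproj₂ := fun {Ψ : ℕ → SimpleIntegrand ℱ 𝓡 T H G} hΨ =>
    tendsto_of_tendsto_of_tendsto_of_le_of_le (b := atTop) tendsto_const_nhds hΨ (fun _ => zero_le)
      fun k => lambdaNormSq_toFamily_sub_compInclAdjoint_le (P := P) (μ := μ) (lam := lam)
        (fun r u h => HilbertSeminorm.right_le_hilbertSum (p₁ r u) (p₂ r u) h) Φ (Ψ k)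
  have hadd : ∀ {Z₁ Z₂ : ℕ → ℝ≥0 → Ω → G} {X₁ X₂ : ℝ≥0 → Ω → G},
      (∀ k, AEStronglyMeasurable (Z₁ k T) P) → AEStronglyMeasurable (X₁ T) P →
      Tendsto (fun k => ∫⁻ ω, ‖Z₁ k T ω - X₁ T ω‖ₑ ^ 2 ∂P) atTop (𝓝 0) →
      Tendsto (fun k => ∫⁻ ω, ‖Z₂ k T ω - X₂ T ω‖ₑ ^ 2 ∂P) atTop (𝓝 0) →
      Tendsto (fun k => ∫⁻ ω, ‖(Z₁ k T ω + Z₂ k T ω) - (X₁ T ω + X₂ T ω)‖ₑ ^ 2 ∂P)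
        atTop (𝓝 0) := by
    intro Z₁ Z₂ X₁ X₂ hZ hX h₁ h₂
    have h := (ENNReal.Tendsto.const_mul (a := 2) h₁ (Or.inr ENNReal.ofNat_ne_top)).add
      (ENNReal.Tendsto.const_mul (a := 2) h₂ (Or.inr ENNReal.ofNat_ne_top))
    rw [mul_zero, add_zero] at h
    refine tendsto_of_tendsto_of_tendsto_of_le_of_le tendsto_const_nhds h (fun _ => zero_le)
      fun k => ?_
    simp only [add_sub_add_comm]
    exact lintegral_enorm_add_sq_le ((hZ k).sub hX)
  refine ⟨hΦ₁, hΦ₂, ?_⟩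
  have hsimple₁ := fun Ψ : SimpleIntegrand ℱ 𝓡 T H G =>
    Ψ.exists_isSimpleIntegral hℱ hN₁ hN₁_cov hμ hlam
  have hsimple₂ := fun Ψ : SimpleIntegrand ℱ 𝓡 T H G =>
    Ψ.exists_isSimpleIntegral hℱ hN₂ hN₂_cov hμ hlam
  obtain ⟨Ψ, hΨ⟩ := exists_simpleIntegrand_tendsto h𝓡 h𝓡_meas h𝓡_gen hμ hμ_cover hlam
    hMC.measurable_form hMC.bounded_form hΦ.predictable hΦ.norm_lt_top
  choose Z₁ hZ₁ using fun k => hsimple₁ (Ψ k)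
  choose Z₂ hZ₂ using fun k => hsimple₂ (Ψ k)
  obtain ⟨X₁, hX₁, hl₁⟩ := exists_limit_simpleIntegral hℱ h𝓡 h𝓡_meas hμ hlam hN₁ hN₁_indep
    hN₁_cov hΦ₁.predictable (hproj₁ hΨ) hZ₁
  obtain ⟨X₂, hX₂, hl₂⟩ := exists_limit_simpleIntegral hℱ h𝓡 h𝓡_meas hμ hlam hN₂ hN₂_indep
    hN₂_cov hΦ₂.predictable (hproj₂ hΨ) hZ₂
  -- The integral against `M` is obtained as the sum of the two limits along common data, since no
  -- isometry is at hand for `M`.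
  refine ⟨⟨_, isStochasticIntegral_of_tendsto hℱ hΨ
      (fun k => (hZ₁ k).add_measure hM (hZ₂ k)) (hX₁.add hX₂)
      (hadd (fun k => (((hZ₁ k).isCadlagSqIntMartingale hℱ).memLp T le_rfl).1)
        (hX₁.memLp T le_rfl).1 hl₁ hl₂)⟩,
    ⟨X₁, isStochasticIntegral_of_tendsto hℱ (hproj₁ hΨ) hZ₁ hX₁ hl₁⟩,
    ⟨X₂, isStochasticIntegral_of_tendsto hℱ (hproj₂ hΨ) hZ₂ hX₂ hl₂⟩, ?_⟩
  clear hl₂ hX₂ X₂ hl₁ hX₁ X₁ hZ₂ Z₂ hZ₁ Z₁ hΨ Ψ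
  rintro X X₁ X₂ ⟨hX, Ψ, Z, hZ, hΨ, hlim⟩ hX₁ hX₂
  -- The sequence Ψ comes from the given X; the same data are integrated against `N₁` and `N₂`,
  -- irrespective of the sequences that define X₁ and X₂.
  choose Z₁ hZ₁ using fun k => hsimple₁ (Ψ k)
  choose Z₂ hZ₂ using fun k => hsimple₂ (Ψ k)
  have hZ₁m := fun k => (((hZ₁ k).isCadlagSqIntMartingale hℱ).memLp T le_rfl).1
  have hl := hadd hZ₁m (hX₁.1.memLp T le_rfl).1
    (hX₁.tendsto_simpleIntegral hℱ h𝓡 h𝓡_meas hμ hlam hN₁ hN₁_indep hN₁_cov hΦ₁.predictable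
      (hproj₁ hΨ) hZ₁)
    (hX₂.tendsto_simpleIntegral hℱ h𝓡 h𝓡_meas hμ hlam hN₂ hN₂_indep hN₂_cov hΦ₂.predictable
      (hproj₂ hΨ) hZ₂)
  have hl' : Tendsto (fun k => ∫⁻ ω, ‖Z k T ω - X T ω‖ₑ ^ 2 ∂P) atTop (𝓝 0) :=
    tendsto_of_tendsto_of_tendsto_of_le_of_le tendsto_const_nhds hlim (fun _ => zero_le)
      fun k => lintegral_le_supNormSq (fun t ω => Z k t ω - X t ω)
  -- Integrals of the same simple data against `M` agree almost surely, so Z k may be replaced by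
  -- its splitting; the two L² limits at T then coincide, and càdlàg martingales are determined by
  -- their terminal values.
  have hZZ : ∀ k, Z k T =ᵐ[P] fun ω => Z₁ k T ω + Z₂ k T ω := fun k =>
    (hZ k).ae_eq ((hZ₁ k).add_measure hM (hZ₂ k)) le_rfl
  have hl'' : Tendsto (fun k => ∫⁻ ω, ‖(Z₁ k T ω + Z₂ k T ω) - X T ω‖ₑ ^ 2 ∂P) atTop (𝓝 0) := by
    refine hl'.congr fun k => lintegral_congr_ae ?_
    filter_upwards [hZZ k] with ω hω
    rw [hω]
  exact hX.indistinguishable (hX₁.1.add hX₂.1) (ae_eq_of_tendsto_lintegral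
    (fun k => (hZ₁m k).add (((hZ₂ k).isCadlagSqIntMartingale hℱ).memLp T le_rfl).1)
    (hX.memLp T le_rfl).1 ((hX₁.1.add hX₂.1).memLp T le_rfl).1 hl'' hl)
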